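/- Let $n\ge 1$ and let $\Gamma(A_{n-1})$ be the cluster complex of type $A_{n-1}$: its vertices are the almost positive roots of the root system $\{e_i-e_j : i\neq j\}$ of $\mathfrak S_n$ (the positive roots $e_i-e_j$, $i<j$, and the opposites of the simple roots), and its faces are the sets of pairwise compatible almost positive roots. Here the simple system is split as $\Delta=\Delta_+\sqcup\Delta_-$ into two sets of pairwise orthogonal simple roots (either of the two ways), $c_\pm=\prod_{\alpha\in\Delta_\pm}s_\alpha$, $c=c_+c_-$, the rotation $\mathcal R$ of the almost positive roots is $\mathcal R(\alpha)=-\alpha$ if $\alpha\in(-\Delta_+)\cup\Delta_-$ and $\mathcal R(\alpha)=c(\alpha)$ otherwise, and compatibility is the $\mathcal R$-invariant relation for which $-\alpha$ $(\alpha\in\Delta)$ is compatible with $\beta$ if and only if $\alpha$ does not appear in the decomposition of $\beta$ in simple roots. For a face $f$, order its elements so that the product $w$ of the corresponding reflections lies in the interval $[e,c]$ of the absolute order; the parabolic type of $f$ is the partition $\lambda\vdash n$ formed by the block sizes of the parabolic (Young) subgroup of $\mathfrak S_n$ that is the pointwise stabilizer of $\mathrm{Fix}(c_+wc_-)\subseteq\mathbb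 R^n$. (a) There is a bijection from the almost positive roots to the diagonals of an $(n+2)$-gon with cyclically labelled vertices that carries $\mathcal R$ to the rotation of the polygon by one step, and under which two distinct roots are compatible if and only if the corresponding diagonals do not cross. So the faces of $\Gamma(A_{n-1})$ correspond to the dissections of the $(n+2)$-gon, and $\mathcal R$ to polygon rotation. (b) For every partition $\lambda=[1^{n_1},2^{n_2},\dots,k^{n_k}]\vdash n$ with $l=n_1+\dots+n_k$ parts, the rotation $\mathcal R$ defines an action of the cyclic group $C_{n+2}$ on the set $\Gamma(A_{n-1})_\lambda$ of faces of parabolic type $\lambda$, a fixed generator acting by $\mathcal R$; the $q$-multinomial coefficient $$\begin{bmatrix} n+l\\ n_1,\dots,n_k,n\end{bmatrix}_q=\frac{[n+l]_q!}{[n_1]_q!\cdots[n_k]_q!\,[n]_q!}$$ and $$\mu_\lambda(q)=\frac{1}{[n+1]_q}\begin{bmatrix} n+l\\ n_1,\dots,n_k,n\end{bmatrix}_q$$ are polynomials in $q$ with integer coefficients, where $[m]_q=1+q+\dots+q^{m-1}$ and $[m]_q!=[1]_q\cdots[m]_q$; and $(\Gamma(A_{n-1})_\lambda,C_{n+2},\mu_\lambda(q))$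 exhibits the cyclic sieving phenomenon: for every $g\in C_{n+2}$, if $d$ is the order of $g$, then $\mu_\lambda(e^{2\pi i/d})$ is the number of faces in $\Gamma(A_{n-1})_\lambda$ fixed by $g$. -/

import Mathlib

open Polynomial

/-! ### The cyclic sieving phenomenon -/

/-- `(X, C, P)` exhibits the cyclic sieving phenomenon: `P(exp(2πi/d))` is the number of points of
`X` fixed by `g`, for every `g ∈ C`, where `d` is the order of `g`. -/
def ExhibitsCSP (C : Type) [Group C] [Finite C] [IsCyclic C] (X : Type) [Finite X]
    [MulAction C X] (P : ℤ[X]) : Prop :=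
  ∀ g : C, aeval (Complex.exp (2 * Real.pi * Complex.I / (orderOf g : ℂ))) P
    = (Nat.card (MulAction.fixedBy X g) : ℂ)

/-! ### `q`-integers and `q`-factorials -/

/-- `[m]_q = 1 + q + ⋯ + q^(m-1)`. -/
noncomputable def qInt (m : ℕ) : ℤ[X] := ∑ i ∈ Finset.range m, X ^ i

/-- `[m]_q! = [1]_q [2]_q ⋯ [m]_q`. -/
noncomputable def qFactorial (m : ℕ) : ℤ[X] := ∏ i ∈ Finset.range m, qInt (i + 1)

namespace TypeA

/-! ### The root system `A_{n-1}` and its Weyl group `S_n` -/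

/-- The roots of `A_{n-1}`: the pair `(i, j)`, `i ≠ j`, stands for the vector `e_i - e_j` of
`ℝ^n`. The Weyl group `S_n = Equiv.Perm (Fin n)` permutes coordinates. -/
abbrev Root (n : ℕ) : Type := {p : Fin n × Fin n // p.1 ≠ p.2}

/-- The opposite root. -/
def Root.neg {n : ℕ} (a : Root n) : Root n := ⟨(a.1.2, a.1.1), a.2.symm⟩

/-- The action of `S_n` on the roots, `w (e_i - e_j) = e_{w i} - e_{w j}`. -/
def Root.act {n : ℕ} (w : Equiv.Perm (Fin n)) (a : Root n) : Root n :=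
  ⟨(w a.1.1, w a.1.2), fun h => a.2 (w.injective h)⟩

/-- The reflection associated with the root `e_i - e_j` is the transposition `(i j)`. -/
def Root.refl {n : ℕ} (a : Root n) : Equiv.Perm (Fin n) := Equiv.swap a.1.1 a.1.2

/-- `a` is positive: `a = e_i - e_j` with `i < j`. -/
def Root.IsPos {n : ℕ} (a : Root n) : Prop := a.1.1 < a.1.2

/-- `a` is the simple root `α_k = e_k - e_{k+1}` (indices start at `0`). -/
def Root.IsSimple {n : ℕ} (k : ℕ) (a : Root n) : Prop :=
  (a.1.1 : ℕ) = k ∧ (a.1.2 : ℕ) = k + 1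

/-- `a` is an almost positive root: a positive root or the opposite of a simple root. -/
def Root.IsAlmostPos {n : ℕ} (a : Root n) : Prop :=
  a.IsPos ∨ ∃ k, a.neg.IsSimple k

/-- The simple root `α_k` appears in the decomposition of `a` in simple roots. If `i < j`,
then `e_i - e_j = α_i + ⋯ + α_{j-1}`; opposite roots have the same support. -/
def Root.Appears {n : ℕ} (k : ℕ) (a : Root n) : Prop :=
  ((a.1.1 : ℕ) ≤ k ∧ k < (a.1.2 : ℕ)) ∨ ((a.1.2 : ℕ) ≤ k ∧ k < (a.1.1 : ℕ))

/-- The simple reflection `s_k = (k, k+1)`, for `k + 1 < n`. -/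
def simpleRefl (n k : ℕ) : Equiv.Perm (Fin n) :=
  if h : k + 1 < n then Equiv.swap ⟨k, Nat.lt_of_succ_lt h⟩ ⟨k + 1, h⟩ else 1

/-! ### Bipartite Coxeter element and rotation

The simple roots are split into two sets `Δ_+`, `Δ_-` of pairwise orthogonal roots, that is, by the
parity of their index. The parameter `ε` says which parity is `Δ_+`. -/

/-- `c_+`, the product of the (commuting) simple reflections with index of parity `ε`. -/
def cPlus (n : ℕ) (ε : Fin 2) : Equiv.Perm (Fin n) :=
  (((List.range (n - 1)).filter (fun k => decide (k % 2 = ε.val))).map (simpleRefl n)).prod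

/-- `c_-`, the product of the other simple reflections. -/
def cMinus (n : ℕ) (ε : Fin 2) : Equiv.Perm (Fin n) :=
  (((List.range (n - 1)).filter (fun k => decide (k % 2 ≠ ε.val))).map (simpleRefl n)).prod

/-- The bipartite Coxeter element `c = c_+ c_-`. -/
def cox (n : ℕ) (ε : Fin 2) : Equiv.Perm (Fin n) := cPlus n ε * cMinus n ε

open Classical in
/-- The Fomin-Zelevinsky rotation: `R(a) = -a` if `a ∈ (-Δ_+) ∪ Δ_-`, and `R(a) = c(a)` otherwise.
It is only meant to be applied to almost positive roots. -/
noncomputable def rotate {n : ℕ} (ε : Fin 2) (a : Root n) : Root n :=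
  if (∃ k, k % 2 = ε.val ∧ a.neg.IsSimple k) ∨ (∃ k, k % 2 ≠ ε.val ∧ a.IsSimple k)
  then a.neg else a.act (cox n ε)

/-- The compatibility relation on almost positive roots: it is invariant under the rotation, and
`-α_k` is compatible with `b` iff `α_k` does not appear in `b`. -/
def Compat {n : ℕ} (ε : Fin 2) (a b : Root n) : Prop :=
  ∃ r k : ℕ, ((rotate ε)^[r] a).neg.IsSimple k ∧ ¬ ((rotate ε)^[r] b).Appears k

/-- The faces of the cluster complex `Γ(A_{n-1})`: the finite sets of almost positive roots that
are pairwise compatible (including the empty set). -/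
def IsFace {n : ℕ} (ε : Fin 2) (f : Finset (Root n)) : Prop :=
  (∀ a ∈ f, a.IsAlmostPos) ∧ ∀ a ∈ f, ∀ b ∈ f, a ≠ b → Compat ε a b

/-! ### Noncrossing partitions and parabolic types -/

/-- The reflection length of `w`: the least length of a factorization of `w` into
transpositions. -/
noncomputable def reflLength {n : ℕ} (w : Equiv.Perm (Fin n)) : ℕ :=
  sInf {m | ∃ L : List (Equiv.Perm (Fin n)), (∀ t ∈ L, t.IsSwap) ∧ L.prod = w ∧ L.length = m}

/-- `w` lies in the interval `[1, c]` of the absolute order. -/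
def IsNC {n : ℕ} (ε : Fin 2) (w : Equiv.Perm (Fin n)) : Prop :=
  reflLength (cox n ε) = reflLength w + reflLength (w⁻¹ * cox n ε)

/-- The parabolic subgroup attached to `u`: the pointwise stabilizer of the fixed space
`Fix(u) ⊆ ℝ^n`. -/
def parabolic {n : ℕ} (u : Equiv.Perm (Fin n)) : Subgroup (Equiv.Perm (Fin n)) where
  carrier := {σ | ∀ v : Fin n → ℝ, (∀ i, v (u i) = v i) → ∀ i, v (σ i) = v i}
  one_mem' := fun _ _ _ => rfl
  mul_mem' := fun {σ τ} hσ hτ v hv i => (hσ v hv (τ i)).trans (hτ v hv i)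
  inv_mem' := fun {σ} hσ v hv i => by
    have h := hσ v hv (σ⁻¹ i)
    simpa using h.symm

/-- `H` is the parabolic subgroup `S_{B_1} × ⋯ × S_{B_r}` of a set partition `{B_1, …, B_r}` of
`Fin n` whose block sizes are the parts of the integer partition `lam`. The parabolic
subgroups with this property form one conjugacy class. -/
def SubgroupHasType {n : ℕ} (H : Subgroup (Equiv.Perm (Fin n))) (lam : n.Partition) : Prop :=
  ∃ B : Finpartition (Finset.univ : Finset (Fin n)),
    (∀ σ, σ ∈ H ↔ ∀ b ∈ B.parts, ∀ i ∈ b, σ i ∈ b) ∧ B.parts.val.map Finset.card = lam.parts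

/-- The face `f` has parabolic type `lam`: for an ordering of `f` such that the product `w` of the
reflections of its elements is in `[1, c]`, the parabolic subgroup attached to the bipartite
Kreweras complement `c_+ w c_-` has type `lam`. -/
def HasParabolicType {n : ℕ} (ε : Fin 2) (f : Finset (Root n)) (lam : n.Partition) : Prop :=
  ∃ L : List (Root n), L.Nodup ∧ (∀ a, a ∈ L ↔ a ∈ f) ∧ IsNC ε (L.map Root.refl).prod ∧
    SubgroupHasType (parabolic (cPlus n ε * (L.map Root.refl).prod * cMinus n ε)) lam

/-- The set of faces of `Γ(A_{n-1})` of parabolic type `lam`. -/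
abbrev TypedFace (n : ℕ) (ε : Fin 2) (lam : n.Partition) : Type :=
  {f : Finset (Root n) // IsFace ε f ∧ HasParabolicType ε f lam}

/-! ### The polygon -/

/-- The diagonals of the polygon with `N` vertices, labelled cyclically by
`Fin N` (addition modulo `N`): pairs of distinct vertices that are not neighbours. -/
def IsDiagonal {N : ℕ} [NeZero N] (d : Sym2 (Fin N)) : Prop :=
  ∃ a b : Fin N, d = s(a, b) ∧ a ≠ b ∧ a + 1 ≠ b ∧ b + 1 ≠ a

/-- The two diagonals cross in the interior of the polygon. -/
def Cross {N : ℕ} (d e : Sym2 (Fin N)) : Prop :=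
  ∃ a x b y : Fin N, a < x ∧ x < b ∧ b < y ∧
    ((d = s(a, b) ∧ e = s(x, y)) ∨ (e = s(a, b) ∧ d = s(x, y)))

end TypeA

/-! ### `q`-factorials, cyclotomic factors and values at roots of unity -/

/-! Geometry. Number the vertices of the (n+2)-gon along a zigzag whose consecutive steps are the
opposites of the simple roots, and let e_i - e_j be the diagonal joining the zigzag vertices i and j
+ 2. The bipartite Coxeter element moves almost every index two steps along the zigzag, so R becomes
rotation by one vertex (`TypeA.diagonal_rotate`). A zigzag diagonal separates the earlier zigzag
vertices from the later ones, hence crossing it means having the simple root in the support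
(`TypeA.cross_neg_simple_iff`). Every diagonal can be rotated onto the zigzag, so compatible means
noncrossing (`TypeA.compat_iff`), and faces are dissections.

Type. Up to inversion and conjugation by c₋, the complement c₊wc₋ is w⁻¹c. If the reflections of a
face are taken in a suitable order, each one cuts a cycle of the current product, starting from the
n-cycle c, into two arcs (`TypeA.IsNext.swap`). The final cycles are therefore the classes of labels
that no root of the face separates. The orderings with w ≤ c are exactly those that cut at every
step (`TypeA.isNC_iff_isUnseparated`), so the type does not depend on the ordering. Each label sits
at a zigzag vertex, and a cell Q contributes one class: the labels of its vertices other than its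
first and last along the zigzag. The parabolic type is thus the multiset of the numbers |Q| - 2
(`TypeA.hasParabolicType_iff_cells`).

Counting. Unrolled on ℤ, a dissection is a laminar family of intervals. Give each interval its
arity, the number of vertices of the cell below it minus two, and record at each integer the list of
arities of the intervals starting there. These lists are the increments of a Łukasiewicz walk, and
the lengths of the intervals come back as first passage times (`IsLaminar.mem_iff`,
`arityList_ofLists`). So the m-periodic families with arity multiset κ of sum less than m correspond
to m-tuples of lists with content κ, and there are (m-1+|κ|)! / ((m-1)! ∏ mult!) of them
(`card_periodicLaminar_mul`). All dissections are counted with period n + 1, each one being laid out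
from n + 1 starting points. The dissections invariant under an element of order d ≥ 2 are counted
with period m = (n+2)/d; apart from one possible central cell, their cells form free orbits, of type
κ (`TypeA.count_cellType`). Such a dissection of type λ exists only if the residues mod d of the
multiplicities of λ sum to at most 1, and then κ has the multiplicities ⌊λ_i/d⌋
(`TypeA.cellType_eq_iff`).

Algebra. Comparing cyclotomic exponents shows that μ is a polynomial (`sum_div_add_le`). At a
primitive d-th root of unity with d ≥ 2 dividing n + 2, removing the zeros of [d]_q shows that μ
vanishes if the residues sum to at least 2 and is the same quotient of factorials otherwise
(`aeval_mu`). The two computations meet in `TypeA.aeval_eq_card_invariant`. -/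

theorem qFactorial_succ (m : ℕ) : qFactorial (m + 1) = qFactorial m * qInt (m + 1) := by
  simp [qFactorial, Finset.prod_range_succ]

theorem qInt_eq_prod_cyclotomic (m B : ℕ) (hm : 1 ≤ m) (hB : m ≤ B) :
    qInt m = ∏ e ∈ Finset.Icc 2 B, if e ∣ m then cyclotomic e ℤ else 1 := by
  rw [qInt, ← prod_cyclotomic_eq_geom_sum hm, ← Finset.prod_filter]
  refine Finset.prod_congr ?_ fun _ _ => rfl
  ext e
  simp only [Finset.mem_erase, Nat.mem_divisors, Finset.mem_filter, Finset.mem_Icc]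
  constructor
  · rintro ⟨h1, h2, h3⟩
    have := Nat.le_of_dvd hm h2
    have : e ≠ 0 := fun h => by simp [h] at h2; omega
    exact ⟨by omega, h2⟩
  · rintro ⟨h1, h2⟩
    exact ⟨by omega, h2, by omega⟩

/-- Φ_e divides [i]_q, exactly once, when e ∣ i, and this happens for ⌊m/e⌋ indices i ≤ m. The bound
`B` is free so that several q-factorials can be compared over a common index set. -/
theorem qFactorial_eq_prod_cyclotomic (m B : ℕ) (hB : m ≤ B) :
    qFactorial m = ∏ e ∈ Finset.Icc 2 B, cyclotomic e ℤ ^ (m / e) := by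
  induction m with
  | zero => simp [qFactorial]
  | succ m ih =>
    rw [qFactorial_succ, ih (by omega), qInt_eq_prod_cyclotomic (m + 1) B (by omega) hB,
      ← Finset.prod_mul_distrib]
    refine Finset.prod_congr rfl fun e _ => ?_
    rw [Nat.succ_div]
    split_ifs <;> simp [pow_add]

/-- This is nonnegativity of the exponent of Φ_e in μ. If some `k i` is not divisible by e, the
remainders contribute at least 1 to l and pay for the passage from n to n + 1. If all are divisible,
then e ∣ n and, as e ≥ 2, n and n + 1 have the same quotient. -/
theorem sum_div_add_le {ι : Type*} (s : Finset ι) (k w : ι → ℕ) (n l e : ℕ) (he : 2 ≤ e)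
    (hl : ∑ i ∈ s, k i = l) (hn : ∑ i ∈ s, w i * k i = n) :
    (n + 1) / e + ∑ i ∈ s, k i / e ≤ (n + l) / e := by
  have h1 : e * ∑ i ∈ s, k i / e + ∑ i ∈ s, k i % e = l := by
    rw [← hl, Finset.mul_sum, ← Finset.sum_add_distrib]
    exact Finset.sum_congr rfl fun i _ => Nat.div_add_mod _ _
  have h2 : ∀ a, a / e + ∑ i ∈ s, k i / e = (a + e * ∑ i ∈ s, k i / e) / e := fun a => by
    rw [Nat.add_mul_div_left _ _ (by omega)]
  by_cases h : ∑ i ∈ s, k i % e = 0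
  · have hd : e ∣ n := by
      rw [← hn]
      refine Finset.dvd_sum fun i hi => Dvd.dvd.mul_left ?_ _
      exact Nat.dvd_of_mod_eq_zero ((Finset.sum_eq_zero_iff.mp h) i hi)
    have h3 : (n + 1) / e = n / e := by
      rw [Nat.succ_div, if_neg, add_zero]
      intro h4
      have := (Nat.dvd_add_right hd).mp h4
      have := Nat.le_of_dvd one_pos this
      omega
    rw [h3, h2]
    exact Nat.div_le_div_right (by omega)
  · rw [h2]
    exact Nat.div_le_div_right (by omega)

theorem exists_mul_qFactorial {ι : Type*} (s : Finset ι) (k w : ι → ℕ) (n l : ℕ) (hl1 : 1 ≤ l)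
    (hl : ∑ i ∈ s, k i = l) (hn : ∑ i ∈ s, w i * k i = n) :
    ∃ μ : ℤ[X], μ * ((∏ i ∈ s, qFactorial (k i)) * qFactorial (n + 1)) = qFactorial (n + l) := by
  have hk : ∀ i ∈ s, k i ≤ n + l := fun i hi => by
    have := Finset.single_le_sum (fun j _ => Nat.zero_le (k j)) hi
    omega
  refine ⟨∏ e ∈ Finset.Icc 2 (n + l), cyclotomic e ℤ ^
    ((n + l) / e - ((n + 1) / e + ∑ i ∈ s, k i / e)), ?_⟩
  rw [qFactorial_eq_prod_cyclotomic (n + 1) (n + l) (by omega),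
    qFactorial_eq_prod_cyclotomic (n + l) (n + l) le_rfl,
    Finset.prod_congr rfl fun i hi => qFactorial_eq_prod_cyclotomic (k i) (n + l) (hk i hi),
    Finset.prod_comm, ← Finset.prod_mul_distrib, ← Finset.prod_mul_distrib]
  refine Finset.prod_congr rfl fun e he => ?_
  rw [Finset.prod_pow_eq_pow_sum, ← pow_add, ← pow_add]
  have := sum_div_add_le s k w n l e (Finset.mem_Icc.mp he).1 hl hn
  congr 1
  omega

/-! ### Values of q-factorials at primitive roots of unity. -/

theorem qInt_mul (d t : ℕ) : qInt (d * t) = qInt d * (qInt t).comp (X ^ d) := by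
  induction t with
  | zero => simp [qInt]
  | succ t ih =>
    have : qInt (t + 1) = qInt t + X ^ t := by simp [qInt, Finset.sum_range_succ]
    rw [this, add_comp, mul_add (qInt d), ← ih, Nat.mul_succ]
    simp only [qInt, Finset.sum_range_add, pow_comp, X_comp, ← pow_mul, Finset.sum_mul,
      pow_add, mul_comm]

/-- The factor of `[m]_q!` left after dividing by `[d]_q ^ (m / d)`. -/
noncomputable def qFactorialCofactor (d m : ℕ) : ℤ[X] :=
  ∏ i ∈ Finset.range m,
    if d ∣ i + 1 then (qInt ((i + 1) / d)).comp (X ^ d) else qInt (i + 1)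

theorem qFactorial_eq_pow_mul (d m : ℕ) :
    qFactorial m = qInt d ^ (m / d) * qFactorialCofactor d m := by
  induction m with
  | zero => simp [qFactorial, qFactorialCofactor]
  | succ m ih =>
    rw [qFactorial_succ, ih, qFactorialCofactor, qFactorialCofactor, Finset.prod_range_succ,
      Nat.succ_div]
    split_ifs with h
    · obtain ⟨t, ht⟩ := h
      rcases Nat.eq_zero_or_pos d with rfl | hd
      · simp at ht
      have h2 : m / d + 1 = t := by
        rw [← Nat.mul_div_cancel_left t hd, ← ht, Nat.succ_div, if_pos ⟨t, ht⟩]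
      rw [h2, ht, qInt_mul, ← h2, pow_succ]
      ring
    · ring

theorem aeval_qInt (z : ℂ) (m : ℕ) : aeval z (qInt m) = ∑ i ∈ Finset.range m, z ^ i := by
  simp [qInt]

theorem aeval_qInt_mod {z : ℂ} {d : ℕ} (hd : 2 ≤ d) (hz : IsPrimitiveRoot z d) (m : ℕ) :
    aeval z (qInt m) = aeval z (qInt (m % d)) := by
  have h1 : z ≠ 1 := hz.ne_one (by omega)
  rw [aeval_qInt, aeval_qInt, geom_sum_eq h1, geom_sum_eq h1, ← pow_mod_orderOf z m,
    hz.eq_orderOf]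

theorem aeval_qInt_ne_zero {z : ℂ} {d : ℕ} (hd : 2 ≤ d) (hz : IsPrimitiveRoot z d) {m : ℕ}
    (hm : 0 < m) (hmd : m < d) : aeval z (qInt m) ≠ 0 := by
  have h1 : z ≠ 1 := hz.ne_one (by omega)
  rw [aeval_qInt, geom_sum_eq h1]
  exact div_ne_zero (sub_ne_zero.mpr (hz.pow_ne_one_of_pos_of_lt (by omega) hmd))
    (sub_ne_zero.mpr h1)

theorem aeval_qFactorial_ne_zero {z : ℂ} {d : ℕ} (hd : 2 ≤ d) (hz : IsPrimitiveRoot z d) {m : ℕ}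
    (hmd : m < d) : aeval z (qFactorial m) ≠ 0 := by
  rw [qFactorial, map_prod, Finset.prod_ne_zero_iff]
  intro i hi
  exact aeval_qInt_ne_zero hd hz (by omega) (by have := Finset.mem_range.mp hi; omega)

/-- At z the value of [i]_q depends only on i mod d, so each complete block of d indices gives
[d-1]! and the incomplete one gives [m mod d]!. A multiple td contributes [t] in the variable q^d,
whose value is t; these numbers multiply to ⌊m/d⌋!. -/
theorem aeval_qFactorialCofactor {z : ℂ} {d : ℕ} (hd : 2 ≤ d) (hz : IsPrimitiveRoot z d) (m : ℕ) :
    aeval z (qFactorialCofactor d m) = ((m / d).factorial : ℂ) *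
      aeval z (qFactorial (d - 1)) ^ (m / d) * aeval z (qFactorial (m % d)) := by
  induction m with
  | zero => simp [qFactorialCofactor, qFactorial]
  | succ m ih =>
    rw [qFactorialCofactor, Finset.prod_range_succ, ← qFactorialCofactor, map_mul, ih]
    have hm := Nat.div_add_mod m d
    have hm' := Nat.mod_lt m (show d > 0 by omega)
    split_ifs with h
    · have h1 : m % d = d - 1 := by
        by_contra hne
        obtain ⟨t, ht⟩ := h
        have h2 : m % d + 1 < d := by omega
        have h3 : (m + 1) % d = m % d + 1 := by
          rw [Nat.add_mod, Nat.mod_eq_of_lt (show 1 < d by omega), Nat.mod_eq_of_lt h2]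
        rw [ht, Nat.mul_mod_right] at h3
        omega
      have h2 : (m + 1) / d = m / d + 1 := by rw [Nat.succ_div, if_pos h]
      have h3 : (m + 1) % d = 0 := Nat.mod_eq_zero_of_dvd h
      have h4 : aeval z ((qInt ((m + 1) / d)).comp (X ^ d)) = ((m / d + 1 : ℕ) : ℂ) := by
        rw [aeval_comp, map_pow, aeval_X, hz.pow_eq_one, aeval_qInt, h2]
        simp
      rw [h4, h2, h3, h1, Nat.factorial_succ]
      simp only [qFactorial, Finset.range_zero, Finset.prod_empty, map_one]
      push_cast
      ring
    · have h1 : m % d + 1 ≠ d := fun h1 => h ⟨m / d + 1, by rw [mul_add]; omega⟩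
      have h3 : (m + 1) % d = m % d + 1 := by
        rw [Nat.add_mod, Nat.mod_eq_of_lt (show 1 < d by omega), Nat.mod_eq_of_lt (by omega)]
      have h2 : (m + 1) / d = m / d := by rw [Nat.succ_div, if_neg h, add_zero]
      rw [h2, h3, qFactorial_succ, map_mul, aeval_qInt_mod hd hz (m + 1), h3]
      ring

theorem aeval_one_qFactorial (m : ℕ) : aeval (1 : ℂ) (qFactorial m) = (m.factorial : ℂ) := by
  induction m with
  | zero => simp [qFactorial]
  | succ m ih =>
    rw [qFactorial_succ, map_mul, ih, aeval_qInt, Nat.factorial_succ]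
    simp [mul_comm]

/-- The identity defining μ is 0 = 0 at z as soon as [d]_q occurs on both sides, so the common
powers of [d]_q are cancelled as polynomials before evaluation. -/
theorem mul_qFactorialCofactor {ι : Type*} (s : Finset ι) (k : ι → ℕ) (n l d : ℕ) (hd : 2 ≤ d)
    (μ : ℤ[X])
    (hμ : μ * ((∏ i ∈ s, qFactorial (k i)) * qFactorial (n + 1)) = qFactorial (n + l))
    (hle : (n + 1) / d + ∑ i ∈ s, k i / d ≤ (n + l) / d) :
    μ * ((∏ i ∈ s, qFactorialCofactor d (k i)) * qFactorialCofactor d (n + 1)) =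
      qInt d ^ ((n + l) / d - ((n + 1) / d + ∑ i ∈ s, k i / d)) * qFactorialCofactor d (n + l) := by
  have h0 : qInt d ≠ 0 := by
    intro h
    have : aeval (1 : ℂ) (qInt d) = 0 := by rw [h, map_zero]
    rw [aeval_qInt] at this
    simp at this
    omega
  refine mul_left_cancel₀ (pow_ne_zero ((n + 1) / d + ∑ i ∈ s, k i / d) h0) ?_
  rw [← mul_assoc (_ ^ _) (_ ^ _), ← pow_add, Nat.add_sub_cancel' hle, ← qFactorial_eq_pow_mul,
    ← hμ, qFactorial_eq_pow_mul d (n + 1),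
    Finset.prod_congr rfl fun i _ => qFactorial_eq_pow_mul d (k i),
    Finset.prod_mul_distrib, Finset.prod_pow_eq_pow_sum, pow_add]
  ring

theorem aeval_mu {ι : Type*} (s : Finset ι) (k w : ι → ℕ) (n l d m : ℕ) (hd : 2 ≤ d)
    (hm : d * m = n + 2)
    (hl : ∑ i ∈ s, k i = l) (hn : ∑ i ∈ s, w i * k i = n)
    {z : ℂ} (hz : IsPrimitiveRoot z d) (μ : ℤ[X])
    (hμ : μ * ((∏ i ∈ s, qFactorial (k i)) * qFactorial (n + 1)) = qFactorial (n + l)) :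
    (2 ≤ ∑ i ∈ s, k i % d → aeval z μ = 0) ∧
    (∑ i ∈ s, k i % d ≤ 1 → aeval z μ * ((m - 1).factorial * ∏ i ∈ s, ((k i / d).factorial : ℂ)) =
      ((m - 1 + ∑ i ∈ s, k i / d).factorial : ℂ)) := by
  have hle := sum_div_add_le s k w n l d hd hl hn
  have key := congrArg (aeval z) (mul_qFactorialCofactor s k n l d hd μ hμ hle)
  have hE : aeval z (qFactorial (d - 1)) ≠ 0 := aeval_qFactorial_ne_zero hd hz (by omega)
  have hd0 : aeval z (qInt d) = 0 := by
    rw [aeval_qInt_mod hd hz, Nat.mod_self]; simp [qInt]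
  have hG : ∀ a, aeval z (qFactorialCofactor d a) ≠ 0 := fun a => by
    rw [aeval_qFactorialCofactor hd hz]
    exact mul_ne_zero (mul_ne_zero (by exact_mod_cast Nat.factorial_ne_zero _)
      (pow_ne_zero _ hE)) (aeval_qFactorial_ne_zero hd hz (Nat.mod_lt _ (by omega)))
  simp only [map_mul, map_pow, map_prod] at key
  have h1 : d * ∑ i ∈ s, k i / d + ∑ i ∈ s, k i % d = l := by
    rw [← hl, Finset.mul_sum, ← Finset.sum_add_distrib]
    exact Finset.sum_congr rfl fun i _ => Nat.div_add_mod _ _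
  set K := ∑ i ∈ s, k i / d with hK
  obtain ⟨m', rfl⟩ : ∃ m', m = m' + 1 := ⟨m - 1, by
    rcases m with _ | m
    · simp at hm
    · rfl⟩
  have hn1 : n + 1 = d * m' + (d - 1) := by rw [mul_add] at hm; omega
  have hn1d : (n + 1) / d = m' := by
    rw [hn1, Nat.mul_add_div (by omega), Nat.div_eq_of_lt (by omega), add_zero]
  have hn1m : (n + 1) % d = d - 1 := by
    rw [hn1, Nat.mul_add_mod, Nat.mod_eq_of_lt (by omega)]
  constructor
  · intro h2
    -- Two units of remainder complete n + 2 = dm to one more multiple of d, so the right side keeps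
    -- a factor [d]_q, which vanishes at z.
    have h3 : m' + K + 1 ≤ (n + l) / d := by
      rw [Nat.le_div_iff_mul_le (by omega), ← h1]
      have : (m' + K + 1) * d = d * (m' + 1) + d * K := by ring
      omega
    have h4 : (n + l) / d - ((n + 1) / d + K) ≠ 0 := by omega
    rw [hd0, zero_pow h4, zero_mul] at key
    refine (mul_eq_zero.mp key).resolve_right (mul_ne_zero ?_ (hG _))
    exact Finset.prod_ne_zero_iff.mpr fun i _ => hG _
  · intro h2
    have hnl : n + l = d * (m' + K) + (d - 2 + ∑ i ∈ s, k i % d) := by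
      rw [mul_add] at hm
      rw [mul_add]; omega
    have hnld : (n + l) / d = m' + K := by
      rw [hnl, Nat.mul_add_div (by omega), Nat.div_eq_of_lt (by omega), add_zero]
    have hnlm : (n + l) % d = d - 2 + ∑ i ∈ s, k i % d := by
      rw [hnl, Nat.mul_add_mod, Nat.mod_eq_of_lt (by omega)]
    -- With residue sum 1 the two arguments coincide. With residue sum 0, d divides both n and n +
    -- 2, so d = 2, and [0]! = [1]!.
    have h5 : aeval z (qFactorial (d - 2 + ∑ i ∈ s, k i % d)) = aeval z (qFactorial (d - 1)) := by
      rcases Nat.eq_zero_or_pos (∑ i ∈ s, k i % d) with h0 | h0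
      · have hdn : d ∣ n := by
          rw [← hn]
          exact Finset.dvd_sum fun i hi => Dvd.dvd.mul_left
            (Nat.dvd_of_mod_eq_zero ((Finset.sum_eq_zero_iff.mp h0) i hi)) _
        have : d ∣ 2 := (Nat.dvd_add_right hdn).mp ⟨_, hm.symm⟩
        have := Nat.le_of_dvd (by norm_num) this
        obtain rfl : d = 2 := by omega
        rw [h0]
        simp [qFactorial, qInt]
      · congr 2; omega
    have h6 : ∀ i ∈ s, aeval z (qFactorialCofactor d (k i)) =
        ((k i / d).factorial : ℂ) * aeval z (qFactorial (d - 1)) ^ (k i / d) := fun i hi => by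
      have h7 : k i % d ≤ 1 := (Finset.single_le_sum (fun j _ => Nat.zero_le (k j % d)) hi).trans h2
      rw [aeval_qFactorialCofactor hd hz]
      have : aeval z (qFactorial (k i % d)) = 1 := by
        interval_cases k i % d <;> simp [qFactorial, qInt]
      rw [this, mul_one]
    rw [Finset.prod_congr rfl h6, Finset.prod_mul_distrib, Finset.prod_pow_eq_pow_sum,
      aeval_qFactorialCofactor hd hz (n + 1), aeval_qFactorialCofactor hd hz (n + l), hnld, hn1d,
      hn1m, hnlm, h5, Nat.sub_self, pow_zero, one_mul, ← hK] at key
    refine mul_right_cancel₀ (pow_ne_zero (m' + K + 1) hE) ?_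
    rw [Nat.add_sub_cancel]
    calc _ = aeval z μ * ((∏ i ∈ s, ((k i / d).factorial : ℂ)) *
          aeval z (qFactorial (d - 1)) ^ K * ((m'.factorial : ℂ) *
          aeval z (qFactorial (d - 1)) ^ m' * aeval z (qFactorial (d - 1)))) := by ring
      _ = _ := by rw [key]; ring

/-! ### Counting tuples of lists by content -/

theorem prod_factorial_count_erase (s : Finset ℕ) (κ : Multiset ℕ) {a : ℕ} (ha : a ∈ κ)
    (has : a ∈ s) :
    ∏ b ∈ s, (κ.count b).factorial =
      κ.count a * ∏ b ∈ s, ((κ.erase a).count b).factorial := by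
  rw [← Finset.mul_prod_erase s _ has, ← Finset.mul_prod_erase s _ has, ← mul_assoc]
  congr 1
  · rw [Multiset.count_erase_self, Nat.mul_factorial_pred]
    exact (Multiset.count_pos.mpr ha).ne'
  · refine Finset.prod_congr rfl fun b hb => ?_
    rw [Multiset.count_erase_of_ne (Finset.ne_of_mem_erase hb)]

/-- A tuple of m + 1 lists is a word in the letters of κ and m separators, so the count is
multinomial. The induction is on the first symbol: a separator leaves m - 1 separators, while a
letter a leaves `κ.erase a`. -/
theorem exists_finset_lists (s : Finset ℕ) (m : ℕ) (κ : Multiset ℕ) (hs : ∀ a ∈ κ, a ∈ s) :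
    ∃ F : Finset (Fin (m + 1) → List ℕ),
      (∀ g, g ∈ F ↔ ∑ i, (g i : Multiset ℕ) = κ) ∧
      F.card * (m.factorial * ∏ a ∈ s, (κ.count a).factorial) = (m + κ.card).factorial := by
  classical
  induction hN : m + κ.card generalizing m κ with
  | zero =>
    obtain ⟨rfl, hκ⟩ : m = 0 ∧ κ.card = 0 := by omega
    obtain rfl := Multiset.card_eq_zero.mp hκ
    refine ⟨{fun _ => []}, fun g => ?_, by simp⟩
    rw [Finset.mem_singleton, funext_iff]
    simp
  | succ N ih =>
    rcases eq_or_ne κ 0 with rfl | hκ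
    · refine ⟨{fun _ => []}, fun g => ?_, by simpa using congrArg Nat.factorial hN⟩
      rw [Finset.mem_singleton, funext_iff]
      simp [Finset.sum_eq_zero_iff]
    have hex : ∀ a : ℕ, ∃ F : Finset (Fin (m + 1) → List ℕ), a ∈ κ →
        (∀ g, g ∈ F ↔ ∑ i, (g i : Multiset ℕ) = κ.erase a) ∧
        F.card * (m.factorial * ∏ b ∈ s, ((κ.erase a).count b).factorial) = N.factorial := by
      intro a
      by_cases ha : a ∈ κ
      · have hc := Multiset.card_erase_add_one ha
        obtain ⟨F, hF⟩ := ih m (κ.erase a) (fun b hb => hs b (Multiset.mem_of_mem_erase hb))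
          (by omega)
        exact ⟨F, fun _ => hF⟩
      · exact ⟨∅, fun h => absurd h ha⟩
    choose F hF using hex
    let push : ℕ → (Fin (m + 1) → List ℕ) → (Fin (m + 1) → List ℕ) :=
      fun a g => Fin.cons (a :: g 0) (Fin.tail g)
    have hpush : ∀ a g, ∑ i, ((push a g) i : Multiset ℕ) = a ::ₘ ∑ i, (g i : Multiset ℕ) := by
      intro a g
      simp only [push, Fin.sum_univ_succ, Fin.cons_zero, Fin.cons_succ, Fin.tail]
      rw [← Multiset.cons_coe, Multiset.cons_add]
    have hinj : ∀ a, Function.Injective (push a) := by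
      intro a g g' h
      rw [Fin.cons_inj] at h
      funext i
      refine Fin.cases ?_ (fun j => ?_) i
      · simpa using h.1
      · exact congrFun h.2 j
    let F2 := κ.toFinset.biUnion fun a => (F a).image (push a)
    have hmem2 : ∀ g, g ∈ F2 ↔ ∑ i, (g i : Multiset ℕ) = κ ∧ g 0 ≠ [] := by
      intro g
      simp only [F2, Finset.mem_biUnion, Multiset.mem_toFinset, Finset.mem_image]
      constructor
      · rintro ⟨a, ha, g', hg', rfl⟩
        rw [hpush, ((hF a ha).1 g').mp hg', Multiset.cons_erase ha]
        exact ⟨rfl, by simp [push]⟩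
      · rintro ⟨h1, h2⟩
        obtain ⟨a, l, hal⟩ := List.exists_cons_of_ne_nil h2
        have hg : g = push a (Fin.cons l (Fin.tail g)) := by
          simp only [push, Fin.cons_zero, Fin.tail_cons, ← hal]
          exact (Fin.cons_self_tail g).symm
        rw [hg, hpush] at h1
        have ha : a ∈ κ := by rw [← h1]; exact Multiset.mem_cons_self _ _
        refine ⟨a, ha, _, ((hF a ha).1 _).mpr ?_, hg.symm⟩
        rw [← h1, Multiset.erase_cons_head]
    have hcard2 : F2.card * (m.factorial * ∏ a ∈ s, (κ.count a).factorial) =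
        κ.card * N.factorial := by
      -- The words beginning with a number (count of a) · N! after multiplication by the
      -- denominator, and the counts add up to `κ.card`.
      rw [Finset.card_biUnion, Finset.sum_mul]
      · rw [← Multiset.toFinset_sum_count_eq κ, Finset.sum_mul]
        refine Finset.sum_congr rfl fun a ha => ?_
        rw [Multiset.mem_toFinset] at ha
        rw [Finset.card_image_of_injective _ (hinj a), ← (hF a ha).2,
          prod_factorial_count_erase s κ ha (hs a ha)]
        ring
      · intro a _ b _ hab
        rw [Function.onFun, Finset.disjoint_left]
        intro g hg hg'
        obtain ⟨g1, -, h1⟩ := Finset.mem_image.mp hg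
        obtain ⟨g2, -, h2⟩ := Finset.mem_image.mp hg'
        rw [← h2] at h1
        have := congrFun h1 0
        simp only [push, Fin.cons_zero, List.cons.injEq] at this
        exact hab this.1
    rcases m with _ | m
    · refine ⟨F2, fun g => ?_, ?_⟩
      · rw [hmem2]
        refine ⟨fun h => h.1, fun h => ⟨h, fun h0 => hκ ?_⟩⟩
        rw [← h]
        simp [h0]
      · rw [hcard2, Nat.factorial_succ]
        congr 1
        omega
    · obtain ⟨F1, hF1, hc1⟩ := ih m κ hs (by omega)
      have hinj1 : Function.Injective
          (fun g : Fin (m + 1) → List ℕ => (Fin.cons [] g : Fin (m + 2) → List ℕ)) :=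
        fun g g' h => by simpa [Fin.cons_inj] using h
      refine ⟨F1.image (fun g => Fin.cons [] g) ∪ F2, fun g => ?_, ?_⟩
      · rw [Finset.mem_union, hmem2, Finset.mem_image]
        constructor
        · rintro (⟨g', hg', rfl⟩ | h)
          · rw [Fin.sum_univ_succ]
            simpa using (hF1 g').mp hg'
          · exact h.1
        · intro h
          by_cases h0 : g 0 = []
          · left
            refine ⟨Fin.tail g, (hF1 _).mpr ?_, ?_⟩
            · rw [Fin.sum_univ_succ, h0] at h
              simpa [Fin.tail] using h
            · rw [← h0]; exact Fin.cons_self_tail g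
          · exact Or.inr ⟨h, h0⟩
      · rw [Finset.card_union_of_disjoint, Finset.card_image_of_injective _ hinj1, add_mul, hcard2,
          Nat.factorial_succ m, Nat.factorial_succ N, ← hN, add_mul, ← hc1]
        · ring
        · rw [Finset.disjoint_left]
          intro g hg hg'
          obtain ⟨g', -, rfl⟩ := Finset.mem_image.mp hg
          exact ((hmem2 _).mp hg').2 rfl

/-! ### Laminar families of intervals of `ℤ`

A family `V : ℤ → Finset ℕ` stands for the set of intervals `[u, u + ℓ]` with `ℓ ∈ V u`. -/

/-- The intervals have length at least two and are pairwise nested or with disjoint interiors. -/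
structure IsLaminar (V : ℤ → Finset ℕ) : Prop where
  two_le : ∀ {u ℓ}, ℓ ∈ V u → 2 ≤ ℓ
  nested : ∀ {u ℓ u' ℓ'}, ℓ ∈ V u → ℓ' ∈ V u' → u < u' → u' < u + ℓ → u' + ℓ' ≤ u + ℓ

open Classical in
/-- The interior points of `[u, u + ℓ]` for which no shorter interval of the family is
around them. -/
noncomputable def innerPts (V : ℤ → Finset ℕ) (u : ℤ) (ℓ : ℕ) : Finset ℤ :=
  (Finset.Ioo u (u + ℓ)).filter
    fun x => ∀ u' ℓ', ℓ' ∈ V u' → u' < x → x < u' + ℓ' → ℓ ≤ ℓ'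

/-- The number of inner points of an interval. -/
noncomputable def arity (V : ℤ → Finset ℕ) (u : ℤ) (ℓ : ℕ) : ℕ := (innerPts V u ℓ).card

/-- The total arity of the intervals that start at `u` and have length at most `ℓ`. -/
noncomputable def arityUpTo (V : ℤ → Finset ℕ) (u : ℤ) (ℓ : ℕ) : ℕ :=
  ∑ k ∈ (V u).filter (· ≤ ℓ), arity V u k

/-- The total arity of the intervals that start at `u`. -/
noncomputable def aritySum (V : ℤ → Finset ℕ) (u : ℤ) : ℕ := ∑ k ∈ V u, arity V u k

theorem mem_innerPts {V : ℤ → Finset ℕ} {u : ℤ} {ℓ : ℕ} {x : ℤ} :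
    x ∈ innerPts V u ℓ ↔ (u < x ∧ x < u + ℓ) ∧
      ∀ u' ℓ', ℓ' ∈ V u' → u' < x → x < u' + ℓ' → ℓ ≤ ℓ' := by
  simp [innerPts]

namespace IsLaminar

variable {V : ℤ → Finset ℕ}

/-- The witness is a shortest interval around x; laminarity forces it inside the given one. -/
theorem exists_mem_innerPts (hV : IsLaminar V) {u x : ℤ} {ℓ : ℕ} (hℓ : ℓ ∈ V u) (h1 : u < x)
    (h2 : x < u + ℓ) :
    ∃ p q, q ∈ V p ∧ x ∈ innerPts V p q ∧ u ≤ p ∧ p + q ≤ u + ℓ ∧ q ≤ ℓ := by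
  classical
  have hex : ∃ q : ℕ, ∃ p, q ∈ V p ∧ p < x ∧ x < p + q := ⟨ℓ, u, hℓ, h1, h2⟩
  obtain ⟨p, hp, hp1, hp2⟩ := Nat.find_spec hex
  have hmin : ∀ u' ℓ', ℓ' ∈ V u' → u' < x → x < u' + ℓ' → Nat.find hex ≤ ℓ' :=
    fun u' ℓ' h h' h'' => Nat.find_min' hex ⟨u', h, h', h''⟩
  have hle := hmin u ℓ hℓ h1 h2
  refine ⟨p, Nat.find hex, hp, mem_innerPts.mpr ⟨⟨hp1, hp2⟩, hmin⟩, ?_, ?_, hle⟩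
  · by_contra hlt
    have := hV.nested hp hℓ (by omega) (by omega)
    omega
  · rcases lt_trichotomy p u with h | h | h
    · have := hV.nested hp hℓ h (by omega)
      omega
    · omega
    · exact hV.nested hℓ hp h (by omega)

theorem innerPts_unique (hV : IsLaminar V) {p p' x : ℤ} {q q' : ℕ} (hq : q ∈ V p)
    (hq' : q' ∈ V p') (hx : x ∈ innerPts V p q) (hx' : x ∈ innerPts V p' q') :
    p = p' ∧ q = q' := by
  rw [mem_innerPts] at hx hx'
  have h1 := hx.2 p' q' hq' hx'.1.1 hx'.1.2
  have h2 := hx'.2 p q hq hx.1.1 hx.1.2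
  obtain rfl : q = q' := le_antisymm h1 h2
  refine ⟨?_, rfl⟩
  rcases lt_trichotomy p p' with h | h | h
  · have := hV.nested hq hq' h (by omega)
    omega
  · exact h
  · have := hV.nested hq' hq h (by omega)
    omega

/-- The first vertex after u of the cell below the interval is inner: it is the right end of the
longest shorter interval starting at u, or u + 1 if there is none. -/
theorem arity_pos (hV : IsLaminar V) {u : ℤ} {ℓ : ℕ} (hℓ : ℓ ∈ V u) : 0 < arity V u ℓ := by
  classical
  have h2 := hV.two_le hℓ
  obtain ⟨k, hk1, hkℓ, hk, hmax⟩ : ∃ k : ℕ, 1 ≤ k ∧ k < ℓ ∧ (k = 1 ∨ k ∈ V u) ∧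
      ∀ ℓ' ∈ V u, ℓ' < ℓ → ℓ' ≤ k := by
    rcases ((V u).filter (· < ℓ)).eq_empty_or_nonempty with he | hne
    · refine ⟨1, le_rfl, by omega, Or.inl rfl, fun ℓ' h h' => ?_⟩
      have : ℓ' ∈ (V u).filter (· < ℓ) := Finset.mem_filter.mpr ⟨h, h'⟩
      simp [he] at this
    · have hm := Finset.mem_filter.mp (Finset.max'_mem _ hne)
      have := hV.two_le hm.1
      exact ⟨_, by omega, hm.2, Or.inr hm.1,
        fun ℓ' h h' => Finset.le_max' _ _ (Finset.mem_filter.mpr ⟨h, h'⟩)⟩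
  refine Finset.card_pos.mpr ⟨u + k, mem_innerPts.mpr ⟨⟨by omega, by omega⟩, ?_⟩⟩
  intro u' ℓ' h' h1 h3
  rcases lt_trichotomy u' u with h | h | h
  · have := hV.nested h' hℓ h (by omega)
    omega
  · subst h
    by_contra hlt
    have := hmax ℓ' h' (by omega)
    omega
  · rcases hk with rfl | hk
    · omega
    · have := hV.nested hk h' h (by omega)
      omega

/-- The intervals that start in `[u, v)`, those starting at `u` being of length at most `ℓ`. -/
noncomputable def window (V : ℤ → Finset ℕ) (u : ℤ) (ℓ : ℕ) (v : ℤ) : Finset (Σ _ : ℤ, ℕ) :=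
  (Finset.Ico u v).sigma fun p => if p = u then (V u).filter (· ≤ ℓ) else V p

theorem sum_window (V : ℤ → Finset ℕ) (u : ℤ) (ℓ : ℕ) {v : ℤ} (huv : u < v) :
    ∑ a ∈ window V u ℓ v, arity V a.1 a.2 =
      arityUpTo V u ℓ + ∑ x ∈ Finset.Ioo u v, aritySum V x := by
  rw [window, Finset.sum_sigma, ← Finset.Ioo_insert_left huv, Finset.sum_insert (by simp)]
  simp only [if_true]
  congr 1
  refine Finset.sum_congr rfl fun x hx => ?_
  rw [if_neg (by have := Finset.mem_Ioo.mp hx; omega), aritySum]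

/-- Each of the ℓ - 1 interior points is inner for exactly one interval of the family, and that
interval starts in [u, u + ℓ) and stays inside [u, u + ℓ]. This says that the walk is at 0 at time
ℓ. -/
theorem arityUpTo_add_sum (hV : IsLaminar V) {u : ℤ} {ℓ : ℕ} (hℓ : ℓ ∈ V u) :
    arityUpTo V u ℓ + ∑ x ∈ Finset.Ioo u (u + ℓ), aritySum V x + 1 = ℓ := by
  have h2 := hV.two_le hℓ
  rw [← sum_window V u ℓ (by omega)]
  have : Finset.Ioo u (u + ℓ) =
      (window V u ℓ (u + ℓ)).biUnion fun a => innerPts V a.1 a.2 := by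
    ext x
    simp only [Finset.mem_biUnion, window, Finset.mem_sigma, Finset.mem_Ico, Finset.mem_Ioo]
    constructor
    · rintro ⟨h1, h3⟩
      obtain ⟨p, q, hq, hx, hp, hpq, hqℓ⟩ := hV.exists_mem_innerPts hℓ h1 h3
      have hx' := mem_innerPts.mp hx
      refine ⟨⟨p, q⟩, ⟨⟨hp, by dsimp only; omega⟩, ?_⟩, hx⟩
      dsimp only
      split_ifs with h
      · subst h
        exact Finset.mem_filter.mpr ⟨hq, hqℓ⟩
      · exact hq
    · rintro ⟨⟨p, q⟩, ⟨⟨hp1, hp2⟩, hq⟩, hx⟩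
      have hx' := (mem_innerPts.mp hx).1
      dsimp only at *
      split_ifs at hq with h
      · have := (Finset.mem_filter.mp hq).2
        omega
      · have := hV.nested hℓ hq (by omega) hp2
        omega
  have hc := congrArg Finset.card this
  rw [Finset.card_biUnion, Int.card_Ioo] at hc
  · simp only [arity]
    omega
  · intro a ha b hb hab
    rw [Function.onFun, Finset.disjoint_left]
    intro x hxa hxb
    refine hab ?_
    have hmem : ∀ c ∈ window V u ℓ (u + ℓ), c.2 ∈ V c.1 := by
      intro c hc
      have := (Finset.mem_sigma.mp hc).2
      split_ifs at this with h
      · rw [h]; exact (Finset.mem_filter.mp this).1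
      · exact this
    obtain ⟨h1, h3⟩ := hV.innerPts_unique (hmem a ha) (hmem b hb) hxa hxb
    exact Sigma.ext h1 (heq_of_eq h3)

/-- The k points u + 1, …, u + k are inner for intervals that start before u + k, so the walk has
not reached 0 before time ℓ. -/
theorem le_arityUpTo_add_sum (hV : IsLaminar V) {u : ℤ} {ℓ : ℕ} (hℓ : ℓ ∈ V u) {k : ℕ}
    (hk : 1 ≤ k) (hkℓ : k < ℓ) :
    k ≤ arityUpTo V u ℓ + ∑ x ∈ Finset.Ioo u (u + k), aritySum V x := by
  rw [← sum_window V u ℓ (by omega)]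
  have : Finset.Ioc u (u + k) ⊆
      (window V u ℓ (u + k)).biUnion fun a => innerPts V a.1 a.2 := by
    intro x hx
    simp only [Finset.mem_biUnion, window, Finset.mem_sigma, Finset.mem_Ico]
    rw [Finset.mem_Ioc] at hx
    obtain ⟨p, q, hq, hx', hp, hpq, hqℓ⟩ := hV.exists_mem_innerPts hℓ hx.1 (by omega)
    have hx'' := mem_innerPts.mp hx'
    refine ⟨⟨p, q⟩, ⟨⟨hp, by dsimp only; omega⟩, ?_⟩, hx'⟩
    dsimp only
    split_ifs with h
    · subst h
      exact Finset.mem_filter.mpr ⟨hq, hqℓ⟩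
    · exact hq
  have hc := (Finset.card_le_card this).trans Finset.card_biUnion_le
  rw [Int.card_Ioc] at hc
  simp only [arity]
  omega

end IsLaminar

/-! ### First passage -/

/-- `k` is the first time the walk with height `t` and increments `S (u + j) - 1`
reaches `0`. -/
def IsFirst (S : ℤ → ℕ) (u : ℤ) (t k : ℕ) : Prop :=
  (1 ≤ k ∧ t + ∑ x ∈ Finset.Ioo u (u + k), S x + 1 ≤ k) ∧
    ∀ j : ℕ, 1 ≤ j → j < k → j ≤ t + ∑ x ∈ Finset.Ioo u (u + j), S x

theorem IsFirst.unique {S : ℤ → ℕ} {u : ℤ} {t k k' : ℕ} (h : IsFirst S u t k)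
    (h' : IsFirst S u t k') : k = k' := by
  rcases lt_trichotomy k k' with hlt | hlt | hlt
  · have := h'.2 k h.1.1 hlt
    have := h.1.2
    omega
  · exact hlt
  · have := h.2 k' h'.1.1 hlt
    have := h'.1.2
    omega

theorem sum_Ioo_succ (S : ℤ → ℕ) (u : ℤ) {j : ℕ} (hj : 1 ≤ j) :
    ∑ x ∈ Finset.Ioo u (u + (j + 1 : ℕ)), S x =
      ∑ x ∈ Finset.Ioo u (u + j), S x + S (u + j) := by
  have : Finset.Ioo u (u + (j + 1 : ℕ)) = insert (u + (j : ℤ)) (Finset.Ioo u (u + j)) := by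
    ext x
    simp only [Finset.mem_insert, Finset.mem_Ioo]
    push_cast
    omega
  rw [this, Finset.sum_insert (by simp), add_comm]

/-- The walk goes down by at most one at each step, so it cannot jump over 0. -/
theorem IsFirst.eq {S : ℤ → ℕ} {u : ℤ} {t k : ℕ} (h : IsFirst S u t k) (ht : 1 ≤ t) :
    2 ≤ k ∧ t + ∑ x ∈ Finset.Ioo u (u + k), S x + 1 = k := by
  obtain ⟨⟨h1, h2⟩, h3⟩ := h
  have hk : 2 ≤ k := by omega
  obtain ⟨j, rfl⟩ : ∃ j, k = j + 1 := ⟨k - 1, by omega⟩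
  have h4 := h3 j (by omega) (by omega)
  rw [sum_Ioo_succ S u (by omega)] at h2 ⊢
  omega

theorem exists_isFirst {S : ℤ → ℕ} {u : ℤ} {t m : ℕ} (hm : 1 ≤ m)
    (h : t + ∑ x ∈ Finset.Ioo u (u + m), S x + 1 ≤ m) : ∃ k ≤ m, IsFirst S u t k := by
  classical
  have hex : ∃ k : ℕ, 1 ≤ k ∧ t + ∑ x ∈ Finset.Ioo u (u + k), S x + 1 ≤ k := ⟨m, hm, h⟩
  refine ⟨Nat.find hex, Nat.find_min' hex ⟨hm, h⟩, Nat.find_spec hex, fun j hj hjk => ?_⟩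
  have := Nat.find_min hex hjk
  omega

theorem IsFirst.lt {S : ℤ → ℕ} {u : ℤ} {t t' k k' : ℕ} (h : IsFirst S u t k)
    (h' : IsFirst S u t' k') (ht : 1 ≤ t) (htt' : t < t') : k < k' := by
  by_contra hle
  rcases (not_lt.mp hle).lt_or_eq with hlt | rfl
  · have := h.2 k' h'.1.1 hlt
    have := h'.1.2
    omega
  · have := (h.eq ht).2
    have := (h'.eq (by omega)).2
    omega

/-- At u' the outer walk is still above 0, and its increment there includes `S u' ≥ t'`. From then
on the outer walk dominates the inner one, so it cannot finish first. The sum is split at u' to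
compare them. -/
theorem IsFirst.nested {S : ℤ → ℕ} {u u' : ℤ} {t t' k k' : ℕ} (h : IsFirst S u t k)
    (h' : IsFirst S u' t' k') (ht' : t' ≤ S u') (huu' : u < u') (hu' : u' < u + k) :
    u' + k' ≤ u + k := by
  obtain ⟨j, hj⟩ : ∃ j : ℕ, u' = u + j := ⟨(u' - u).toNat, by omega⟩
  have h1 := h.2 j (by omega) (by omega)
  by_contra hlt
  have h2 := h'.2 (k - j) (by omega) (by omega)
  have h3 := h.1.2
  have h4 : Finset.Ioo u (u + k) = (Finset.Ioo u (u + j) ∪ {u'}) ∪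
      Finset.Ioo u' (u' + (k - j : ℕ)) := by
    ext x
    simp only [Finset.mem_union, Finset.mem_Ioo, Finset.mem_singleton]
    omega
  rw [h4, Finset.sum_union, Finset.sum_union, Finset.sum_singleton] at h3
  · omega
  · rw [Finset.disjoint_left]
    intro x hx
    simp only [Finset.mem_Ioo, Finset.mem_singleton] at hx ⊢
    omega
  · rw [Finset.disjoint_left]
    intro x hx
    simp only [Finset.mem_union, Finset.mem_Ioo, Finset.mem_singleton] at hx ⊢
    omega

/-! ### Suffix sums of lists -/

/-- The set of sums of the nonempty suffixes of a list. -/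
def suffixSums : List ℕ → Finset ℕ
  | [] => ∅
  | a :: l => insert (a + l.sum) (suffixSums l)

theorem le_sum_of_mem_suffixSums {l : List ℕ} {t : ℕ} (ht : t ∈ suffixSums l) : t ≤ l.sum := by
  induction l with
  | nil => simp [suffixSums] at ht
  | cons a l ih =>
    rw [suffixSums, Finset.mem_insert] at ht
    rw [List.sum_cons]
    rcases ht with rfl | ht
    · exact le_rfl
    · have := ih ht
      omega

theorem sum_mem_suffixSums {l : List ℕ} (hl : l ≠ []) : l.sum ∈ suffixSums l := by
  cases l with
  | nil => exact absurd rfl hl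
  | cons a l => simp [suffixSums]

theorem pos_of_mem_suffixSums {l : List ℕ} (hl : ∀ a ∈ l, 0 < a) {t : ℕ}
    (ht : t ∈ suffixSums l) : 0 < t := by
  induction l with
  | nil => simp [suffixSums] at ht
  | cons a l ih =>
    rw [suffixSums, Finset.mem_insert] at ht
    rcases ht with rfl | ht
    · have := hl a (by simp)
      omega
    · exact ih (fun b hb => hl b (by simp [hb])) ht

/-- The total is the largest suffix sum. Since the entries are positive it does not occur in the
tail, so it can be erased and the tails compared by induction. -/
theorem suffixSums_injective {l l' : List ℕ} (hl : ∀ a ∈ l, 0 < a) (hl' : ∀ a ∈ l', 0 < a)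
    (h : suffixSums l = suffixSums l') : l = l' := by
  induction l generalizing l' with
  | nil =>
    by_contra hne
    have := sum_mem_suffixSums (Ne.symm hne)
    rw [← h] at this
    simp [suffixSums] at this
  | cons a l ih =>
    cases l' with
    | nil =>
      have := sum_mem_suffixSums (List.cons_ne_nil a l)
      rw [h] at this
      simp [suffixSums] at this
    | cons b l' =>
      have h1 := le_sum_of_mem_suffixSums (h ▸ sum_mem_suffixSums (List.cons_ne_nil a l))
      have h2 := le_sum_of_mem_suffixSums (h.symm ▸ sum_mem_suffixSums (List.cons_ne_nil b l'))
      simp only [List.sum_cons] at h1 h2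
      have h3 : a + l.sum = b + l'.sum := le_antisymm h1 h2
      have ha := hl a (by simp)
      have hb := hl' b (by simp)
      have h4 : suffixSums l = suffixSums l' := by
        have e1 : a + l.sum ∉ suffixSums l := fun hm => by
          have := le_sum_of_mem_suffixSums hm
          omega
        have e2 : a + l.sum ∉ suffixSums l' := fun hm => by
          have := le_sum_of_mem_suffixSums hm
          omega
        rw [suffixSums, suffixSums, ← h3] at h
        rw [← Finset.erase_insert e1, h, Finset.erase_insert e2]
      have h5 := ih (fun c hc => hl c (by simp [hc])) (fun c hc => hl' c (by simp [hc])) h4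
      subst h5
      congr 1
      omega

theorem suffixSums_map (f : ℕ → ℕ) {L : List ℕ} (hL : L.Pairwise (· > ·)) :
    suffixSums (L.map f) =
      L.toFinset.image fun ℓ => ∑ k ∈ L.toFinset.filter (· ≤ ℓ), f k := by
  induction L with
  | nil => rfl
  | cons a L ih =>
    rw [List.pairwise_cons] at hL
    have ha : a ∉ L.toFinset := fun h => lt_irrefl _ (hL.1 a (List.mem_toFinset.mp h))
    have hnd : L.Nodup := hL.2.imp (fun h => ne_of_gt h)
    rw [List.map_cons, suffixSums, ih hL.2, List.toFinset_cons, Finset.image_insert]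
    congr 1
    · rw [Finset.filter_true_of_mem, Finset.sum_insert ha, List.sum_toFinset _ hnd]
      intro x hx
      rcases Finset.mem_insert.mp hx with rfl | hx
      · exact le_rfl
      · exact (hL.1 x (List.mem_toFinset.mp hx)).le
    · refine Finset.image_congr fun ℓ hℓ => ?_
      have := hL.1 ℓ (List.mem_toFinset.mp hℓ)
      rw [Finset.filter_insert, if_neg (by omega)]

/-! ### Arity lists -/

/-- The arities of the intervals starting at `u`, longest interval first. -/
noncomputable def arityList (V : ℤ → Finset ℕ) (u : ℤ) : List ℕ :=
  ((V u).sort (· ≥ ·)).map (arity V u)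

theorem coe_arityList (V : ℤ → Finset ℕ) (u : ℤ) :
    (arityList V u : Multiset ℕ) = (V u).val.map (arity V u) := by
  rw [arityList, ← Multiset.map_coe, Finset.sort_eq]

theorem sum_arityList (V : ℤ → Finset ℕ) (u : ℤ) : (arityList V u).sum = aritySum V u := by
  rw [← Multiset.sum_coe, coe_arityList]
  rfl

theorem suffixSums_arityList (V : ℤ → Finset ℕ) (u : ℤ) :
    suffixSums (arityList V u) = (V u).image (arityUpTo V u) := by
  rw [arityList, suffixSums_map, Finset.sort_toFinset]
  · rfl
  · exact (Finset.sortedGT_sort (V u)).pairwise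

/-! ### Reconstruction of a laminar family from its arity lists. -/

namespace IsLaminar

variable {V : ℤ → Finset ℕ}

theorem pos_of_mem_arityList (hV : IsLaminar V) (u : ℤ) : ∀ a ∈ arityList V u, 0 < a := by
  intro a ha
  obtain ⟨ℓ, hℓ, rfl⟩ := List.mem_map.mp ha
  exact hV.arity_pos ((Finset.mem_sort _).mp hℓ)

theorem isFirst (hV : IsLaminar V) {u : ℤ} {ℓ : ℕ} (hℓ : ℓ ∈ V u) :
    IsFirst (aritySum V) u (arityUpTo V u ℓ) ℓ := by
  have h2 := hV.two_le hℓ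
  exact ⟨⟨by omega, (hV.arityUpTo_add_sum hℓ).le⟩,
    fun j hj hjℓ => hV.le_arityUpTo_add_sum hℓ hj hjℓ⟩

/-- The suffix sums of the list at u are the starting heights `arityUpTo`, one for each interval
starting at u, and uniqueness of the first passage returns the length. Hence the arity lists
determine the family. -/
theorem mem_iff (hV : IsLaminar V) (u : ℤ) (ℓ : ℕ) :
    ℓ ∈ V u ↔ ∃ t ∈ suffixSums (arityList V u),
      IsFirst (fun x => (arityList V x).sum) u t ℓ := by
  have hS : (fun x => (arityList V x).sum) = aritySum V := funext (sum_arityList V)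
  rw [suffixSums_arityList, hS]
  constructor
  · exact fun h => ⟨_, Finset.mem_image_of_mem _ h, hV.isFirst h⟩
  · rintro ⟨t, ht, hf⟩
    obtain ⟨ℓ', hℓ', rfl⟩ := Finset.mem_image.mp ht
    rwa [hf.unique (hV.isFirst hℓ')]

theorem ext_arityList {V' : ℤ → Finset ℕ} (hV : IsLaminar V) (hV' : IsLaminar V')
    (h : arityList V = arityList V') : V = V' := by
  funext u
  ext ℓ
  rw [hV.mem_iff, hV'.mem_iff, h]

end IsLaminar

theorem sum_Ico_of_periodic {α : Type*} [AddCommMonoid α] {F : ℤ → α} {m : ℕ}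
    (hF : ∀ u, F (u + m) = F u) (a : ℤ) :
    ∑ x ∈ Finset.Ico a (a + m), F x = ∑ i ∈ Finset.range m, F i := by
  have h0 : ∑ x ∈ Finset.Ico (0 : ℤ) (0 + m), F x = ∑ i ∈ Finset.range m, F i := by
    refine (Finset.sum_bij (fun (i : ℕ) _ => (i : ℤ)) ?_ ?_ ?_ ?_).symm
    · intro i hi
      have := Finset.mem_range.mp hi
      exact Finset.mem_Ico.mpr ⟨by omega, by omega⟩
    · intro i _ j _ h
      exact_mod_cast h
    · intro x hx
      have := Finset.mem_Ico.mp hx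
      exact ⟨x.toNat, Finset.mem_range.mpr (by omega), by omega⟩
    · exact fun _ _ => rfl
  have hstep : ∀ a : ℤ, ∑ x ∈ Finset.Ico a (a + m), F x =
      ∑ x ∈ Finset.Ico (a + 1) (a + 1 + m), F x := by
    intro a
    rcases Nat.eq_zero_or_pos m with rfl | hm
    · simp
    · have e1 : Finset.Ico a (a + m) = insert a (Finset.Ico (a + 1) (a + m)) := by
        ext x; simp only [Finset.mem_insert, Finset.mem_Ico]; omega
      have e2 : Finset.Ico (a + 1) (a + 1 + m) = insert (a + m) (Finset.Ico (a + 1) (a + m)) := by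
        ext x; simp only [Finset.mem_insert, Finset.mem_Ico]; omega
      rw [e1, e2, Finset.sum_insert (by simp), Finset.sum_insert (by simp), hF]
  rw [← h0]
  induction a using Int.induction_on with
  | zero => rfl
  | succ i ih => rw [← hstep, ih]
  | pred i ih => rw [hstep, show (-(i : ℤ) - 1 + 1) = -i by ring, ih]

/-! ### Periodic laminar families -/

/-- The `m`-periodic laminar families of intervals of length at most `m`. -/
structure IsPeriodicLaminar (m : ℕ) (V : ℤ → Finset ℕ) : Prop extends IsLaminar V where
  periodic : ∀ u, V (u + m) = V u
  le : ∀ {u ℓ}, ℓ ∈ V u → ℓ ≤ m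

/-- `x` lies strictly inside an interval of the family. -/
def Covered (V : ℤ → Finset ℕ) (x : ℤ) : Prop := ∃ u ℓ, ℓ ∈ V u ∧ u < x ∧ x < u + ℓ

/-- The multiset of the arities of the intervals starting in `[0, m)`. -/
noncomputable def arityType (m : ℕ) (V : ℤ → Finset ℕ) : Multiset ℕ :=
  ∑ i ∈ Finset.range m, (arityList V i : Multiset ℕ)

theorem sum_arityType (m : ℕ) (V : ℤ → Finset ℕ) :
    (arityType m V).sum = ∑ i ∈ Finset.range m, aritySum V i := by
  rw [arityType, ← Multiset.coe_sumAddMonoidHom, map_sum]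
  refine Finset.sum_congr rfl fun i _ => ?_
  rw [Multiset.coe_sumAddMonoidHom, Multiset.sum_coe, sum_arityList]

theorem periodic_mul {α : Type*} {F : ℤ → α} {m : ℕ} (hF : ∀ u, F (u + m) = F u) (u k : ℤ) :
    F (u + k * m) = F u := by
  induction k using Int.induction_on with
  | zero => simp
  | succ i ih => rw [← ih, ← hF (u + i * m)]; congr 1; ring
  | pred i ih => rw [← ih, ← hF (u + (-(i : ℤ) - 1) * m)]; congr 1; ring

namespace IsPeriodicLaminar

variable {m : ℕ} {V : ℤ → Finset ℕ}

theorem arity_periodic (hV : IsPeriodicLaminar m V) (u : ℤ) (ℓ : ℕ) :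
    arity V (u + m) ℓ = arity V u ℓ := by
  rw [arity, arity]
  refine Finset.card_bij (fun x _ => x - m) ?_ (fun x _ y _ h => by omega) ?_
  · intro x hx
    rw [mem_innerPts] at hx ⊢
    refine ⟨by omega, fun u' ℓ' h h1 h2 => hx.2 (u' + m) ℓ' ?_ (by omega) (by omega)⟩
    rwa [hV.periodic]
  · intro x hx
    rw [mem_innerPts] at hx
    refine ⟨x + m, mem_innerPts.mpr ⟨by omega, fun u' ℓ' h h1 h2 => ?_⟩, by omega⟩
    refine hx.2 (u' - m) ℓ' ?_ (by omega) (by omega)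
    rwa [← hV.periodic, sub_add_cancel]

theorem arityList_periodic (hV : IsPeriodicLaminar m V) (u : ℤ) :
    arityList V (u + m) = arityList V u := by
  rw [arityList, arityList, hV.periodic]
  exact List.map_congr_left fun ℓ _ => hV.arity_periodic u ℓ

theorem aritySum_periodic (hV : IsPeriodicLaminar m V) (u : ℤ) :
    aritySum V (u + m) = aritySum V u := by
  rw [← sum_arityList, ← sum_arityList, hV.arityList_periodic]

theorem covered_periodic (hV : IsPeriodicLaminar m V) (x : ℤ) :
    Covered V (x + m) ↔ Covered V x := by
  constructor
  · rintro ⟨u, ℓ, h, h1, h2⟩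
    refine ⟨u - m, ℓ, ?_, by omega, by omega⟩
    rwa [← hV.periodic, sub_add_cancel]
  · rintro ⟨u, ℓ, h, h1, h2⟩
    exact ⟨u + m, ℓ, by rwa [hV.periodic], by omega, by omega⟩

/-- The left end of a longest interval: an interval strictly around it would have to contain that
whole interval and be longer. -/
theorem exists_not_covered (hV : IsPeriodicLaminar m V) : ∃ x, ¬ Covered V x := by
  classical
  by_cases hex : ∃ k u, k ∈ V u
  · obtain ⟨k, u, hk⟩ := hex
    have hP : ∃ u, Nat.findGreatest (fun k => ∃ u, k ∈ V u) m ∈ V u :=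
      Nat.findGreatest_spec (P := fun k => ∃ u, k ∈ V u) (hV.le hk) ⟨u, hk⟩
    obtain ⟨u, hu⟩ := hP
    refine ⟨u, ?_⟩
    rintro ⟨u', ℓ', h, h1, h2⟩
    have h3 := hV.nested h hu h1 h2
    have h4 := Nat.le_findGreatest (P := fun k => ∃ u, k ∈ V u) (hV.le h) ⟨u', h⟩
    omega
  · refine ⟨0, ?_⟩
    rintro ⟨u', ℓ', h, -⟩
    exact hex ⟨_, _, h⟩

-- Starting the period at an uncovered point keeps every interval within one period, so the covered
-- points are partitioned into the sets of inner points.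
open Classical in
theorem card_covered (hV : IsPeriodicLaminar m V) :
    ((Finset.range m).filter fun i : ℕ => Covered V i).card = (arityType m V).sum := by
  obtain ⟨x, hx⟩ := hV.exists_not_covered
  have hx' : ¬ Covered V (x + m) := by rwa [hV.covered_periodic]
  rw [sum_arityType, ← sum_Ico_of_periodic hV.aritySum_periodic x, Finset.card_filter]
  have := sum_Ico_of_periodic (F := fun y => if Covered V y then 1 else 0) (m := m)
    (fun u => by rw [hV.covered_periodic]) x
  rw [← this, ← Finset.card_filter]
  have hU : (Finset.Ico x (x + m)).filter (fun y => Covered V y) =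
      ((Finset.Ico x (x + m)).sigma fun u => V u).biUnion fun a => innerPts V a.1 a.2 := by
    ext y
    simp only [Finset.mem_filter, Finset.mem_biUnion, Finset.mem_sigma, Finset.mem_Ico]
    constructor
    · rintro ⟨hy, u, ℓ, hℓ, h1, h2⟩
      obtain ⟨p, q, hq, hyq, -⟩ := hV.exists_mem_innerPts hℓ h1 h2
      have h3 := mem_innerPts.mp hyq
      refine ⟨⟨p, q⟩, ⟨⟨?_, by dsimp only; omega⟩, hq⟩, hyq⟩
      by_contra hlt
      exact hx ⟨p, q, hq, by dsimp only at hlt; omega, by omega⟩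
    · rintro ⟨⟨p, q⟩, ⟨⟨h1, h2⟩, hq⟩, hy⟩
      have h3 := mem_innerPts.mp hy
      dsimp only at *
      refine ⟨⟨by omega, ?_⟩, p, q, hq, h3.1⟩
      by_contra hlt
      exact hx' ⟨p, q, hq, by omega, by omega⟩
  rw [hU, Finset.card_biUnion, Finset.sum_sigma]
  · rfl
  · intro a ha b hb hab
    rw [Function.onFun, Finset.disjoint_left]
    intro y hya hyb
    have ha' := (Finset.mem_sigma.mp ha).2
    have hb' := (Finset.mem_sigma.mp hb).2
    obtain ⟨h1, h3⟩ := hV.innerPts_unique ha' hb' hya hyb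
    exact hab (Sigma.ext h1 (heq_of_eq h3))

end IsPeriodicLaminar

/-! ### Periodic laminar families and tuples of lists -/

open Classical in
/-- The family of intervals whose lengths are the first passage times of the walk attached to a
sequence of lists. -/
noncomputable def ofLists (m : ℕ) (g : ℤ → List ℕ) (u : ℤ) : Finset ℕ :=
  (Finset.range (m + 1)).filter
    fun ℓ => ∃ t ∈ suffixSums (g u), IsFirst (fun x => (g x).sum) u t ℓ

section OfLists

variable {m : ℕ} {g : ℤ → List ℕ}

theorem mem_ofLists {u : ℤ} {ℓ : ℕ} : ℓ ∈ ofLists m g u ↔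
    ℓ ≤ m ∧ ∃ t ∈ suffixSums (g u), IsFirst (fun x => (g x).sum) u t ℓ := by
  simp [ofLists]

/-- As t is at most the increment at u and one full period has total increment less than m, the walk
comes down to 0 within m steps. This is where the bound on the sum is needed. -/
theorem exists_isFirst_of_mem (hg : ∀ u, g (u + m) = g u)
    (hs : ∑ i ∈ Finset.range m, (g i).sum < m) {u : ℤ} {t : ℕ} (ht : t ∈ suffixSums (g u)) :
    ∃ ℓ ∈ ofLists m g u, IsFirst (fun x => (g x).sum) u t ℓ := by
  have h1 : t + ∑ x ∈ Finset.Ioo u (u + m), (g x).sum + 1 ≤ m := by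
    have h2 := sum_Ico_of_periodic (F := fun x => (g x).sum) (m := m)
      (fun u => by rw [hg]) u
    rw [← Finset.Ioo_insert_left (by omega), Finset.sum_insert (by simp)] at h2
    have := le_sum_of_mem_suffixSums ht
    omega
  obtain ⟨k, hk, hf⟩ := exists_isFirst (S := fun x => (g x).sum) (by omega) h1
  exact ⟨k, mem_ofLists.mpr ⟨hk, t, ht, hf⟩, hf⟩

theorem isPeriodicLaminar_ofLists (hg : ∀ u, g (u + m) = g u) (hpos : ∀ u, ∀ a ∈ g u, 0 < a) :
    IsPeriodicLaminar m (ofLists m g) where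
  two_le := by
    intro u ℓ h
    obtain ⟨t, ht, hf⟩ := (mem_ofLists.mp h).2
    exact (hf.eq (pos_of_mem_suffixSums (hpos u) ht)).1
  nested := by
    intro u ℓ u' ℓ' h h' h1 h2
    obtain ⟨t, ht, hf⟩ := (mem_ofLists.mp h).2
    obtain ⟨t', ht', hf'⟩ := (mem_ofLists.mp h').2
    exact hf.nested hf' (le_sum_of_mem_suffixSums ht') h1 h2
  periodic := by
    intro u
    ext ℓ
    rw [mem_ofLists, mem_ofLists, hg]
    refine and_congr_right fun _ => exists_congr fun t => and_congr_right fun _ => ?_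
    have : ∀ j : ℕ, ∑ x ∈ Finset.Ioo (u + m) (u + m + j), (g x).sum =
        ∑ x ∈ Finset.Ioo u (u + j), (g x).sum := fun j => by
      refine Finset.sum_bij (fun x _ => x - m) ?_ (fun x _ y _ h => by omega) ?_ ?_
      · intro x hx
        rw [Finset.mem_Ioo] at hx ⊢
        omega
      · intro x hx
        rw [Finset.mem_Ioo] at hx
        exact ⟨x + m, Finset.mem_Ioo.mpr (by omega), by omega⟩
      · intro x _
        rw [← hg (x - m), sub_add_cancel]
    simp only [IsFirst, this]
  le := by
    intro u ℓ h
    exact (mem_ofLists.mp h).1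

/-- Both `arityUpTo` and t satisfy the same first passage equation with the same ℓ, so it suffices
that the increments strictly inside the interval agree. Those come from shorter intervals, whence
the strong induction. -/
theorem arityUpTo_ofLists (hg : ∀ u, g (u + m) = g u) (hpos : ∀ u, ∀ a ∈ g u, 0 < a)
    (hs : ∑ i ∈ Finset.range m, (g i).sum < m) (ℓ : ℕ) :
    ∀ u t, ℓ ∈ ofLists m g u → t ∈ suffixSums (g u) → IsFirst (fun x => (g x).sum) u t ℓ →
      arityUpTo (ofLists m g) u ℓ = t := by
  have hV := isPeriodicLaminar_ofLists hg hpos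
  induction ℓ using Nat.strong_induction_on with
  | _ ℓ ih =>
  intro u t hℓ ht hf
  have h1 := (hf.eq (pos_of_mem_suffixSums (hpos u) ht)).2
  have h2 := hV.arityUpTo_add_sum hℓ
  have h3 : ∑ x ∈ Finset.Ioo u (u + ℓ), aritySum (ofLists m g) x =
      ∑ x ∈ Finset.Ioo u (u + ℓ), (g x).sum := by
    refine Finset.sum_congr rfl fun x hx => ?_
    rw [Finset.mem_Ioo] at hx
    by_cases hgx : g x = []
    · have : ofLists m g x = ∅ := by
        refine Finset.eq_empty_of_forall_notMem fun k hk => ?_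
        obtain ⟨t, ht, -⟩ := (mem_ofLists.mp hk).2
        simp [hgx, suffixSums] at ht
      rw [aritySum, this, hgx]
      rfl
    -- The full sum of `g x` is a suffix sum; its passage time k is the greatest length at x, so
    -- `arityUpTo` at k is the whole `aritySum` at x.
    · have hmem := sum_mem_suffixSums hgx
      obtain ⟨k, hk, hfk⟩ := exists_isFirst_of_mem hg hs hmem
      have h4 := hV.nested hℓ hk hx.1 hx.2
      rw [← ih k (by omega) x _ hk hmem hfk, arityUpTo, Finset.filter_true_of_mem, aritySum]
      intro k' hk'
      obtain ⟨t', ht', hf'⟩ := (mem_ofLists.mp hk').2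
      rcases (le_sum_of_mem_suffixSums ht').lt_or_eq with hlt | heq
      · exact (hf'.lt hfk (pos_of_mem_suffixSums (hpos x) ht') hlt).le
      · rw [heq] at hf'
        exact (hf'.unique hfk).le
  omega

theorem arityList_ofLists (hg : ∀ u, g (u + m) = g u) (hpos : ∀ u, ∀ a ∈ g u, 0 < a)
    (hs : ∑ i ∈ Finset.range m, (g i).sum < m) : arityList (ofLists m g) = g := by
  have hV := isPeriodicLaminar_ofLists hg hpos
  funext u
  refine suffixSums_injective (hV.pos_of_mem_arityList u) (hpos u) ?_
  rw [suffixSums_arityList]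
  ext t
  rw [Finset.mem_image]
  constructor
  · rintro ⟨ℓ, hℓ, rfl⟩
    obtain ⟨t, ht, hf⟩ := (mem_ofLists.mp hℓ).2
    rwa [arityUpTo_ofLists hg hpos hs ℓ u t hℓ ht hf]
  · intro ht
    obtain ⟨ℓ, hℓ, hf⟩ := exists_isFirst_of_mem hg hs ht
    exact ⟨ℓ, hℓ, arityUpTo_ofLists hg hpos hs ℓ u t hℓ ht hf⟩

end OfLists

/-- Restriction of `arityList` to one period is a bijection onto the m-tuples of lists with content
κ; its inverse is `ofLists` applied to the periodic extension. -/
theorem card_periodicLaminar_mul (s : Finset ℕ) (m : ℕ) (κ : Multiset ℕ) (hs : ∀ a ∈ κ, a ∈ s)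
    (hpos : ∀ a ∈ κ, 0 < a) (hκ : κ.sum < m) :
    Finite {V : ℤ → Finset ℕ // IsPeriodicLaminar m V ∧ arityType m V = κ} ∧
    Nat.card {V : ℤ → Finset ℕ // IsPeriodicLaminar m V ∧ arityType m V = κ} *
      ((m - 1).factorial * ∏ a ∈ s, (κ.count a).factorial) = (m - 1 + κ.card).factorial := by
  classical
  obtain ⟨M, rfl⟩ : ∃ M, m = M + 1 := ⟨m - 1, by omega⟩
  obtain ⟨F, hF, hcard⟩ := exists_finset_lists s M κ hs
  let f : {V : ℤ → Finset ℕ // IsPeriodicLaminar (M + 1) V ∧ arityType (M + 1) V = κ} → F :=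
    fun V => ⟨fun i => arityList V.1 (i : ℕ), by
      rw [hF]
      refine Eq.trans ?_ V.2.2
      rw [arityType, Finset.sum_range]⟩
  have hf : Function.Bijective f := by
    constructor
    · intro V V' h
      have h1 : ∀ i : Fin (M + 1), arityList V.1 (i : ℕ) = arityList V'.1 (i : ℕ) :=
        fun i => congrFun (congrArg Subtype.val h) i
      refine Subtype.ext (V.2.1.ext_arityList V'.2.1.toIsLaminar (funext fun u => ?_))
      have h2 := Int.emod_nonneg u (show ((M + 1 : ℕ) : ℤ) ≠ 0 by omega)
      have h3 := Int.emod_lt_of_pos u (show (0 : ℤ) < (M + 1 : ℕ) by omega)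
      have h4 := h1 ⟨(u % (M + 1 : ℕ)).toNat, by omega⟩
      dsimp only at h4
      rw [Int.toNat_of_nonneg h2] at h4
      have h5 := periodic_mul V.2.1.arityList_periodic (u % (M + 1 : ℕ)) (u / (M + 1 : ℕ))
      have h6 := periodic_mul V'.2.1.arityList_periodic (u % (M + 1 : ℕ)) (u / (M + 1 : ℕ))
      rw [mul_comm, Int.emod_add_mul_ediv] at h5 h6
      rw [h5, h6, h4]
    · rintro ⟨g, hg⟩
      have hg' := (hF g).mp hg
      let G : ℤ → List ℕ := fun u => g ⟨(u % (M + 1 : ℕ)).toNat, by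
        have h2 := Int.emod_nonneg u (show ((M + 1 : ℕ) : ℤ) ≠ 0 by omega)
        have h3 := Int.emod_lt_of_pos u (show (0 : ℤ) < (M + 1 : ℕ) by omega)
        omega⟩
      have hGi : ∀ i : Fin (M + 1), G (i : ℕ) = g i := by
        intro i
        simp only [G]
        congr 1
        ext
        dsimp only
        rw [Int.emod_eq_of_lt (by omega) (by have := i.2; omega)]
        simp
      have hper : ∀ u, G (u + (M + 1 : ℕ)) = G u := by
        intro u
        simp only [G, Int.add_emod_right]
      have hmem : ∀ u, ∀ a ∈ G u, a ∈ κ := by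
        intro u a ha
        rw [← hg', Multiset.mem_sum]
        exact ⟨_, Finset.mem_univ _, ha⟩
      have hsum : ∑ i ∈ Finset.range (M + 1), (G i).sum < M + 1 := by
        rw [Finset.sum_range]
        simp only [hGi]
        have : κ.sum = ∑ i, (g i).sum := by
          rw [← hg', ← Multiset.coe_sumAddMonoidHom, map_sum]
          rfl
        rwa [← this]
      have hlist := arityList_ofLists hper (fun u a ha => hpos a (hmem u a ha)) hsum
      refine ⟨⟨ofLists (M + 1) G,
        isPeriodicLaminar_ofLists hper (fun u a ha => hpos a (hmem u a ha)), ?_⟩, ?_⟩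
      · rw [arityType, hlist, Finset.sum_range, ← hg']
        exact Finset.sum_congr rfl fun i _ => by rw [hGi]
      · refine Subtype.ext (funext fun i => ?_)
        simp only [f, hlist, hGi]
  refine ⟨Finite.of_injective f hf.1, ?_⟩
  rw [Nat.card_congr (Equiv.ofBijective f hf), Nat.card_eq_fintype_card, Fintype.card_coe]
  exact hcard

/-! ### Crossing chords, visibility and cells -/

/-- The vertex of the `N`-gon with a given integer label. -/
def vtx (N : ℕ) [NeZero N] (u : ℤ) : Fin N :=
  ⟨(u % N).toNat, by
    have h0 : (N : ℤ) ≠ 0 := by exact_mod_cast NeZero.ne N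
    have h1 := Int.emod_nonneg u h0
    have h2 := Int.emod_lt_of_pos u (show (0 : ℤ) < N by omega)
    omega⟩

section Vtx

variable {N : ℕ} [NeZero N]

theorem vtx_val_cast (u : ℤ) : ((vtx N u).val : ℤ) = u % N := by
  have h0 : (N : ℤ) ≠ 0 := by exact_mod_cast NeZero.ne N
  exact Int.toNat_of_nonneg (Int.emod_nonneg u h0)

theorem vtx_eq_iff {u v : ℤ} : vtx N u = vtx N v ↔ ∃ k : ℤ, v = u + k * N := by
  rw [Fin.ext_iff, ← Int.natCast_inj, vtx_val_cast, vtx_val_cast]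
  constructor
  · intro h
    obtain ⟨k, hk⟩ := Int.dvd_of_emod_eq_zero (Int.emod_eq_emod_iff_emod_sub_eq_zero.mp h.symm)
    exact ⟨k, by rw [mul_comm]; omega⟩
  · rintro ⟨k, rfl⟩
    simp

theorem vtx_natCast (x : Fin N) : vtx N (x.val : ℤ) = x := by
  rw [Fin.ext_iff, ← Int.natCast_inj, vtx_val_cast, Int.emod_eq_of_lt (by omega)]
  exact_mod_cast x.2

theorem vtx_add_mul (u k : ℤ) : vtx N (u + k * N) = vtx N u :=
  (vtx_eq_iff.mpr ⟨k, rfl⟩).symm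

theorem vtx_add (u v : ℤ) : vtx N (u + v) = vtx N u + vtx N v := by
  rw [Fin.ext_iff, Fin.val_add, ← Int.natCast_inj, vtx_val_cast, Int.natCast_emod,
    Int.natCast_add, vtx_val_cast, vtx_val_cast]
  simp

theorem vtx_one : vtx N 1 = 1 := by
  rw [Fin.ext_iff, ← Int.natCast_inj, vtx_val_cast, Fin.val_one']
  simp

theorem exists_lift (u : ℤ) (p : Fin N) : ∃ x, u ≤ x ∧ x < u + N ∧ vtx N x = p := by
  have h0 : (N : ℤ) ≠ 0 := by exact_mod_cast NeZero.ne N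
  have h1 := Int.emod_nonneg (p.val - u) h0
  have h2 := Int.emod_lt_of_pos (p.val - u) (show (0 : ℤ) < N by omega)
  refine ⟨u + (p.val - u) % N, by omega, by omega, ?_⟩
  have h3 := vtx_add_mul (N := N) p.val (-((p.val - u) / N))
  rw [vtx_natCast] at h3
  have h4 := Int.emod_add_mul_ediv (p.val - u) N
  refine (congrArg (vtx N) ?_).trans h3
  rw [neg_mul, mul_comm]
  omega

theorem vtx_injOn (u : ℤ) {x y : ℤ} (hx : u ≤ x) (hx' : x < u + N) (hy : u ≤ y) (hy' : y < u + N)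
    (h : vtx N x = vtx N y) : x = y := by
  obtain ⟨k, hk⟩ := vtx_eq_iff.mp h
  have h1 : k * (N : ℤ) < 1 * N := by omega
  have h2 : (-1) * (N : ℤ) < k * N := by omega
  have h3 := lt_of_mul_lt_mul_right h1 (by omega)
  have h4 := lt_of_mul_lt_mul_right h2 (by omega)
  obtain rfl : k = 0 := by omega
  omega

end Vtx

namespace TypeA

variable {N : ℕ}

theorem cross_mk_iff (p q x y : Fin N) : Cross s(p, q) s(x, y) ↔
    (p < x ∧ x < q ∧ q < y) ∨ (p < y ∧ y < q ∧ q < x) ∨ (q < x ∧ x < p ∧ p < y) ∨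
    (q < y ∧ y < p ∧ p < x) ∨ (x < p ∧ p < y ∧ y < q) ∨ (x < q ∧ q < y ∧ y < p) ∨
    (y < p ∧ p < x ∧ x < q) ∨ (y < q ∧ q < x ∧ x < p) := by
  constructor
  · rintro ⟨a, b, c, d, h1, h2, h3, ⟨h4, h5⟩ | ⟨h4, h5⟩⟩ <;>
    rw [Sym2.eq_iff] at h4 h5 <;>
    rcases h4 with ⟨rfl, rfl⟩ | ⟨rfl, rfl⟩ <;>
    rcases h5 with ⟨rfl, rfl⟩ | ⟨rfl, rfl⟩ <;> simp only [h1, h2, h3, true_and, true_or, or_true]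
  · rintro (h | h | h | h | h | h | h | h)
    · exact ⟨p, x, q, y, h.1, h.2.1, h.2.2, Or.inl ⟨rfl, rfl⟩⟩
    · exact ⟨p, y, q, x, h.1, h.2.1, h.2.2, Or.inl ⟨rfl, Sym2.eq_swap⟩⟩
    · exact ⟨q, x, p, y, h.1, h.2.1, h.2.2, Or.inl ⟨Sym2.eq_swap, rfl⟩⟩
    · exact ⟨q, y, p, x, h.1, h.2.1, h.2.2, Or.inl ⟨Sym2.eq_swap, Sym2.eq_swap⟩⟩
    · exact ⟨x, p, y, q, h.1, h.2.1, h.2.2, Or.inr ⟨rfl, rfl⟩⟩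
    · exact ⟨x, q, y, p, h.1, h.2.1, h.2.2, Or.inr ⟨rfl, Sym2.eq_swap⟩⟩
    · exact ⟨y, p, x, q, h.1, h.2.1, h.2.2, Or.inr ⟨Sym2.eq_swap, rfl⟩⟩
    · exact ⟨y, q, x, p, h.1, h.2.1, h.2.2, Or.inr ⟨Sym2.eq_swap, Sym2.eq_swap⟩⟩

/-- Crossing depends only on the cyclic order, so the polygon may be cut open at any end u of one
chord. The labels in [u, u + N) keep their order except for a single wrap at N, which is the case
distinction in `hval`. -/
theorem cross_vtx_iff [NeZero N] {u v x y : ℤ} (huv : u < v) (hv : v < u + N) (hx : u ≤ x)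
    (hx' : x < u + N) (hy : u ≤ y) (hy' : y < u + N) :
    Cross s(vtx N u, vtx N v) s(vtx N x, vtx N y) ↔
      (u < x ∧ x < v ∧ v < y) ∨ (u < y ∧ y < v ∧ v < x) := by
  have h0 : (N : ℤ) ≠ 0 := by exact_mod_cast NeZero.ne N
  have hval : ∀ w, u ≤ w → w < u + N → ((vtx N w).val : ℤ) = w - u + u % N ∧ w - u + u % N < N ∨
      ((vtx N w).val : ℤ) = w - u + u % N - N ∧ N ≤ w - u + u % N := by
    intro w h1 h2
    have h3 := Int.emod_nonneg u h0
    have h4 := Int.emod_lt_of_pos u (show (0 : ℤ) < N by omega)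
    have h5 : w % N = (w - u + u % N) % N := by
      rw [Int.add_emod, Int.emod_emod_of_dvd _ dvd_rfl, ← Int.add_emod, sub_add_cancel]
    rw [vtx_val_cast, h5]
    rcases lt_or_ge (w - u + u % N) N with h | h
    · exact Or.inl ⟨Int.emod_eq_of_lt (by omega) h, h⟩
    · right
      refine ⟨?_, h⟩
      rw [Int.emod_eq_sub_self_emod, Int.emod_eq_of_lt (by omega) (by omega)]
  have hU : ((vtx N u).val : ℤ) = u % N := vtx_val_cast u
  have h3 := Int.emod_nonneg u h0
  have h4 := Int.emod_lt_of_pos u (show (0 : ℤ) < N by omega)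
  have hV := hval v huv.le hv
  have hX := hval x hx hx'
  have hY := hval y hy hy'
  rw [cross_mk_iff]
  simp only [Fin.lt_def]
  generalize (vtx N u).val = U at *
  generalize (vtx N v).val = V at *
  generalize (vtx N x).val = X at *
  generalize (vtx N y).val = Y at *
  generalize u % (N : ℤ) = r at *
  rcases hV with hV | hV <;> rcases hX with hX | hX <;> rcases hY with hY | hY <;> omega

/-- No chord of `D` crosses the segment between the two vertices. -/
def Visible (D : Finset (Sym2 (Fin N))) (x y : Fin N) : Prop := ∀ d ∈ D, ¬ Cross d s(x, y)

theorem Visible.symm {D : Finset (Sym2 (Fin N))} {x y : Fin N} (h : Visible D x y) :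
    Visible D y x := by
  intro d hd
  rw [Sym2.eq_swap]
  exact h d hd

/-- A cell of the dissection of the `N`-gon by `D`, as a set of vertices: a maximal set of at
least three mutually visible vertices. -/
structure IsCell (D : Finset (Sym2 (Fin N))) (Q : Finset (Fin N)) : Prop where
  three_le : 3 ≤ Q.card
  visible : ∀ x ∈ Q, ∀ y ∈ Q, Visible D x y
  maximal : ∀ t, (∀ x ∈ Q, Visible D t x) → t ∈ Q

open Classical in
/-- The cells of a dissection. -/
noncomputable def cells (D : Finset (Sym2 (Fin N))) : Finset (Finset (Fin N)) :=
  Finset.univ.filter (IsCell D)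

theorem mem_cells {D : Finset (Sym2 (Fin N))} {Q : Finset (Fin N)} :
    Q ∈ cells D ↔ IsCell D Q := by
  simp [cells]

theorem IsCell.eq_of_subset {D : Finset (Sym2 (Fin N))} {Q Q' : Finset (Fin N)} (hQ : IsCell D Q)
    (hQ' : ∀ x ∈ Q', ∀ y ∈ Q', Visible D x y) (h : Q ⊆ Q') : Q = Q' :=
  Finset.Subset.antisymm h fun t ht => hQ.maximal t fun x hx => hQ' t ht x (h hx)

/-- The intervals of `V` represent the chords of `D`; sides of the polygon are also allowed. -/
structure Represents [NeZero N] (V : ℤ → Finset ℕ) (D : Finset (Sym2 (Fin N))) : Prop where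
  laminar : IsPeriodicLaminar N V
  lt : ∀ {u ℓ}, ℓ ∈ V u → ℓ < N
  mem : ∀ {u ℓ}, ℓ ∈ V u → s(vtx N u, vtx N (u + ℓ)) ∈ D ∨ ℓ + 1 = N
  exists_mem : ∀ d ∈ D, ∃ u ℓ, ℓ ∈ V u ∧ d = s(vtx N u, vtx N (u + ℓ))

/-- The vertices of the cell under an interval. -/
noncomputable def cellUnder (N : ℕ) [NeZero N] (V : ℤ → Finset ℕ) (u : ℤ) (ℓ : ℕ) :
    Finset (Fin N) :=
  (insert u (insert (u + ℓ) (innerPts V u ℓ))).image (vtx N)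

open Classical in
/-- The vertices that are not strictly inside an interval. -/
noncomputable def outerCell (N : ℕ) [NeZero N] (V : ℤ → Finset ℕ) : Finset (Fin N) :=
  Finset.univ.filter fun x : Fin N => ¬ Covered V x.val

theorem mem_cellUnder [NeZero N] {V : ℤ → Finset ℕ} {u : ℤ} {ℓ : ℕ} {x : Fin N} :
    x ∈ cellUnder N V u ℓ ↔ ∃ w, (w = u ∨ w = u + ℓ ∨ w ∈ innerPts V u ℓ) ∧ vtx N w = x := by
  simp [cellUnder, eq_comm]

namespace Represents

variable [NeZero N] {V : ℤ → Finset ℕ} {D : Finset (Sym2 (Fin N))}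

theorem mem_shift (h : Represents V D) {u : ℤ} {ℓ : ℕ} (k : ℤ) (hℓ : ℓ ∈ V u) :
    ℓ ∈ V (u + k * N) := by
  rwa [periodic_mul h.laminar.periodic]

/-- A chord hides what is beyond it from the vertices strictly under it. When the interval
represents a side, nothing is beyond it. -/
theorem le_of_visible (h : Represents V D) {u x y : ℤ} {ℓ : ℕ} (hℓ : ℓ ∈ V u) (h1 : u < x)
    (h2 : x < u + ℓ) (hy : u ≤ y) (hy' : y < u + N) (hv : Visible D (vtx N x) (vtx N y)) :
    y ≤ u + ℓ := by
  by_contra hlt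
  have hN := h.lt hℓ
  rcases h.mem hℓ with hd | hd
  · refine hv _ hd ((cross_vtx_iff (by omega) (by omega) h1.le (by omega) hy hy').mpr
      (Or.inl ⟨h1, h2, by omega⟩))
  · omega

theorem exists_of_not_visible (h : Represents V D) {x y : ℤ}
    (hv : ¬ Visible D (vtx N x) (vtx N y)) :
    (∃ u ℓ y', ℓ ∈ V u ∧ u < x ∧ x < u + ℓ ∧ u + ℓ < y' ∧ y' < u + N ∧ vtx N y' = vtx N y) ∨
    (∃ u ℓ x', ℓ ∈ V u ∧ u < y ∧ y < u + ℓ ∧ u + ℓ < x' ∧ x' < u + N ∧ vtx N x' = vtx N x) := by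
  simp only [Visible, not_forall, not_not] at hv
  obtain ⟨d, hd, hc⟩ := hv
  obtain ⟨u, ℓ, hℓ, rfl⟩ := h.exists_mem d hd
  obtain ⟨x', hx1, hx2, hx3⟩ := exists_lift u (vtx N x)
  obtain ⟨y', hy1, hy2, hy3⟩ := exists_lift u (vtx N y)
  have hN := h.lt hℓ
  have h2 := h.laminar.two_le hℓ
  rw [← hx3, ← hy3, cross_vtx_iff (by omega) (by omega) hx1 hx2 hy1 hy2] at hc
  rcases hc with ⟨c1, c2, c3⟩ | ⟨c1, c2, c3⟩
  · left
    obtain ⟨k, hk⟩ := vtx_eq_iff.mp hx3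
    refine ⟨u + k * N, ℓ, y' + k * N, h.mem_shift k hℓ, by omega, by omega, by omega, by omega, ?_⟩
    rw [vtx_add_mul, hy3]
  · right
    obtain ⟨k, hk⟩ := vtx_eq_iff.mp hy3
    refine ⟨u + k * N, ℓ, x' + k * N, h.mem_shift k hℓ, by omega, by omega, by omega, by omega, ?_⟩
    rw [vtx_add_mul, hx3]

theorem covered_vtx (h : Represents V D) (w : ℤ) : Covered V (vtx N w).val ↔ Covered V w := by
  obtain ⟨k, hk⟩ := vtx_eq_iff.mp (vtx_natCast (vtx N w))
  have := periodic_mul (F := fun y => Covered V y) (m := N)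
    (fun u => propext (h.laminar.covered_periodic u)) ((vtx N w).val : ℤ) k
  rw [← hk] at this
  rw [← this]

theorem mem_outerCell (h : Represents V D) (w : ℤ) :
    vtx N w ∈ outerCell N V ↔ ¬ Covered V w := by
  simp [outerCell, h.covered_vtx]

end Represents

end TypeA

/-! ### The cells of a dissection represented by a family of intervals. -/

namespace TypeA

namespace Represents

variable {N : ℕ} [NeZero N] {V : ℤ → Finset ℕ} {D : Finset (Sym2 (Fin N))}

theorem injOn_interval {u : ℤ} {ℓ : ℕ} (hN : ℓ < N) {x y : ℤ} (hx : u ≤ x) (hx' : x ≤ u + ℓ)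
    (hy : u ≤ y) (hy' : y ≤ u + ℓ) (h : vtx N x = vtx N y) : x = y :=
  vtx_injOn u hx (by omega) hy (by omega) h

theorem visible_cellUnder (h : Represents V D) {u : ℤ} {ℓ : ℕ} (hℓ : ℓ ∈ V u) :
    ∀ x ∈ cellUnder N V u ℓ, ∀ y ∈ cellUnder N V u ℓ, Visible D x y := by
  -- An interval strictly around one vertex of the cell spans all of the cell, so it cannot separate
  -- that vertex from another one.
  have key : ∀ x y : ℤ, (x = u ∨ x = u + ℓ ∨ x ∈ innerPts V u ℓ) →
      (y = u ∨ y = u + ℓ ∨ y ∈ innerPts V u ℓ) → ∀ p q y', q ∈ V p → p < x → x < p + q →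
      p + q < y' → y' < p + N → vtx N y' = vtx N y → False := by
    intro x y hx hy p q y' hq h1 h2 h3 h4 h5
    have hy' : u ≤ y ∧ y ≤ u + ℓ := by
      rcases hy with rfl | rfl | hy
      · omega
      · omega
      · have := (mem_innerPts.mp hy).1
        omega
    have h6 : p ≤ y ∧ y ≤ p + q := by
      rcases hx with rfl | rfl | hx
      · have := h.laminar.nested hq hℓ h1 h2
        omega
      · rcases lt_trichotomy p u with hp | hp | hp
        · omega
        · omega
        · have := h.laminar.nested hℓ hq hp h1
          omega
      · have hx' := mem_innerPts.mp hx
        have h7 := hx'.2 p q hq h1 h2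
        rcases lt_trichotomy p u with hp | hp | hp
        · have := h.laminar.nested hq hℓ hp (by omega)
          omega
        · omega
        · have := h.laminar.nested hℓ hq hp (by omega)
          omega
    have := vtx_injOn p (by omega) h4 h6.1 (by omega) h5
    omega
  intro a ha b hb
  obtain ⟨x, hx, rfl⟩ := mem_cellUnder.mp ha
  obtain ⟨y, hy, rfl⟩ := mem_cellUnder.mp hb
  by_contra hv
  rcases h.exists_of_not_visible hv with ⟨p, q, y', hq, h1, h2, h3, h4, h5⟩ |
    ⟨p, q, x', hq, h1, h2, h3, h4, h5⟩
  · exact key x y hx hy p q y' hq h1 h2 h3 h4 h5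
  · exact key y x hy hx p q x' hq h1 h2 h3 h4 h5

theorem card_cellUnder (h : Represents V D) {u : ℤ} {ℓ : ℕ} (hℓ : ℓ ∈ V u) :
    (cellUnder N V u ℓ).card = arity V u ℓ + 2 := by
  have h2 := h.laminar.two_le hℓ
  have hN := h.lt hℓ
  rw [cellUnder, Finset.card_image_of_injOn, Finset.card_insert_of_notMem,
    Finset.card_insert_of_notMem]
  · rfl
  · intro hm
    have := (mem_innerPts.mp hm).1
    omega
  · rw [Finset.mem_insert, not_or]
    refine ⟨by omega, fun hm => ?_⟩
    have := (mem_innerPts.mp hm).1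
    omega
  · have : ∀ x ∈ insert u (insert (u + ℓ) (innerPts V u ℓ)), u ≤ x ∧ x ≤ u + ℓ := by
      intro x hx
      rw [Finset.mem_insert, Finset.mem_insert] at hx
      rcases hx with rfl | rfl | hx
      · omega
      · omega
      · have := (mem_innerPts.mp hx).1
        omega
    intro x hx y hy hxy
    exact injOn_interval hN (this x hx).1 (this x hx).2 (this y hy).1 (this y hy).2 hxy

theorem isCell_cellUnder (h : Represents V D) {u : ℤ} {ℓ : ℕ} (hℓ : ℓ ∈ V u) :
    IsCell D (cellUnder N V u ℓ) where
  three_le := by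
    rw [h.card_cellUnder hℓ]
    have := h.laminar.arity_pos hℓ
    omega
  visible := h.visible_cellUnder hℓ
  maximal := by
    intro t ht
    have hN := h.lt hℓ
    obtain ⟨w, hw1, hw2, rfl⟩ := exists_lift u t
    obtain ⟨x, hx⟩ := Finset.card_pos.mp (h.laminar.arity_pos hℓ)
    have hx' := mem_innerPts.mp hx
    have h1 := h.le_of_visible hℓ hx'.1.1 hx'.1.2 hw1 hw2
      (ht _ (mem_cellUnder.mpr ⟨x, Or.inr (Or.inr hx), rfl⟩)).symm
    refine mem_cellUnder.mpr ⟨w, ?_, rfl⟩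
    by_contra hne
    simp only [not_or] at hne
    obtain ⟨h2, h3, h4⟩ := hne
    rw [mem_innerPts, not_and] at h4
    have h5 := h4 (by omega)
    push Not at h5
    obtain ⟨p, q, hq, hp1, hp2, hqℓ⟩ := h5
    have h6 : u ≤ p := by
      by_contra hlt
      have := h.laminar.nested hq hℓ (by omega) (by omega)
      omega
    have h7 : p + q ≤ u + ℓ := by
      rcases h6.eq_or_lt with rfl | hlt
      · omega
      · exact h.laminar.nested hℓ hq hlt (by omega)
    rcases h7.lt_or_eq with hlt | heq
    · have := h.le_of_visible hq hp1 hp2 (y := u + ℓ) (by omega) (by omega)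
        (ht _ (mem_cellUnder.mpr ⟨_, Or.inr (Or.inl rfl), rfl⟩))
      omega
    -- When the shorter interval also ends at u + ℓ, the vertex it hides is u, which must be
    -- represented by u + N to lie to the right of the interval.
    · have := h.le_of_visible hq hp1 hp2 (y := u + N) (by omega) (by omega)
        (ht _ (mem_cellUnder.mpr ⟨u, Or.inl rfl, by
          have := vtx_add_mul (N := N) u 1
          rw [one_mul] at this
          exact this.symm⟩))
      omega

theorem visible_outerCell (h : Represents V D) :
    ∀ x ∈ outerCell N V, ∀ y ∈ outerCell N V, Visible D x y := by
  intro a ha b hb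
  by_contra hv
  rw [← vtx_natCast a] at ha hv
  rw [← vtx_natCast b] at hb hv
  rw [h.mem_outerCell] at ha hb
  rcases h.exists_of_not_visible hv with ⟨p, q, y', hq, h1, h2, -⟩ | ⟨p, q, x', hq, h1, h2, -⟩
  · exact ha ⟨p, q, hq, h1, h2⟩
  · exact hb ⟨p, q, hq, h1, h2⟩

theorem isCell_outerCell (h : Represents V D) (h3 : 3 ≤ (outerCell N V).card) :
    IsCell D (outerCell N V) where
  three_le := h3
  visible := h.visible_outerCell
  maximal := by
    intro t ht
    rw [← vtx_natCast t] at ht ⊢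
    rw [h.mem_outerCell]
    rintro ⟨p, q, hq, h1, h2⟩
    have hsub : outerCell N V ⊆ {vtx N p, vtx N (p + q)} := by
      intro y hy
      obtain ⟨w, hw1, hw2, rfl⟩ := exists_lift p y
      have h4 := h.le_of_visible hq h1 h2 hw1 hw2 (ht _ hy)
      rw [h.mem_outerCell] at hy
      have h5 : w = p ∨ w = p + q := by
        by_contra hne
        exact hy ⟨p, q, hq, by omega, by omega⟩
      rcases h5 with rfl | rfl <;> simp
    have := Finset.card_le_card hsub
    have := Finset.card_le_two (a := vtx N p) (b := vtx N (p + q))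
    omega

/-- If some interval spans Q, take a shortest one: a vertex of Q that is not on its cell is strictly
under a shorter interval, which by visibility also spans Q. If no interval spans Q, no vertex of Q
is covered. -/
theorem exists_of_isCell (h : Represents V D) {Q : Finset (Fin N)} (hQ : IsCell D Q) :
    (∃ u ℓ, ℓ ∈ V u ∧ Q = cellUnder N V u ℓ) ∨ Q = outerCell N V := by
  classical
  have hcov : ∀ w p q, q ∈ V p → p < w → w < p + q → vtx N w ∈ Q →
      ∀ t ∈ Q, ∃ y, p ≤ y ∧ y ≤ p + q ∧ vtx N y = t := by
    intro w p q hq h1 h2 hw t ht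
    obtain ⟨y, hy1, hy2, rfl⟩ := exists_lift p t
    exact ⟨y, hy1, h.le_of_visible hq h1 h2 hy1 hy2 (hQ.visible _ hw _ ht), rfl⟩
  by_cases hex : ∃ ℓ u, ℓ ∈ V u ∧ ∀ t ∈ Q, ∃ y, u ≤ y ∧ y ≤ u + ℓ ∧ vtx N y = t
  · left
    obtain ⟨u, hu, hsub⟩ := Nat.find_spec hex
    refine ⟨u, _, hu, hQ.eq_of_subset (h.visible_cellUnder hu) fun t ht => ?_⟩
    obtain ⟨w, hw1, hw2, rfl⟩ := hsub t ht
    refine mem_cellUnder.mpr ⟨w, ?_, rfl⟩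
    by_contra hne
    simp only [not_or] at hne
    obtain ⟨h2, h3, h4⟩ := hne
    rw [mem_innerPts, not_and] at h4
    have h5 := h4 (by omega)
    push Not at h5
    obtain ⟨p, q, hq, hp1, hp2, hqℓ⟩ := h5
    exact Nat.find_min hex hqℓ ⟨p, hq, hcov w p q hq hp1 hp2 ht⟩
  · right
    refine hQ.eq_of_subset h.visible_outerCell fun t ht => ?_
    rw [← vtx_natCast t] at ht ⊢
    rw [h.mem_outerCell]
    rintro ⟨p, q, hq, h1, h2⟩
    exact hex ⟨q, p, hq, hcov _ p q hq h1 h2 ht⟩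

/-- After translation by a multiple of N the two intervals share an inner point, and a point is
inner for only one interval of the family. The rest is the case where the chosen inner point of the
first is an end of the second. -/
theorem cellUnder_injective (h : Represents V D) {u p : ℤ} {ℓ q : ℕ} (hℓ : ℓ ∈ V u) (hq : q ∈ V p)
    (he : cellUnder N V u ℓ = cellUnder N V p q) : (∃ k : ℤ, u = p + k * N) ∧ ℓ = q := by
  obtain ⟨x, hx⟩ := Finset.card_pos.mp (h.laminar.arity_pos hℓ)
  have hxm : vtx N x ∈ cellUnder N V p q := he ▸ mem_cellUnder.mpr ⟨x, Or.inr (Or.inr hx), rfl⟩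
  obtain ⟨x', hx', hxx⟩ := mem_cellUnder.mp hxm
  obtain ⟨k, hk⟩ := vtx_eq_iff.mp hxx
  obtain ⟨p', hp'⟩ : ∃ p', p' = p + k * N := ⟨_, rfl⟩
  have hq' : q ∈ V p' := hp' ▸ h.mem_shift k hq
  have he' : cellUnder N V p q = cellUnder N V p' q := by
    refine (h.isCell_cellUnder hq).eq_of_subset (h.visible_cellUnder hq') fun t ht => ?_
    obtain ⟨w, hw, rfl⟩ := mem_cellUnder.mp ht
    refine mem_cellUnder.mpr ⟨w + k * N, ?_, vtx_add_mul w k⟩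
    rw [hp']
    rcases hw with rfl | rfl | hw
    · exact Or.inl rfl
    · right; left; ring
    · right; right
      rw [mem_innerPts] at hw ⊢
      refine ⟨by omega, fun u' ℓ' h' h1 h2 => ?_⟩
      have := h.mem_shift (-k) h'
      rw [neg_mul] at this
      exact hw.2 _ ℓ' this (by omega) (by omega)
  have hxp : x = p' ∨ x = p' + q ∨ x ∈ innerPts V p' q := by
    obtain ⟨w, hw, hwx⟩ := mem_cellUnder.mp (he' ▸ hxm)
    have hw' : p' ≤ w ∧ w ≤ p' + q := by
      rcases hw with rfl | rfl | hw
      · omega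
      · omega
      · have := (mem_innerPts.mp hw).1
        omega
    have hx'' : p' ≤ x ∧ x ≤ p' + q := by
      rcases hx' with rfl | rfl | hx'
      · omega
      · omega
      · have := (mem_innerPts.mp hx').1
        omega
    obtain rfl := injOn_interval (h.lt hq) hw'.1 hw'.2 hx''.1 hx''.2 hwx
    exact hw
  have hxu := (mem_innerPts.mp hx).1
  obtain ⟨y, hy⟩ := Finset.card_pos.mp (h.laminar.arity_pos hq')
  have hyp := (mem_innerPts.mp hy).1
  -- If the second interval is nested in the first, then its inner point y is a vertex of the common
  -- cell strictly between u and u + ℓ, so y is inner for both.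
  have hend : u ≤ p' → p' + q ≤ u + ℓ → y ∈ innerPts V u ℓ := by
    intro h1 h2
    have hym : vtx N y ∈ cellUnder N V u ℓ := by
      rw [he, he']
      exact mem_cellUnder.mpr ⟨y, Or.inr (Or.inr hy), rfl⟩
    obtain ⟨w, hw, hwy⟩ := mem_cellUnder.mp hym
    have hw' : u ≤ w ∧ w ≤ u + ℓ := by
      rcases hw with rfl | rfl | hw
      · omega
      · omega
      · have := (mem_innerPts.mp hw).1
        omega
    obtain rfl := injOn_interval (h.lt hℓ) hw'.1 hw'.2 (y := y) (by omega) (by omega) hwy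
    rcases hw with rfl | rfl | hw
    · omega
    · omega
    · exact hw
  have hfin : u = p' ∧ ℓ = q := by
    rcases hxp with rfl | rfl | hxp
    · have h1 := h.laminar.nested hℓ hq' hxu.1 hxu.2
      exact h.laminar.innerPts_unique hℓ hq' (hend (by omega) h1) hy
    · have h1 : u ≤ p' := by
        by_contra hlt
        have := h.laminar.nested hq' hℓ (by omega) hxu.1
        omega
      exact h.laminar.innerPts_unique hℓ hq' (hend h1 (by omega)) hy
    · exact h.laminar.innerPts_unique hℓ hq' hx hxp
  exact ⟨⟨k, by rw [hfin.1, hp']⟩, hfin.2⟩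

theorem cellUnder_ne_outerCell (h : Represents V D) {u : ℤ} {ℓ : ℕ} (hℓ : ℓ ∈ V u) :
    cellUnder N V u ℓ ≠ outerCell N V := by
  intro he
  obtain ⟨x, hx⟩ := Finset.card_pos.mp (h.laminar.arity_pos hℓ)
  have hm : vtx N x ∈ outerCell N V := he ▸ mem_cellUnder.mpr ⟨x, Or.inr (Or.inr hx), rfl⟩
  rw [h.mem_outerCell] at hm
  have := (mem_innerPts.mp hx).1
  exact hm ⟨u, ℓ, hℓ, this⟩

/-- The cells of a dissection are those under the representing intervals and the outer one. -/
theorem sum_cells (h : Represents V D) (F : ℕ → ℕ) :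
    ∑ Q ∈ cells D, F Q.card = ((arityType N V).map fun j => F (j + 2)).sum +
      if 3 ≤ (outerCell N V).card then F (outerCell N V).card else 0 := by
  classical
  let A : Finset (Σ _ : ℕ, ℕ) := (Finset.range N).sigma fun i => V i
  have hA : ∀ a ∈ A, a.2 ∈ V a.1 := fun a ha => (Finset.mem_sigma.mp ha).2
  have hcells : cells D = A.image (fun a => cellUnder N V a.1 a.2) ∪
      if 3 ≤ (outerCell N V).card then {outerCell N V} else ∅ := by
    ext Q
    rw [mem_cells, Finset.mem_union, Finset.mem_image]
    constructor
    · intro hQ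
      rcases h.exists_of_isCell hQ with ⟨u, ℓ, hℓ, rfl⟩ | rfl
      · left
        have h1 := vtx_natCast (vtx N u)
        obtain ⟨k, hk⟩ := vtx_eq_iff.mp h1
        have hm : ℓ ∈ V ((vtx N u).val : ℤ) := by
          rw [hk] at hℓ
          rwa [periodic_mul h.laminar.periodic] at hℓ
        refine ⟨⟨(vtx N u).val, ℓ⟩, Finset.mem_sigma.mpr
          ⟨Finset.mem_range.mpr (vtx N u).2, hm⟩, ?_⟩
        refine (h.isCell_cellUnder hm).eq_of_subset (h.visible_cellUnder hℓ) fun t ht => ?_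
        obtain ⟨w, hw, rfl⟩ := mem_cellUnder.mp ht
        refine mem_cellUnder.mpr ⟨w + k * N, ?_, vtx_add_mul w k⟩
        rcases hw with rfl | rfl | hw
        · exact Or.inl hk.symm
        · right; left; omega
        · right; right
          rw [mem_innerPts] at hw ⊢
          refine ⟨by omega, fun u' ℓ' h' h1 h2 => ?_⟩
          have := h.mem_shift (-k) h'
          rw [neg_mul] at this
          exact hw.2 _ ℓ' this (by omega) (by omega)
      · right
        rw [if_pos hQ.three_le]
        exact Finset.mem_singleton_self _
    · rintro (⟨a, ha, rfl⟩ | hQ)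
      · exact h.isCell_cellUnder (hA a ha)
      · split_ifs at hQ with h3
        · rw [Finset.mem_singleton.mp hQ]
          exact h.isCell_outerCell h3
        · simp at hQ
  rw [hcells, Finset.sum_union]
  · congr 1
    · rw [Finset.sum_image]
      · rw [Finset.sum_congr rfl fun a ha => by rw [h.card_cellUnder (hA a ha)],
          Finset.sum_sigma, arityType, ← Multiset.coe_mapAddMonoidHom, map_sum,
          ← Multiset.coe_sumAddMonoidHom, map_sum]
        refine Finset.sum_congr rfl fun i _ => ?_
        rw [Multiset.coe_mapAddMonoidHom, Multiset.coe_sumAddMonoidHom, coe_arityList,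
          Multiset.map_map]
        rfl
      · intro a ha b hb hab
        have ha1 := Finset.mem_range.mp (Finset.mem_sigma.mp ha).1
        have hb1 := Finset.mem_range.mp (Finset.mem_sigma.mp hb).1
        obtain ⟨⟨k, hk⟩, h2⟩ := h.cellUnder_injective (hA a ha) (hA b hb) hab
        have h3 := vtx_add_mul (N := N) (b.1 : ℤ) k
        rw [← hk] at h3
        have h4 := vtx_injOn 0 (by omega) (by omega) (by omega) (by omega) h3
        exact Sigma.ext (by exact_mod_cast h4) (heq_of_eq h2)
    · split_ifs <;> simp
  · rw [Finset.disjoint_left]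
    intro Q hQ hQ'
    obtain ⟨a, ha, rfl⟩ := Finset.mem_image.mp hQ
    split_ifs at hQ'
    · exact h.cellUnder_ne_outerCell (hA a ha) (Finset.mem_singleton.mp hQ')
    · simp at hQ'

theorem card_outerCell_add (h : Represents V D) :
    (outerCell N V).card + (arityType N V).sum = N := by
  classical
  rw [← h.laminar.card_covered]
  have h1 : (outerCell N V).card =
      ((Finset.range N).filter fun i : ℕ => ¬ Covered V i).card := by
    refine Finset.card_bij (fun x _ => x.val) ?_ (fun x _ y _ hxy => Fin.ext hxy) ?_
    · intro x hx
      have := (Finset.mem_filter.mp hx).2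
      exact Finset.mem_filter.mpr ⟨Finset.mem_range.mpr x.2, this⟩
    · intro i hi
      obtain ⟨h2, h3⟩ := Finset.mem_filter.mp hi
      exact ⟨⟨i, Finset.mem_range.mp h2⟩, Finset.mem_filter.mpr ⟨Finset.mem_univ _, h3⟩, rfl⟩
  rw [h1, add_comm, Finset.card_filter_add_card_filter_not, Finset.card_range]

end Represents

end TypeA

namespace TypeA

/-! ### Fixed spaces and reflection length -/

/-- The fixed space of a permutation acting on `ℝ^n`. -/
def fixSpace {n : ℕ} (σ : Equiv.Perm (Fin n)) : Submodule ℝ (Fin n → ℝ) where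
  carrier := {v | ∀ i, v (σ i) = v i}
  zero_mem' := fun _ => rfl
  add_mem' := fun hv hw i => by simp [hv i, hw i]
  smul_mem' := fun c v hv i => by simp [hv i]

/-- The reflecting hyperplane of the transposition `(a b)`. -/
def eqSpace {n : ℕ} (a b : Fin n) : Submodule ℝ (Fin n → ℝ) where
  carrier := {v | v a = v b}
  zero_mem' := rfl
  add_mem' := fun {v w} hv hw => by
    change v a + w a = v b + w b
    rw [show v a = v b from hv, show w a = w b from hw]
  smul_mem' := fun c v hv => by
    change c * v a = c * v b
    rw [show v a = v b from hv]

section FixSpace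

variable {n : ℕ}

open Module

theorem mem_fixSpace {σ : Equiv.Perm (Fin n)} {v : Fin n → ℝ} :
    v ∈ fixSpace σ ↔ ∀ i, v (σ i) = v i := Iff.rfl

theorem mem_eqSpace {a b : Fin n} {v : Fin n → ℝ} : v ∈ eqSpace a b ↔ v a = v b := Iff.rfl

theorem le_finrank_eqSpace (a b : Fin n) : n ≤ finrank ℝ (eqSpace a b) + 1 := by
  let f : (Fin n → ℝ) →ₗ[ℝ] ℝ := LinearMap.proj (R := ℝ) (φ := fun _ => ℝ) a -
    LinearMap.proj (R := ℝ) (φ := fun _ => ℝ) b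
  have hf : f.ker = eqSpace a b := by
    ext v
    simp [f, mem_eqSpace, sub_eq_zero]
  have h1 := f.finrank_range_add_finrank_ker
  have h2 := Submodule.finrank_le f.range
  rw [hf, Module.finrank_fin_fun] at h1
  rw [Module.finrank_self] at h2
  omega

theorem finrank_le_inf_eqSpace (W : Submodule ℝ (Fin n → ℝ)) (a b : Fin n) :
    finrank ℝ W ≤ finrank ℝ (W ⊓ eqSpace a b : Submodule ℝ (Fin n → ℝ)) + 1 := by
  have h1 := Submodule.finrank_sup_add_finrank_inf_eq W (eqSpace a b)
  have h2 := Submodule.finrank_le (W ⊔ eqSpace a b)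
  have h3 := le_finrank_eqSpace a b
  rw [Module.finrank_fin_fun] at h2
  omega

/-- The transposition acts trivially on its own hyperplane. So multiplying by it changes the
dimension of the fixed space by at most one. -/
theorem fixSpace_swap_mul_inf (a b : Fin n) (σ : Equiv.Perm (Fin n)) :
    fixSpace (Equiv.swap a b * σ) ⊓ eqSpace a b = fixSpace σ ⊓ eqSpace a b := by
  ext v
  rw [Submodule.mem_inf, Submodule.mem_inf]
  refine and_congr_left fun h => forall_congr' fun i => ?_
  rw [mem_eqSpace] at h
  have : v ((Equiv.swap a b * σ) i) = v (σ i) := by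
    rw [Equiv.Perm.mul_apply, Equiv.swap_apply_def]
    split_ifs with h1 h2
    · rw [h1, h]
    · rw [h2, h]
    · rfl
  rw [this]

theorem finrank_fixSpace_le_swap_mul (a b : Fin n) (σ : Equiv.Perm (Fin n)) :
    finrank ℝ (fixSpace σ) ≤ finrank ℝ (fixSpace (Equiv.swap a b * σ)) + 1 := by
  have h1 := finrank_le_inf_eqSpace (fixSpace σ) a b
  rw [← fixSpace_swap_mul_inf] at h1
  have h2 := Submodule.finrank_mono
    (inf_le_left : fixSpace (Equiv.swap a b * σ) ⊓ eqSpace a b ≤ fixSpace (Equiv.swap a b * σ))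
  omega

theorem finrank_fixSpace_swap_mul_le (a b : Fin n) (σ : Equiv.Perm (Fin n)) :
    finrank ℝ (fixSpace (Equiv.swap a b * σ)) ≤ finrank ℝ (fixSpace σ) + 1 := by
  have := finrank_fixSpace_le_swap_mul a b (Equiv.swap a b * σ)
  rwa [Equiv.swap_mul_self_mul] at this

theorem finrank_fixSpace_one : finrank ℝ (fixSpace (1 : Equiv.Perm (Fin n))) = n := by
  have : fixSpace (1 : Equiv.Perm (Fin n)) = ⊤ := by
    ext v
    simp [mem_fixSpace]
  rw [this, finrank_top, Module.finrank_fin_fun]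

theorem finrank_fixSpace_le (σ : Equiv.Perm (Fin n)) : finrank ℝ (fixSpace σ) ≤ n := by
  have := Submodule.finrank_le (fixSpace σ)
  rwa [Module.finrank_fin_fun] at this

theorem le_length_add_finrank (L : List (Equiv.Perm (Fin n))) (hL : ∀ t ∈ L, t.IsSwap) :
    n ≤ L.length + finrank ℝ (fixSpace L.prod) := by
  induction L with
  | nil => rw [List.prod_nil, finrank_fixSpace_one]; omega
  | cons t L ih =>
    obtain ⟨a, b, -, rfl⟩ := hL t (by simp)
    have h1 := ih fun t ht => hL t (by simp [ht])
    have h2 := finrank_fixSpace_le_swap_mul a b L.prod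
    rw [List.prod_cons, List.length_cons]
    omega

theorem exists_swaps_of_finrank (k : ℕ) : ∀ σ : Equiv.Perm (Fin n),
    k + finrank ℝ (fixSpace σ) = n →
    ∃ L : List (Equiv.Perm (Fin n)), (∀ t ∈ L, t.IsSwap) ∧ L.prod = σ ∧ L.length = k := by
  induction k with
  | zero =>
    intro σ hσ
    refine ⟨[], by simp, ?_, rfl⟩
    have htop : fixSpace σ = ⊤ := by
      apply Submodule.eq_top_of_finrank_eq
      rw [Module.finrank_fin_fun]
      omega
    ext i
    have h1 : (Pi.single i 1 : Fin n → ℝ) ∈ fixSpace σ := htop ▸ Submodule.mem_top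
    have h2 := mem_fixSpace.mp h1 i
    rw [Pi.single_eq_same] at h2
    by_contra hne
    rw [Pi.single_eq_of_ne] at h2
    · exact zero_ne_one h2
    · intro h
      rw [h] at hne
      exact hne rfl
  | succ k ih =>
    intro σ hσ
    have hne : σ ≠ 1 := by
      rintro rfl
      rw [finrank_fixSpace_one] at hσ
      omega
    obtain ⟨x, hx⟩ : ∃ x, σ x ≠ x := by
      by_contra h
      push Not at h
      exact hne (Equiv.ext h)
    -- Multiplying by (x σx) makes x an additional fixed point while preserving all fixed vectors;
    -- the indicator of x is the new one.
    have hlt : fixSpace σ < fixSpace (Equiv.swap x (σ x) * σ) := by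
      refine lt_of_le_of_ne (fun v hv => ?_) fun h => ?_
      · have h1 : v ∈ fixSpace σ ⊓ eqSpace x (σ x) :=
          ⟨hv, mem_eqSpace.mpr (mem_fixSpace.mp hv x).symm⟩
        rw [← fixSpace_swap_mul_inf] at h1
        exact h1.1
      · have h1 : (Pi.single x 1 : Fin n → ℝ) ∈ fixSpace (Equiv.swap x (σ x) * σ) := by
          intro i
          by_cases hi : i = x
          · subst hi
            simp
          · rw [Pi.single_eq_of_ne hi, Pi.single_eq_of_ne]
            intro h2
            refine hi ((Equiv.swap x (σ x) * σ).injective ?_)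
            rw [h2]
            simp
        rw [← h] at h1
        have h2 := mem_fixSpace.mp h1 x
        rw [Pi.single_eq_same, Pi.single_eq_of_ne hx] at h2
        exact zero_ne_one h2
    have h1 := Submodule.finrank_lt_finrank_of_lt hlt
    have h2 := finrank_fixSpace_swap_mul_le x (σ x) σ
    obtain ⟨L, hL, hLp, hLl⟩ := ih (Equiv.swap x (σ x) * σ) (by omega)
    refine ⟨Equiv.swap x (σ x) :: L, ?_, ?_, by simp [hLl]⟩
    · intro t ht
      rcases List.mem_cons.mp ht with rfl | ht
      · exact ⟨x, σ x, hx.symm, rfl⟩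
      · exact hL t ht
    · rw [List.prod_cons, hLp, Equiv.swap_mul_self_mul]

/-- Each transposition lowers the dimension of the fixed space by at most one, and a transposition
raising it by one exists until the identity is reached. So reflection length is the codimension of
the fixed space. -/
theorem reflLength_add_finrank (σ : Equiv.Perm (Fin n)) :
    reflLength σ + finrank ℝ (fixSpace σ) = n := by
  have h0 := finrank_fixSpace_le σ
  obtain ⟨L, hL⟩ := exists_swaps_of_finrank (n - finrank ℝ (fixSpace σ)) σ (by omega)
  have h1 : reflLength σ ≤ n - finrank ℝ (fixSpace σ) := Nat.sInf_le ⟨L, hL⟩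
  obtain ⟨L', hL', hp, hl⟩ := Nat.sInf_mem (s := {m | ∃ L : List (Equiv.Perm (Fin n)),
    (∀ t ∈ L, t.IsSwap) ∧ L.prod = σ ∧ L.length = m}) ⟨_, L, hL⟩
  have h2 := le_length_add_finrank L' hL'
  rw [hp, hl] at h2
  change n ≤ reflLength σ + _ at h2
  omega

theorem sign_eq_pow_reflLength (σ : Equiv.Perm (Fin n)) :
    Equiv.Perm.sign σ = (-1) ^ reflLength σ := by
  obtain ⟨L, hL, hp, hl⟩ := exists_swaps_of_finrank (reflLength σ) σ (reflLength_add_finrank σ)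
  rw [← hp, Equiv.Perm.sign_prod_list_swap hL, hp, hl]

/-- A parity argument: a transposition changes the sign, and the sign is (-1) to the codimension of
the fixed space. -/
theorem finrank_fixSpace_swap_mul_ne {a b : Fin n} (hab : a ≠ b) (σ : Equiv.Perm (Fin n)) :
    finrank ℝ (fixSpace (Equiv.swap a b * σ)) ≠ finrank ℝ (fixSpace σ) := by
  intro h
  have h1 := reflLength_add_finrank σ
  have h2 := reflLength_add_finrank (Equiv.swap a b * σ)
  have h3 : reflLength (Equiv.swap a b * σ) = reflLength σ := by omega
  have h4 := sign_eq_pow_reflLength (Equiv.swap a b * σ)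
  rw [map_mul, Equiv.Perm.sign_swap hab, h3, ← sign_eq_pow_reflLength] at h4
  have h5 := mul_right_cancel (h4.trans (one_mul _).symm)
  exact absurd h5 (by decide)

theorem finrank_fixSpace_swap_mul_of_not_le {a b : Fin n} (hab : a ≠ b) {σ : Equiv.Perm (Fin n)}
    (h : ¬ fixSpace σ ≤ eqSpace a b) :
    finrank ℝ (fixSpace (Equiv.swap a b * σ)) + 1 = finrank ℝ (fixSpace σ) := by
  have h1 : finrank ℝ (fixSpace σ ⊓ eqSpace a b : Submodule ℝ (Fin n → ℝ)) <
      finrank ℝ (fixSpace σ) := Submodule.finrank_lt_finrank_of_lt (inf_lt_left.mpr h)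
  have h2 := finrank_le_inf_eqSpace (fixSpace (Equiv.swap a b * σ)) a b
  rw [fixSpace_swap_mul_inf] at h2
  have h3 := finrank_fixSpace_swap_mul_ne hab σ
  have h4 := finrank_fixSpace_le_swap_mul a b σ
  omega

/-! ### Products of the reflections of an independent family -/

/-- The intersection of the reflecting hyperplanes of a list of transpositions. -/
def commonSpace (L : List (Fin n × Fin n)) : Submodule ℝ (Fin n → ℝ) where
  carrier := {v | ∀ p ∈ L, v p.1 = v p.2}
  zero_mem' := fun _ _ => rfl
  add_mem' := fun {v w} hv hw p hp => by simp [hv p hp, hw p hp]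
  smul_mem' := fun c v hv p hp => by simp [hv p hp]

theorem commonSpace_cons (p : Fin n × Fin n) (L : List (Fin n × Fin n)) :
    commonSpace (p :: L) = commonSpace L ⊓ eqSpace p.1 p.2 := by
  ext v
  change (∀ q ∈ p :: L, v q.1 = v q.2) ↔ (∀ q ∈ L, v q.1 = v q.2) ∧ v p.1 = v p.2
  simp [and_comm]

/-- The product of a list of transpositions. -/
def swapProd (L : List (Fin n × Fin n)) : Equiv.Perm (Fin n) :=
  (L.map fun p => Equiv.swap p.1 p.2).prod

theorem swapProd_cons (p : Fin n × Fin n) (L : List (Fin n × Fin n)) :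
    swapProd (p :: L) = Equiv.swap p.1 p.2 * swapProd L := by
  simp [swapProd]

theorem le_length_add_finrank_commonSpace (L : List (Fin n × Fin n)) :
    n ≤ L.length + finrank ℝ (commonSpace L) := by
  induction L with
  | nil =>
    have : commonSpace ([] : List (Fin n × Fin n)) = ⊤ := by
      ext v
      change (∀ q ∈ ([] : List (Fin n × Fin n)), v q.1 = v q.2) ↔ _
      simp
    rw [this, finrank_top, Module.finrank_fin_fun]
    omega
  | cons p L ih =>
    have := finrank_le_inf_eqSpace (commonSpace L) p.1 p.2
    rw [commonSpace_cons, List.length_cons]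
    omega

theorem commonSpace_le_fixSpace (L : List (Fin n × Fin n)) :
    commonSpace L ≤ fixSpace (swapProd L) := by
  induction L with
  | nil =>
    intro v _ i
    rfl
  | cons p L ih =>
    rw [commonSpace_cons, swapProd_cons]
    intro v hv
    have h1 : v ∈ fixSpace (swapProd L) ⊓ eqSpace p.1 p.2 := ⟨ih hv.1, hv.2⟩
    rw [← fixSpace_swap_mul_inf] at h1
    exact h1.1

/-- One direction of Carter's lemma: if the hyperplanes are independent, the fixed space of the
product is their intersection. The hypothesis does not see the order of the list, so the result
serves every ordering of a face. -/
theorem finrank_fixSpace_swapProd (L : List (Fin n × Fin n)) (hL : ∀ p ∈ L, p.1 ≠ p.2)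
    (h : L.length + finrank ℝ (commonSpace L) = n) :
    L.length + finrank ℝ (fixSpace (swapProd L)) = n := by
  induction L with
  | nil =>
    rw [show swapProd ([] : List (Fin n × Fin n)) = 1 from rfl, finrank_fixSpace_one]
    exact Nat.zero_add n
  | cons p L ih =>
    have h1 := finrank_le_inf_eqSpace (commonSpace L) p.1 p.2
    have h2 := le_length_add_finrank_commonSpace L
    rw [commonSpace_cons, List.length_cons] at h
    have h3 := ih (fun q hq => hL q (by simp [hq])) (by omega)
    have h4 : commonSpace L = fixSpace (swapProd L) :=
      Submodule.eq_of_le_of_finrank_eq (commonSpace_le_fixSpace L) (by omega)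
    have h5 : ¬ fixSpace (swapProd L) ≤ eqSpace p.1 p.2 := by
      rw [← h4]
      intro hle
      rw [inf_eq_left.mpr hle] at h
      omega
    have h6 := finrank_fixSpace_swap_mul_of_not_le (hL p (by simp)) h5
    rw [swapProd_cons, List.length_cons]
    omega

end FixSpace

end TypeA

namespace TypeA

/-! ### Cutting an `n`-cycle -/

section Cuts

variable {n : ℕ}

/-- The point `x` lies in the interval cut out by the pair `χ`, in the order given by `r`. -/
def InCut (r : Fin n → ℕ) (χ : Fin n × Fin n) (x : Fin n) : Prop :=
  min (r χ.1) (r χ.2) ≤ r x ∧ r x < max (r χ.1) (r χ.2)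

/-- No cut of the list separates the two points. -/
def SameClass (r : Fin n → ℕ) (E : List (Fin n × Fin n)) (x y : Fin n) : Prop :=
  ∀ χ ∈ E, (InCut r χ x ↔ InCut r χ y)

/-- `q` is strictly between `p` and `s` in the cyclic order. -/
def CycBtw (p q s : ℕ) : Prop := (p < q ∧ q < s) ∨ (s ≤ p ∧ (p < q ∨ q < s))

/-- The permutation `σ` sends every point to the next one of its class. -/
def IsNext (r : Fin n → ℕ) (E : List (Fin n × Fin n)) (σ : Equiv.Perm (Fin n)) : Prop :=
  ∀ x, SameClass r E x (σ x) ∧ ∀ y, SameClass r E x y → ¬ CycBtw (r x) (r y) (r (σ x))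

theorem SameClass.symm {r : Fin n → ℕ} {E : List (Fin n × Fin n)} {x y : Fin n}
    (h : SameClass r E x y) : SameClass r E y x := fun χ hχ => (h χ hχ).symm

theorem SameClass.trans {r : Fin n → ℕ} {E : List (Fin n × Fin n)} {x y z : Fin n}
    (h : SameClass r E x y) (h' : SameClass r E y z) : SameClass r E x z :=
  fun χ hχ => (h χ hχ).trans (h' χ hχ)

theorem sameClass_cons {r : Fin n → ℕ} {E : List (Fin n × Fin n)} {p : Fin n × Fin n}
    {x y : Fin n} : SameClass r (p :: E) x y ↔ (InCut r p x ↔ InCut r p y) ∧ SameClass r E x y := by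
  simp [SameClass]

theorem isNext_nil {r : Fin n → ℕ} {σ : Equiv.Perm (Fin n)} (hr : ∀ x, r x < n)
    (hσ : ∀ x, r (σ x) = if r x + 1 = n then 0 else r x + 1) : IsNext r [] σ := by
  intro x
  refine ⟨fun χ hχ => by simp at hχ, fun y _ hb => ?_⟩
  have h1 := hr x
  have h2 := hr y
  rw [hσ, CycBtw] at hb
  split_ifs at hb <;> omega

/-- A point mapped to an end of a new cut is sent across the cut. -/
theorem IsNext.swap_aux {r : Fin n → ℕ} (hr : Function.Injective r) {E : List (Fin n × Fin n)}
    {σ : Equiv.Perm (Fin n)} (h : IsNext r E σ) {i j : Fin n} (hij : i ≠ j)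
    (hE : SameClass r E i j) {x : Fin n} (hx : σ x = i) :
    (InCut r (i, j) x ↔ InCut r (i, j) j) ∧ SameClass r E x j ∧
      ∀ y, (InCut r (i, j) x ↔ InCut r (i, j) y) → SameClass r E x y →
        ¬ CycBtw (r x) (r y) (r j) := by
  have hxi : SameClass r E x i := hx ▸ (h x).1
  have hxj := hxi.trans hE
  have hne : r i ≠ r j := fun h => hij (hr h)
  have h1 := (h x).2 j hxj
  rw [hx] at h1
  refine ⟨?_, hxj, fun y hy hxy => ?_⟩
  · simp only [InCut, CycBtw] at *
    omega
  · have h2 := (h x).2 y hxy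
    rw [hx] at h2
    simp only [InCut, CycBtw] at *
    omega

/-- Left multiplication by (i j) redirects only the predecessors of i and j, which turns the cycle
through them into two cycles, one on each side of the cut. -/
theorem IsNext.swap {r : Fin n → ℕ} (hr : Function.Injective r) {E : List (Fin n × Fin n)}
    {σ : Equiv.Perm (Fin n)} (h : IsNext r E σ) {i j : Fin n} (hij : i ≠ j)
    (hE : SameClass r E i j) : IsNext r ((i, j) :: E) (Equiv.swap i j * σ) := by
  have hswap : ∀ x, InCut r (j, i) x ↔ InCut r (i, j) x := fun x => by
    simp only [InCut, min_comm, max_comm]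
  intro x
  by_cases h1 : σ x = i
  · have e : (Equiv.swap i j * σ) x = j := by simp [h1]
    obtain ⟨a1, a2, a3⟩ := h.swap_aux hr hij hE h1
    rw [e, sameClass_cons]
    refine ⟨⟨a1, a2⟩, fun y hy => ?_⟩
    rw [sameClass_cons] at hy
    exact a3 y hy.1 hy.2
  by_cases h2 : σ x = j
  · have e : (Equiv.swap i j * σ) x = i := by simp [h2]
    obtain ⟨a1, a2, a3⟩ := h.swap_aux hr hij.symm hE.symm h2
    simp only [hswap] at a1 a3
    rw [e, sameClass_cons]
    refine ⟨⟨a1, a2⟩, fun y hy => ?_⟩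
    rw [sameClass_cons] at hy
    exact a3 y hy.1 hy.2
  have e : (Equiv.swap i j * σ) x = σ x := by
    rw [Equiv.Perm.mul_apply, Equiv.swap_apply_of_ne_of_ne h1 h2]
  rw [e, sameClass_cons]
  refine ⟨⟨?_, (h x).1⟩, fun y hy => (h x).2 y (sameClass_cons.mp hy).2⟩
  have n1 : r (σ x) ≠ r i := fun h => h1 (hr h)
  have n2 : r (σ x) ≠ r j := fun h => h2 (hr h)
  -- In the class of i and j, the step from x to σx jumps over neither, so both are on one side. In
  -- another class, an earlier cut keeps i and j together and away from x and σx, and the new cut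
  -- cannot separate the latter.
  by_cases hxi : SameClass r E x i
  · have b1 := (h x).2 i hxi
    have b2 := (h x).2 j (hxi.trans hE)
    simp only [InCut, CycBtw] at *
    omega
  · simp only [SameClass, not_forall] at hxi
    obtain ⟨χ, hχ, hne⟩ := hxi
    have b1 := hE χ hχ
    have b2 := (h x).1 χ hχ
    simp only [InCut] at *
    omega

/-- Given y in the class of x, take the point z of the cycle of x closest before y in the cyclic
order. If z ≠ y, then σz does not pass y and is closer still. -/
theorem IsNext.sameCycle_iff {r : Fin n → ℕ} (hr : Function.Injective r) {E : List (Fin n × Fin n)}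
    {σ : Equiv.Perm (Fin n)} (h : IsNext r E σ) (x y : Fin n) :
    σ.SameCycle x y ↔ SameClass r E x y := by
  classical
  constructor
  · intro hxy
    obtain ⟨k, -, -, rfl⟩ := hxy.exists_pow_eq'
    induction k with
    | zero => exact fun χ _ => Iff.rfl
    | succ k ih =>
      rw [pow_succ', Equiv.Perm.mul_apply]
      exact (ih ⟨k, rfl⟩).trans (h _).1
  · intro hxy
    obtain ⟨B, hB⟩ : ∃ B, ∀ z, r z < B :=
      ⟨Finset.univ.sup r + 1, fun z => Nat.lt_succ_of_le (Finset.le_sup (Finset.mem_univ z))⟩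
    obtain ⟨z, hz, hmin⟩ := Finset.exists_min_image
      (Finset.univ.filter fun z => σ.SameCycle x z)
      (fun z => if r z ≤ r y then r y - r z else r y + B - r z)
      ⟨x, Finset.mem_filter.mpr ⟨Finset.mem_univ _, Equiv.Perm.SameCycle.refl _ _⟩⟩
    have hxz : σ.SameCycle x z := (Finset.mem_filter.mp hz).2
    have hcl : ∀ w, σ.SameCycle x w → SameClass r E x w := by
      intro w hw
      obtain ⟨k, -, -, rfl⟩ := hw.exists_pow_eq'
      clear hw
      induction k with
      | zero => exact fun χ _ => Iff.rfl
      | succ k ih =>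
        rw [pow_succ', Equiv.Perm.mul_apply]
        exact ih.trans (h _).1
    have hzy := (hcl z hxz).symm.trans hxy
    have h1 := (h z).2 y hzy
    have h2 := hmin (σ z) (Finset.mem_filter.mpr ⟨Finset.mem_univ _,
      Equiv.Perm.sameCycle_apply_right.mpr hxz⟩)
    have h3 := hB z
    have h4 := hB (σ z)
    have h5 := hB y
    have h6 : r z = r y := by
      simp only [CycBtw] at h1
      split_ifs at h2 <;> omega
    rwa [← hr h6]

theorem mem_fixSpace_indicator {r : Fin n → ℕ} {E : List (Fin n × Fin n)}
    {σ : Equiv.Perm (Fin n)} (h : IsNext r E σ) {i j : Fin n} (hij : ¬ SameClass r E i j) :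
    ¬ fixSpace σ ≤ eqSpace i j := by
  classical
  intro hle
  have h1 : (fun x => if SameClass r E i x then (1 : ℝ) else 0) ∈ fixSpace σ := by
    intro x
    have : SameClass r E i (σ x) ↔ SameClass r E i x :=
      ⟨fun hx => hx.trans (h x).1.symm, fun hx => hx.trans (h x).1⟩
    simp only [this]
  have h2 := mem_eqSpace.mp (hle h1)
  rw [if_pos (show SameClass r E i i from fun χ _ => Iff.rfl), if_neg hij] at h2
  exact one_ne_zero h2

/-- Every pair of the list has its two points on the same side of all later cuts. -/
def IsUnseparated (r : Fin n → ℕ) (E : List (Fin n × Fin n)) : Prop :=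
  E.Pairwise fun p χ => InCut r χ p.1 ↔ InCut r χ p.2

open Module

theorem IsUnseparated.isNext {r : Fin n → ℕ} (hr : Function.Injective r)
    {c : Equiv.Perm (Fin n)} (hc : IsNext r [] c) {E : List (Fin n × Fin n)}
    (hE : ∀ p ∈ E, p.1 ≠ p.2) (h : IsUnseparated r E) : IsNext r E (swapProd E * c) := by
  induction E with
  | nil => exact hc
  | cons p E ih =>
    rw [IsUnseparated, List.pairwise_cons] at h
    rw [swapProd_cons, mul_assoc]
    exact (ih (fun q hq => hE q (by simp [hq])) h.2).swap hr (hE p (by simp)) h.1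

theorem finrank_fixSpace_swapProd_mul_le (E : List (Fin n × Fin n)) (c : Equiv.Perm (Fin n)) :
    finrank ℝ (fixSpace (swapProd E * c)) ≤ finrank ℝ (fixSpace c) + E.length := by
  induction E with
  | nil => exact le_rfl
  | cons p E ih =>
    rw [swapProd_cons, mul_assoc, List.length_cons]
    have := finrank_fixSpace_swap_mul_le p.1 p.2 (swapProd E * c)
    omega

/-- Every transposition adds at most one dimension, so the total is reached only if each one does. A
transposition splits a cycle when its two points are in one class, and lowers the dimension, by the
indicator of a class, when they are not. -/
theorem isUnseparated_iff_finrank {r : Fin n → ℕ} (hr : Function.Injective r)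
    {c : Equiv.Perm (Fin n)} (hc : IsNext r [] c) {E : List (Fin n × Fin n)}
    (hE : ∀ p ∈ E, p.1 ≠ p.2) : IsUnseparated r E ↔
      finrank ℝ (fixSpace (swapProd E * c)) = finrank ℝ (fixSpace c) + E.length := by
  induction E with
  | nil => exact ⟨fun _ => rfl, fun _ => List.Pairwise.nil⟩
  | cons p E ih =>
    have hE' : ∀ q ∈ E, q.1 ≠ q.2 := fun q hq => hE q (by simp [hq])
    have hp := hE p (by simp)
    have h1 := finrank_fixSpace_swapProd_mul_le E c
    have h2 := finrank_fixSpace_swap_mul_le p.1 p.2 (swapProd E * c)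
    rw [IsUnseparated, List.pairwise_cons, ← IsUnseparated, ih hE', swapProd_cons, mul_assoc,
      List.length_cons]
    constructor
    · rintro ⟨h3, h4⟩
      have h5 := ((ih hE').mpr h4).isNext hr hc hE'
      have h6 := h5.swap hr hp h3
      have h7 : ¬ SameClass r ((p.1, p.2) :: E) p.1 p.2 := by
        intro h7
        have h8 := (sameClass_cons.mp h7).1
        have h9 : r p.1 ≠ r p.2 := fun h => hp (hr h)
        simp only [InCut] at h8
        omega
      have h8 := finrank_fixSpace_swap_mul_of_not_le hp (mem_fixSpace_indicator h6 h7)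
      rw [Equiv.swap_mul_self_mul] at h8
      omega
    · intro h3
      have h4 : finrank ℝ (fixSpace (swapProd E * c)) = finrank ℝ (fixSpace c) + E.length := by
        omega
      refine ⟨?_, h4⟩
      by_contra h5
      have h6 := ((ih hE').mpr h4).isNext hr hc hE'
      have h7 := finrank_fixSpace_swap_mul_of_not_le hp (mem_fixSpace_indicator h6 h5)
      omega

end Cuts

end TypeA

namespace TypeA

section ParabolicType

variable {n : ℕ}

open Module

/-! ### The type of a parabolic subgroup -/

theorem mem_parabolic_swap_iff (u : Equiv.Perm (Fin n)) (i j : Fin n) :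
    Equiv.swap i j ∈ parabolic u ↔ u.SameCycle i j := by
  classical
  constructor
  · intro h
    have h1 := h (fun x => if u.SameCycle i x then (1 : ℝ) else 0)
      (fun x => by simp only [Equiv.Perm.sameCycle_apply_right]) i
    rw [Equiv.swap_apply_left, if_pos (Equiv.Perm.SameCycle.refl u i)] at h1
    by_contra hne
    rw [if_neg hne] at h1
    exact zero_ne_one h1
  · intro h v hv k
    have h1 : ∀ y, u.SameCycle i y → v y = v i := by
      intro y hy
      obtain ⟨k, -, -, rfl⟩ := hy.exists_pow_eq'
      clear hy
      induction k with
      | zero => rfl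
      | succ k ih => rw [pow_succ', Equiv.Perm.mul_apply, hv, ih]
    have h2 := h1 j h
    rw [Equiv.swap_apply_def]
    split_ifs with h3 h4
    · rw [h3, h2]
    · rw [h4, h2]
    · rfl

theorem mem_parabolic_iff (u σ : Equiv.Perm (Fin n)) :
    σ ∈ parabolic u ↔ ∀ i, u.SameCycle i (σ i) := by
  classical
  constructor
  · intro h i
    have h1 := h (fun x => if u.SameCycle i x then (1 : ℝ) else 0)
      (fun x => by simp only [Equiv.Perm.sameCycle_apply_right]) i
    rw [if_pos (Equiv.Perm.SameCycle.refl u i)] at h1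
    by_contra hne
    rw [if_neg hne] at h1
    exact zero_ne_one h1
  · intro h v hv i
    have := (mem_parabolic_swap_iff u i (σ i)).mpr (h i) v hv i
    rwa [Equiv.swap_apply_left] at this

open Classical in
/-- The size of the cycle of `x`. -/
noncomputable def orbitSize (u : Equiv.Perm (Fin n)) (x : Fin n) : ℕ :=
  (Finset.univ.filter fun y => u.SameCycle x y).card

theorem card_filter_part_card (B : Finpartition (Finset.univ : Finset (Fin n))) (k : ℕ) :
    (Finset.univ.filter fun x => (B.part x).card = k).card =
      k * (B.parts.val.map Finset.card).count k := by
  classical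
  have h1 : (Finset.univ.filter fun x => (B.part x).card = k) =
      (B.parts.filter fun b => b.card = k).biUnion id := by
    ext x
    simp only [Finset.mem_filter, Finset.mem_univ, true_and, Finset.mem_biUnion, id]
    constructor
    · intro h
      exact ⟨B.part x, ⟨B.part_mem.mpr (Finset.mem_univ x), h⟩, B.mem_part (Finset.mem_univ x)⟩
    · rintro ⟨b, ⟨hb, hk⟩, hx⟩
      rwa [B.part_eq_of_mem hb hx]
  rw [h1, Finset.card_biUnion]
  · simp only [id]
    rw [Finset.sum_congr rfl (g := fun _ => k) fun b hb => by
      exact (Finset.mem_filter.mp hb).2,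
      Finset.sum_const, smul_eq_mul, mul_comm, Multiset.count_map]
    congr 2
    rw [Finset.card_def, Finset.filter_val]
    exact congrArg _ (Multiset.filter_congr fun b _ => eq_comm)
  · intro b hb b' hb' hne
    exact B.disjoint (Finset.mem_filter.mp hb).1 (Finset.mem_filter.mp hb').1 hne

theorem eq_parts_iff (B : Finpartition (Finset.univ : Finset (Fin n))) (lam : n.Partition) :
    B.parts.val.map Finset.card = lam.parts ↔
      ∀ k, (Finset.univ.filter fun x => (B.part x).card = k).card = k * lam.parts.count k := by
  constructor
  · intro h k
    rw [card_filter_part_card, h]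
  · intro h
    ext k
    rcases Nat.eq_zero_or_pos k with rfl | hk
    · rw [Multiset.count_eq_zero_of_notMem, Multiset.count_eq_zero_of_notMem]
      · exact fun h0 => lt_irrefl 0 (lam.parts_pos h0)
      · intro h0
        obtain ⟨b, hb, hb0⟩ := Multiset.mem_map.mp h0
        exact (B.nonempty_of_mem_parts hb).card_pos.ne' hb0
    · refine Nat.eq_of_mul_eq_mul_left hk ?_
      rw [← h k, card_filter_part_card]

/-- The blocks are the cycles of u, since a transposition lies in the parabolic subgroup exactly
when its points share a cycle. Counting points by block size instead of blocks makes the condition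
easy to transport along relabellings. -/
theorem subgroupHasType_parabolic_iff (u : Equiv.Perm (Fin n)) (lam : n.Partition) :
    SubgroupHasType (parabolic u) lam ↔
      ∀ k, (Finset.univ.filter fun x => orbitSize u x = k).card = k * lam.parts.count k := by
  classical
  have key : ∀ B : Finpartition (Finset.univ : Finset (Fin n)),
      (∀ x y, y ∈ B.part x ↔ u.SameCycle x y) →
      (B.parts.val.map Finset.card = lam.parts ↔
        ∀ k, (Finset.univ.filter fun x => orbitSize u x = k).card = k * lam.parts.count k) := by
    intro B hB
    rw [eq_parts_iff]
    have : ∀ x, (B.part x).card = orbitSize u x := fun x => by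
      rw [orbitSize]
      congr 1
      ext y
      simp [hB]
    simp only [this]
  constructor
  · rintro ⟨B, hB, hlam⟩
    refine (key B fun x y => ?_).mp hlam
    have hx : B.part x ∈ B.parts := B.part_mem.mpr (Finset.mem_univ x)
    have hxx : x ∈ B.part x := B.mem_part (Finset.mem_univ x)
    rw [← mem_parabolic_swap_iff, hB]
    constructor
    · intro hy b hb i hi
      rw [Equiv.swap_apply_def]
      split_ifs with h1 h2
      · subst h1
        rwa [← B.part_eq_of_mem hb hi]
      · subst h2
        have h3 := B.part_eq_of_mem hx hy
        have h4 := B.part_eq_of_mem hb hi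
        rw [← h4, h3]
        exact hxx
      · exact hi
    · intro h
      have := h _ hx x hxx
      rwa [Equiv.swap_apply_left] at this
  · intro h
    let B : Finpartition (Finset.univ : Finset (Fin n)) :=
      Finpartition.ofSetoid (Equiv.Perm.SameCycle.setoid u)
    have hB : ∀ x y, y ∈ B.part x ↔ u.SameCycle x y := fun x y =>
      Finpartition.mem_part_ofSetoid_iff_rel.trans Iff.rfl
    refine ⟨B, fun σ => ?_, (key B hB).mpr h⟩
    rw [mem_parabolic_iff]
    constructor
    · intro hσ b hb i hi
      rw [← B.part_eq_of_mem hb hi, hB]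
      exact hσ i
    · intro hσ i
      rw [← hB]
      exact hσ _ (B.part_mem.mpr (Finset.mem_univ i)) i (B.mem_part (Finset.mem_univ i))

/-! ### The parabolic type of a set of reflections -/

theorem finrank_fixSpace_inv (σ : Equiv.Perm (Fin n)) :
    finrank ℝ (fixSpace σ⁻¹) = finrank ℝ (fixSpace σ) := by
  have : fixSpace σ⁻¹ = fixSpace σ := by
    ext v
    rw [mem_fixSpace, mem_fixSpace]
    constructor
    · intro h i
      simpa using (h (σ i)).symm
    · intro h i
      simpa using (h (σ⁻¹ i)).symm
  rw [this]

/-- The vectors fixed by both factors are fixed by the product; this is subadditivity of reflection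
length. -/
theorem finrank_fixSpace_add_le (σ τ : Equiv.Perm (Fin n)) :
    finrank ℝ (fixSpace σ) + finrank ℝ (fixSpace τ) ≤ n + finrank ℝ (fixSpace (σ * τ)) := by
  have h1 := Submodule.finrank_sup_add_finrank_inf_eq (fixSpace σ) (fixSpace τ)
  have h2 := Submodule.finrank_le (fixSpace σ ⊔ fixSpace τ)
  have h3 : fixSpace σ ⊓ fixSpace τ ≤ fixSpace (σ * τ) := by
    intro v hv i
    rw [Equiv.Perm.mul_apply, hv.1, hv.2]
  have h4 := Submodule.finrank_mono h3
  rw [Module.finrank_fin_fun] at h2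
  omega

theorem finrank_fixSpace_of_isNext_nil {r : Fin n → ℕ} (hr : Function.Injective r)
    {c : Equiv.Perm (Fin n)} (hc : IsNext r [] c) (hn : 1 ≤ n) :
    finrank ℝ (fixSpace c) = 1 := by
  have h1 : fixSpace c = Submodule.span ℝ {fun _ => (1 : ℝ)} := by
    ext v
    rw [Submodule.mem_span_singleton]
    constructor
    · intro hv
      refine ⟨v ⟨0, hn⟩, funext fun i => ?_⟩
      have h2 : c.SameCycle ⟨0, hn⟩ i := (hc.sameCycle_iff hr _ _).mpr fun χ hχ => by simp at hχ
      obtain ⟨k, -, -, rfl⟩ := h2.exists_pow_eq'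
      clear h2
      induction k with
      | zero => simp
      | succ k ih => rw [pow_succ', Equiv.Perm.mul_apply, mem_fixSpace.mp hv, ← ih]; simp
    · rintro ⟨a, rfl⟩ i
      rfl
  rw [h1, finrank_span_singleton]
  intro h
  exact one_ne_zero (congrFun h ⟨0, hn⟩)

theorem swapProd_reverse (E : List (Fin n × Fin n)) : swapProd E.reverse = (swapProd E)⁻¹ := by
  induction E with
  | nil => rfl
  | cons p E ih =>
    rw [swapProd_cons, mul_inv_rev, ← ih, Equiv.swap_inv]
    simp [swapProd]

/-- For an independent set of reflections, the lists with a product below `c` are those which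
cut the cycle `c` at every step. -/
theorem isNC_iff_isUnseparated {ε : Fin 2} {r : Fin n → ℕ} (hr : Function.Injective r)
    (hn : 1 ≤ n) (hc : IsNext r [] (cox n ε)) {E₀ E : List (Fin n × Fin n)}
    (hE₀ : ∀ p ∈ E₀, p.1 ≠ p.2) (hu : IsUnseparated r E₀) (hperm : E.Perm E₀) :
    IsNC ε (swapProd E.reverse) ↔ IsUnseparated r E := by
  have hE : ∀ p ∈ E, p.1 ≠ p.2 := fun p hp => hE₀ p (hperm.mem_iff.mp hp)
  have hF := finrank_fixSpace_of_isNext_nil hr hc hn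
  have h1 := (isUnseparated_iff_finrank hr hc hE₀).mp hu
  -- The product of these two permutations is c, whose fixed space is a line. This bounds the fixed
  -- space of `swapProd E₀` by n - |E₀|, so the hyperplanes are independent and every ordering has a
  -- product of reflection length |E₀|.
  have h2 := finrank_fixSpace_add_le (swapProd E₀)⁻¹ (swapProd E₀ * cox n ε)
  rw [inv_mul_cancel_left, finrank_fixSpace_inv] at h2
  have h3 := le_length_add_finrank_commonSpace E₀
  have h4 := Submodule.finrank_mono (commonSpace_le_fixSpace E₀)
  have h5 : commonSpace E = commonSpace E₀ := by
    ext v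
    exact ⟨fun h p hp => h p (hperm.mem_iff.mpr hp), fun h p hp => h p (hperm.mem_iff.mp hp)⟩
  have h6 := hperm.length_eq
  have h7 := finrank_fixSpace_swapProd E hE (by rw [h5]; omega)
  have h8 := reflLength_add_finrank (cox n ε)
  have h9 := reflLength_add_finrank (swapProd E.reverse)
  have h10 := reflLength_add_finrank ((swapProd E.reverse)⁻¹ * cox n ε)
  rw [isUnseparated_iff_finrank hr hc hE, IsNC]
  rw [swapProd_reverse, finrank_fixSpace_inv] at h9
  rw [swapProd_reverse, inv_inv] at h10 ⊢
  omega

open Classical in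
/-- The size of the class of `x` under the cuts by a set of roots. -/
noncomputable def classSize (r : Fin n → ℕ) (f : Finset (Root n)) (x : Fin n) : ℕ :=
  (Finset.univ.filter fun y => ∀ a ∈ f, (InCut r a.1 x ↔ InCut r a.1 y)).card

theorem hasParabolicType_iff {ε : Fin 2} {r : Fin n → ℕ} (hr : Function.Injective r)
    (hn : 1 ≤ n) (hc : IsNext r [] (cox n ε)) (hp : cPlus n ε * cPlus n ε = 1)
    (hm : cMinus n ε * cMinus n ε = 1)
    {f : Finset (Root n)}
    (hf : ∃ L : List (Root n), L.Nodup ∧ (∀ a, a ∈ L ↔ a ∈ f) ∧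
      IsUnseparated r (L.map Subtype.val)) (lam : n.Partition) :
    HasParabolicType ε f lam ↔
      ∀ k, (Finset.univ.filter fun x => classSize r f x = k).card = k * lam.parts.count k := by
  classical
  obtain ⟨L₀, hnd₀, hmem₀, hu₀⟩ := hf
  have hroot : ∀ L : List (Root n), ∀ p ∈ L.map Subtype.val, p.1 ≠ p.2 := by
    intro L p hp
    obtain ⟨a, -, rfl⟩ := List.mem_map.mp hp
    exact a.2
  have hprod : ∀ L : List (Root n), (L.map Root.refl).prod =
      swapProd (L.reverse.map Subtype.val).reverse := by
    intro L
    rw [← List.map_reverse, List.reverse_reverse, swapProd, List.map_map]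
    rfl
  have hperm : ∀ L : List (Root n), L.Nodup → (∀ a, a ∈ L ↔ a ∈ f) →
      (L.reverse.map Subtype.val).Perm (L₀.map Subtype.val) := by
    intro L hnd hmem
    refine List.Perm.map _ ((List.reverse_perm L).trans ?_)
    exact (List.perm_ext_iff_of_nodup hnd hnd₀).mpr fun a => (hmem a).trans (hmem₀ a).symm
  have hsize : ∀ L : List (Root n), (∀ a, a ∈ L ↔ a ∈ f) →
      IsUnseparated r (L.reverse.map Subtype.val) → ∀ k,
      (Finset.univ.filter fun x =>
        orbitSize (cPlus n ε * (L.map Root.refl).prod * cMinus n ε) x = k).card =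
      (Finset.univ.filter fun x => classSize r f x = k).card := by
    intro L hmem hu k
    have hnext := hu.isNext hr hc (hroot _)
    have hcyc : ∀ x y, (cPlus n ε * (L.map Root.refl).prod * cMinus n ε).SameCycle x y ↔
        ∀ a ∈ f, (InCut r a.1 (cMinus n ε x) ↔ InCut r a.1 (cMinus n ε y)) := by
      intro x y
      -- With w the product along `L`, this reads w⁻¹c = c₋ (c₊wc₋)⁻¹ c₋⁻¹: the cycles of the
      -- complement become those of w⁻¹c after relabelling by c₋.
      have e : swapProd (L.reverse.map Subtype.val) * cox n ε =
          cMinus n ε * (cPlus n ε * (L.map Root.refl).prod * cMinus n ε)⁻¹ * (cMinus n ε)⁻¹ := by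
        rw [hprod, swapProd_reverse, cox]
        have : (cPlus n ε)⁻¹ = cPlus n ε := inv_eq_of_mul_eq_one_right hp
        have hm' : (cMinus n ε)⁻¹ = cMinus n ε := inv_eq_of_mul_eq_one_right hm
        simp only [mul_inv_rev, inv_inv, this, hm', ← mul_assoc, hm, one_mul]
      have h1 := hnext.sameCycle_iff hr (cMinus n ε x) (cMinus n ε y)
      rw [e, Equiv.Perm.sameCycle_conj, Equiv.Perm.sameCycle_inv] at h1
      rw [show (cMinus n ε)⁻¹ (cMinus n ε x) = x from (cMinus n ε).symm_apply_apply x,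
        show (cMinus n ε)⁻¹ (cMinus n ε y) = y from (cMinus n ε).symm_apply_apply y] at h1
      rw [h1, SameClass]
      constructor
      · intro h a ha
        exact h a.1 (List.mem_map.mpr ⟨a, List.mem_reverse.mpr ((hmem a).mpr ha), rfl⟩)
      · intro h χ hχ
        obtain ⟨a, ha, rfl⟩ := List.mem_map.mp hχ
        exact h a ((hmem a).mp (List.mem_reverse.mp ha))
    have horb : ∀ x, orbitSize (cPlus n ε * (L.map Root.refl).prod * cMinus n ε) x =
        classSize r f (cMinus n ε x) := by
      intro x
      rw [orbitSize, classSize]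
      refine Finset.card_bij (fun y _ => cMinus n ε y) ?_ (fun y _ y' _ h => (cMinus n ε).injective h)
        fun y hy => ⟨(cMinus n ε)⁻¹ y, ?_, by simp⟩
      · intro y hy
        simpa [hcyc] using hy
      · simpa [hcyc] using hy
    simp only [horb]
    refine Finset.card_bij (fun y _ => cMinus n ε y) ?_ (fun y _ y' _ h => (cMinus n ε).injective h)
      fun y hy => ⟨(cMinus n ε)⁻¹ y, ?_, by simp⟩
    · intro y hy
      simpa using hy
    · simpa using hy
  constructor
  · rintro ⟨L, hnd, hmem, hnc, htype⟩ k
    rw [hprod, isNC_iff_isUnseparated hr hn hc (hroot _) hu₀ (hperm L hnd hmem)] at hnc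
    rw [← hsize L hmem hnc k]
    exact (subgroupHasType_parabolic_iff _ lam).mp htype k
  · intro h
    have hmem : ∀ a, a ∈ L₀.reverse ↔ a ∈ f := fun a => by rw [List.mem_reverse, hmem₀]
    have hu : IsUnseparated r (L₀.reverse.reverse.map Subtype.val) := by
      rwa [List.reverse_reverse]
    refine ⟨L₀.reverse, List.nodup_reverse.mpr hnd₀, hmem, ?_, ?_⟩
    · rw [hprod, isNC_iff_isUnseparated hr hn hc (hroot _) hu₀
        (hperm _ (List.nodup_reverse.mpr hnd₀) hmem)]
      exact hu
    · rw [subgroupHasType_parabolic_iff]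
      intro k
      rw [hsize _ hmem hu k]
      exact h k

end ParabolicType

end TypeA

namespace TypeA

/-! ### The bipartite Coxeter element -/

theorem simpleRefl_val {n k : ℕ} (hk : k + 1 < n) (x : Fin n) :
    (simpleRefl n k x).val = if x.val = k then k + 1 else if x.val = k + 1 then k else x.val := by
  rw [simpleRefl, dif_pos hk, Equiv.swap_apply_def]
  simp only [Fin.ext_iff]
  split_ifs <;> rfl

theorem prod_simpleRefl_val (n e m : ℕ) (he : e < 2) (hm : m + 1 ≤ n) (x : Fin n) :
    ((((List.range m).filter fun k => decide (k % 2 = e)).map (simpleRefl n)).prod x).val =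
      if x.val % 2 = e ∧ x.val < m then x.val + 1
      else if x.val % 2 ≠ e ∧ 1 ≤ x.val ∧ x.val ≤ m then x.val - 1 else x.val := by
  induction m generalizing x with
  | zero =>
    rw [List.range_zero, List.filter_nil, List.map_nil, List.prod_nil, Equiv.Perm.one_apply]
    split_ifs <;> omega
  | succ m ih =>
    rw [List.range_succ, List.filter_append, List.map_append, List.prod_append,
      Equiv.Perm.mul_apply, ih (by omega), List.filter_singleton]
    by_cases h : m % 2 = e
    · simp only [h, decide_true, cond_true, List.map_cons, List.map_nil, List.prod_cons,
        List.prod_nil, mul_one, simpleRefl_val (show m + 1 < n by omega)]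
      split_ifs <;> omega
    · simp only [h, decide_false, cond_false, List.map_nil, List.prod_nil,
        Equiv.Perm.one_apply]
      split_ifs <;> omega

theorem cPlus_val (n : ℕ) (ε : Fin 2) (x : Fin n) :
    (cPlus n ε x).val = if x.val % 2 = ε.val then (if x.val + 1 < n then x.val + 1 else x.val)
      else x.val - 1 := by
  have hx := x.2
  have hε := ε.2
  rw [cPlus, prod_simpleRefl_val n ε.val (n - 1) ε.2 (by omega)]
  split_ifs <;> omega

theorem cMinus_val (n : ℕ) (ε : Fin 2) (x : Fin n) :
    (cMinus n ε x).val = if x.val % 2 ≠ ε.val then (if x.val + 1 < n then x.val + 1 else x.val)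
      else x.val - 1 := by
  have hx := x.2
  have hε := ε.2
  have h : ((List.range (n - 1)).filter fun k => decide (k % 2 ≠ ε.val)) =
      (List.range (n - 1)).filter fun k => decide (k % 2 = 1 - ε.val) := by
    refine List.filter_congr fun k _ => ?_
    rw [decide_eq_decide]
    omega
  rw [cMinus, h, prod_simpleRefl_val n (1 - ε.val) (n - 1) (by omega) (by omega)]
  split_ifs <;> omega

theorem cPlus_mul_self (n : ℕ) (ε : Fin 2) : cPlus n ε * cPlus n ε = 1 := by
  ext x
  rw [Equiv.Perm.mul_apply, cPlus_val, cPlus_val, Equiv.Perm.one_apply]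
  have := x.2
  have := ε.2
  split_ifs <;> omega

theorem cMinus_mul_self (n : ℕ) (ε : Fin 2) : cMinus n ε * cMinus n ε = 1 := by
  ext x
  rw [Equiv.Perm.mul_apply, cMinus_val, cMinus_val, Equiv.Perm.one_apply]
  have := x.2
  have := ε.2
  split_ifs <;> omega

/-- The position of `x` on the cycle of the Coxeter element. -/
def cycPos (n ε x : ℕ) : ℕ := if x % 2 = ε then n - 1 - x / 2 else x / 2

/-- The position on the `(n + 2)`-gon of the vertex number `x` of the zigzag of the opposites of
the simple roots. -/
def zigzagPos (n ε x : ℕ) : ℕ := if x % 2 = ε then n + 1 - x / 2 else x / 2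

theorem cycPos_lt {n ε x : ℕ} (hx : x < n) : cycPos n ε x < n := by
  rw [cycPos]
  split_ifs <;> omega

theorem cycPos_injective (n : ℕ) (ε : Fin 2) :
    Function.Injective fun x : Fin n => cycPos n ε x.val := by
  intro x y h
  have := x.2
  have := y.2
  have := ε.2
  simp only [cycPos] at h
  ext
  split_ifs at h <;> omega

theorem cox_val (n : ℕ) (ε : Fin 2) (x : Fin n) :
    (cox n ε x).val = if x.val % 2 = ε.val then
        (if 2 ≤ x.val then x.val - 2 else if x.val = 1 ∨ n = 1 then 0 else 1)
      else if x.val + 2 < n then x.val + 2 else if x.val + 1 < n then x.val + 1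
        else x.val - 1 := by
  have := x.2
  have := ε.2
  rw [cox, Equiv.Perm.mul_apply, cPlus_val, cMinus_val]
  split_ifs <;> omega

/-- Away from the two ends, c lowers the indices of parity ε by two and raises the others by two.
Its cycle thus goes up through one parity and down through the other, which is the order measured by
`cycPos`. -/
theorem cycPos_cox (n : ℕ) (ε : Fin 2) (x : Fin n) :
    cycPos n ε (cox n ε x).val =
      if cycPos n ε x.val + 1 = n then 0 else cycPos n ε x.val + 1 := by
  have := x.2
  have := ε.2
  rw [cox_val]
  simp only [cycPos]
  split_ifs <;> omega

theorem isNext_cox (n : ℕ) (ε : Fin 2) :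
    IsNext (fun x : Fin n => cycPos n ε x.val) [] (cox n ε) :=
  isNext_nil (fun x => cycPos_lt x.2) (cycPos_cox n ε)

/-! ### Almost positive roots as diagonals -/

theorem Root.isAlmostPos_iff {n : ℕ} (a : Root n) :
    a.IsAlmostPos ↔ a.1.1.val < a.1.2.val ∨ a.1.1.val = a.1.2.val + 1 := by
  rw [IsAlmostPos, IsPos, Fin.lt_def]
  refine or_congr_right ⟨?_, fun h => ⟨a.1.2.val, rfl, h⟩⟩
  rintro ⟨k, h1, h2⟩
  simp only [neg] at h1 h2
  omega

/-- The vertex number `x` of the zigzag. -/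
def zigzagVertex (n : ℕ) (ε : Fin 2) (x : ℕ) : Fin (n + 2) := vtx (n + 2) (zigzagPos n ε x)

theorem zigzagVertex_val {n : ℕ} {ε : Fin 2} {x : ℕ} (hx : x ≤ n + 1) :
    (zigzagVertex n ε x).val = zigzagPos n ε x := by
  have h : zigzagPos n ε x < n + 2 := by
    rw [zigzagPos]
    split_ifs <;> omega
  rw [← Int.natCast_inj, zigzagVertex, vtx_val_cast, Int.emod_eq_of_lt] <;> omega

/-- The diagonal of the polygon attached to a root. -/
def diagonal {n : ℕ} (ε : Fin 2) (a : Root n) : Sym2 (Fin (n + 2)) :=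
  s(zigzagVertex n ε a.1.1.val, zigzagVertex n ε (a.1.2.val + 2))

theorem zigzagVertex_inj {n : ℕ} {ε : Fin 2} {x y : ℕ} (hx : x ≤ n + 1) (hy : y ≤ n + 1)
    (h : zigzagVertex n ε x = zigzagVertex n ε y) : x = y := by
  have hε := ε.2
  have h1 := congrArg Fin.val h
  rw [zigzagVertex_val hx, zigzagVertex_val hy] at h1
  simp only [zigzagPos] at h1
  split_ifs at h1 <;> omega

theorem exists_zigzagVertex {n : ℕ} (ε : Fin 2) (p : Fin (n + 2)) :
    ∃ x ≤ n + 1, zigzagVertex n ε x = p := by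
  have hε := ε.2
  have hp := p.2
  by_cases h : 2 * p.val + (1 - ε.val) ≤ n + 1
  · refine ⟨_, h, Fin.ext ?_⟩
    rw [zigzagVertex_val h, zigzagPos]
    split_ifs <;> omega
  · have h' : 2 * (n + 1 - p.val) + ε.val ≤ n + 1 := by omega
    refine ⟨_, h', Fin.ext ?_⟩
    rw [zigzagVertex_val h', zigzagPos]
    split_ifs <;> omega

theorem val_add_one {n : ℕ} (v : Fin (n + 2)) :
    (v + 1).val = if v.val = n + 1 then 0 else v.val + 1 := by
  have hv := v.2
  rw [Fin.val_add, Fin.val_one]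
  split_ifs with h
  · rw [h]; exact Nat.mod_self _
  · exact Nat.mod_eq_of_lt (by omega)

theorem isDiagonal_mk_iff {N : ℕ} [NeZero N] (p q : Fin N) :
    IsDiagonal s(p, q) ↔ p ≠ q ∧ p + 1 ≠ q ∧ q + 1 ≠ p := by
  constructor
  · rintro ⟨a, b, h, h1, h2, h3⟩
    rcases Sym2.eq_iff.mp h with ⟨rfl, rfl⟩ | ⟨rfl, rfl⟩
    · exact ⟨h1, h2, h3⟩
    · exact ⟨h1.symm, h3, h2⟩
  · rintro ⟨h1, h2, h3⟩
    exact ⟨p, q, rfl, h1, h2, h3⟩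

theorem isDiagonal_diagonal {n : ℕ} {ε : Fin 2} {a : Root n} (ha : a.IsAlmostPos) :
    IsDiagonal (diagonal ε a) := by
  have hε := ε.2
  have h1 := a.1.1.2
  have h2 := a.1.2.2
  rw [a.isAlmostPos_iff] at ha
  rw [diagonal, isDiagonal_mk_iff]
  simp only [ne_eq, Fin.ext_iff, val_add_one]
  rw [zigzagVertex_val (by omega), zigzagVertex_val (by omega)]
  simp only [zigzagPos]
  split_ifs <;> omega

theorem diagonal_injOn {n : ℕ} (ε : Fin 2) :
    Set.InjOn (diagonal ε) {a : Root n | a.IsAlmostPos} := by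
  intro a ha b hb h
  have h1 := a.1.1.2
  have h2 := a.1.2.2
  have h3 := b.1.1.2
  have h4 := b.1.2.2
  replace ha := a.isAlmostPos_iff.mp ha
  replace hb := b.isAlmostPos_iff.mp hb
  rcases Sym2.eq_iff.mp h with ⟨e1, e2⟩ | ⟨e1, e2⟩
  · have e3 := zigzagVertex_inj (by omega) (by omega) e1
    have e4 := zigzagVertex_inj (by omega) (by omega) e2
    exact Subtype.ext (Prod.ext (Fin.ext e3) (Fin.ext (by omega)))
  · have e3 := zigzagVertex_inj (by omega) (by omega) e1
    have e4 := zigzagVertex_inj (by omega) (by omega) e2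
    omega

theorem bijOn_diagonal {n : ℕ} (ε : Fin 2) :
    Set.BijOn (diagonal ε) {a : Root n | a.IsAlmostPos} {d | IsDiagonal d} := by
  refine ⟨fun a ha => isDiagonal_diagonal ha, diagonal_injOn ε, fun d hd => ?_⟩
  have hε := ε.2
  induction d using Sym2.ind with
  | _ p q =>
  obtain ⟨x, hx, rfl⟩ := exists_zigzagVertex ε p
  obtain ⟨y, hy, rfl⟩ := exists_zigzagVertex ε q
  have key : ∀ x y, x ≤ n + 1 → y ≤ n + 1 → x < y →
      IsDiagonal s(zigzagVertex n ε x, zigzagVertex n ε y) →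
      s(zigzagVertex n ε x, zigzagVertex n ε y) ∈ diagonal ε '' {a : Root n | a.IsAlmostPos} := by
    intro x y hx hy hxy hd
    -- For zigzag numbers x < y, the excluded pairs are the sides of the polygon: {0, 1}, {n, n + 1}
    -- and {x, x + 2}.
    have h : x < n ∧ 2 ≤ y ∧ y ≠ x + 2 := by
      rw [isDiagonal_mk_iff] at hd
      simp only [ne_eq, Fin.ext_iff, val_add_one] at hd
      rw [zigzagVertex_val hx, zigzagVertex_val hy] at hd
      simp only [zigzagPos] at hd
      split_ifs at hd <;> omega
    refine ⟨⟨(⟨x, h.1⟩, ⟨y - 2, by omega⟩), fun he => ?_⟩, ?_, ?_⟩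
    · have := congrArg Fin.val he
      dsimp only at this
      omega
    · rw [Set.mem_ofPred_eq, Root.isAlmostPos_iff]
      dsimp only
      omega
    · rw [diagonal]
      dsimp only
      rw [Nat.sub_add_cancel h.2.1]
  rcases lt_trichotomy x y with h | rfl | h
  · exact key x y hx hy h hd
  · exact absurd rfl ((isDiagonal_mk_iff _ _).mp hd).1
  · rw [Sym2.eq_swap] at hd ⊢
    exact key y x hy hx h hd

theorem rotate_cond_iff {n : ℕ} (ε : Fin 2) (a : Root n) :
    ((∃ k, k % 2 = ε.val ∧ a.neg.IsSimple k) ∨ (∃ k, k % 2 ≠ ε.val ∧ a.IsSimple k)) ↔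
      (a.1.1.val = a.1.2.val + 1 ∧ a.1.2.val % 2 = ε.val) ∨
        (a.1.2.val = a.1.1.val + 1 ∧ a.1.1.val % 2 ≠ ε.val) := by
  simp only [Root.IsSimple, Root.neg]
  constructor
  · rintro (⟨k, h1, h2, h3⟩ | ⟨k, h1, h2, h3⟩)
    · left; subst h2; exact ⟨h3, h1⟩
    · right; subst h2; exact ⟨h3, h1⟩
  · rintro (⟨h1, h2⟩ | ⟨h1, h2⟩)
    · exact Or.inl ⟨_, h2, rfl, h1⟩
    · exact Or.inr ⟨_, h2, rfl, h1⟩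

theorem rotate_isAlmostPos {n : ℕ} (ε : Fin 2) {a : Root n} (ha : a.IsAlmostPos) :
    (rotate ε a).IsAlmostPos := by
  classical
  have hε := ε.2
  have h1 := a.1.1.2
  have h2 := a.1.2.2
  rw [Root.isAlmostPos_iff] at ha ⊢
  rw [rotate]
  split_ifs with h <;> rw [rotate_cond_iff] at h
  · simp only [Root.neg]
    omega
  · simp only [Root.act, cox_val]
    split_ifs <;> omega

/-- When R acts by c, each end moves separately by one vertex. When R negates a root, the diagonal
still turns by one step but its two ends exchange roles. -/
theorem diagonal_rotate {n : ℕ} (ε : Fin 2) {a : Root n} (ha : a.IsAlmostPos) :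
    diagonal ε (rotate ε a) = (diagonal ε a).map (fun v => v + 1) := by
  classical
  have hε := ε.2
  have h1 := a.1.1.2
  have h2 := a.1.2.2
  rw [Root.isAlmostPos_iff] at ha
  rw [rotate]
  split_ifs with h <;> rw [rotate_cond_iff] at h <;> rw [diagonal, diagonal, Sym2.map_mk] <;>
    rw [Sym2.eq_iff]
  · right
    constructor <;> ext <;> rw [val_add_one] <;> simp only [Root.neg] <;>
      rw [zigzagVertex_val (by omega), zigzagVertex_val (by omega)] <;>
      simp only [zigzagPos] <;> split_ifs <;> omega
  · left
    have h3 := (cox n ε a.1.1).2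
    have h4 := (cox n ε a.1.2).2
    constructor <;> ext <;> rw [val_add_one] <;> simp only [Root.act] <;>
      rw [zigzagVertex_val (by omega), zigzagVertex_val (by omega), cox_val] <;>
      simp only [zigzagPos] <;> split_ifs <;> omega

end TypeA

namespace TypeA

/-! ### Compatibility and crossing -/

theorem not_cross_diag {N : ℕ} (p x y : Fin N) : ¬ Cross s(p, p) s(x, y) := by
  rw [cross_mk_iff]
  rintro (h | h | h | h | h | h | h | h) <;> omega

theorem cross_iff_of_lt {N : ℕ} {p q x y : Fin N} (hpq : p < q) (h1 : x ≠ p) (h2 : x ≠ q)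
    (h3 : y ≠ p) (h4 : y ≠ q) :
    Cross s(p, q) s(x, y) ↔ ¬ ((p < x ∧ x < q) ↔ (p < y ∧ y < q)) := by
  rw [cross_mk_iff]
  constructor
  · rintro (h | h | h | h | h | h | h | h) <;> omega
  · intro h
    by_cases hx : p < x ∧ x < q
    · have hy : ¬ (p < y ∧ y < q) := fun hy => h (iff_of_true hx hy)
      rcases (show q < y ∨ y < p by omega) with h5 | h5
      · exact Or.inl ⟨hx.1, hx.2, h5⟩
      · exact Or.inr (Or.inr (Or.inr (Or.inr (Or.inr (Or.inr (Or.inl ⟨h5, hx⟩))))))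
    · have hy : p < y ∧ y < q := by
        by_contra hy
        exact h (iff_of_false hx hy)
      rcases (show q < x ∨ x < p by omega) with h5 | h5
      · exact Or.inr (Or.inl ⟨hy.1, hy.2, h5⟩)
      · exact Or.inr (Or.inr (Or.inr (Or.inr (Or.inl ⟨h5, hy⟩))))

theorem cross_eq_left {N : ℕ} {p q y : Fin N} : ¬ Cross s(p, q) s(p, y) := by
  rw [cross_mk_iff]
  rintro (h | h | h | h | h | h | h | h) <;> omega

theorem cross_map_add {N : ℕ} [NeZero N] (g : Fin N) (d e : Sym2 (Fin N)) :
    Cross (d.map fun v => v + g) (e.map fun v => v + g) ↔ Cross d e := by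
  induction d using Sym2.ind with
  | _ p q =>
  induction e using Sym2.ind with
  | _ x y =>
  rw [Sym2.map_mk, Sym2.map_mk]
  by_cases hpq : p = q
  · subst hpq
    exact iff_of_false (not_cross_diag _ _ _) (not_cross_diag _ _ _)
  obtain ⟨P, rfl⟩ : ∃ P : ℤ, vtx N P = p := ⟨p.val, vtx_natCast p⟩
  obtain ⟨G, rfl⟩ : ∃ G : ℤ, vtx N G = g := ⟨g.val, vtx_natCast g⟩
  obtain ⟨Q, hQ, hQ', rfl⟩ := exists_lift P q
  obtain ⟨X, hX, hX', rfl⟩ := exists_lift P x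
  obtain ⟨Y, hY, hY', rfl⟩ := exists_lift P y
  have h1 : P < Q := lt_of_le_of_ne hQ fun h => hpq (congrArg (vtx N) h)
  simp only [← vtx_add]
  rw [cross_vtx_iff (by omega) (by omega) (by omega) (by omega) (by omega) (by omega),
    cross_vtx_iff h1 hQ' hX hX' hY hY']
  omega

/-- The zigzag alternates between the two ends of the label range and closes in on the middle, so
the labels between two consecutive vertices are those of the later vertices. -/
theorem zigzagPos_between {n k z : ℕ} {ε : Fin 2} (hk : k + 1 ≤ n) (hz : z ≤ n + 1)
    (h1 : z ≠ k + 1) (h2 : z ≠ k + 2) :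
    (zigzagPos n ε (k + 1) < zigzagPos n ε z ∧ zigzagPos n ε z < zigzagPos n ε (k + 2) ∨
      zigzagPos n ε (k + 2) < zigzagPos n ε z ∧ zigzagPos n ε z < zigzagPos n ε (k + 1)) ↔ k < z := by
  have hε := ε.2
  simp only [zigzagPos]
  split_ifs <;> omega

theorem cross_zigzag_iff {n k x y : ℕ} {ε : Fin 2} (hk : k + 1 ≤ n) (hx : x ≤ n + 1)
    (hy : y ≤ n + 1) (hx1 : x ≠ k + 1) (hx2 : x ≠ k + 2) (hy1 : y ≠ k + 1) (hy2 : y ≠ k + 2) :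
    Cross s(zigzagVertex n ε (k + 1), zigzagVertex n ε (k + 2))
      s(zigzagVertex n ε x, zigzagVertex n ε y) ↔ ¬ (k < x ↔ k < y) := by
  have hX := zigzagPos_between (ε := ε) hk hx hx1 hx2
  have hY := zigzagPos_between (ε := ε) hk hy hy1 hy2
  have inj : ∀ {z w}, z ≤ n + 1 → w ≤ n + 1 → z ≠ w →
      zigzagVertex n ε z ≠ zigzagVertex n ε w := fun hz hw h he => h (zigzagVertex_inj hz hw he)
  have h0 := inj (show k + 1 ≤ n + 1 by omega) (show k + 2 ≤ n + 1 by omega) (by omega)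
  have e1 := inj hx (show k + 1 ≤ n + 1 by omega) hx1
  have e2 := inj hx (show k + 2 ≤ n + 1 by omega) hx2
  have e3 := inj hy (show k + 1 ≤ n + 1 by omega) hy1
  have e4 := inj hy (show k + 2 ≤ n + 1 by omega) hy2
  rw [← hX, ← hY]
  rw [← zigzagVertex_val (ε := ε) hx, ← zigzagVertex_val (ε := ε) hy,
    ← zigzagVertex_val (ε := ε) (show k + 1 ≤ n + 1 by omega),
    ← zigzagVertex_val (ε := ε) (show k + 2 ≤ n + 1 by omega)]
  simp only [← Fin.lt_def]
  rcases lt_or_gt_of_ne h0 with h | h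
  · rw [cross_iff_of_lt h e1 e2 e3 e4]
    refine not_congr (iff_congr (or_iff_left ?_).symm (or_iff_left ?_).symm) <;>
    · intro h'
      exact absurd (h'.1.trans h'.2) h.asymm
  · rw [Sym2.eq_swap, cross_iff_of_lt h e2 e1 e4 e3]
    refine not_congr (iff_congr (or_iff_right ?_).symm (or_iff_right ?_).symm) <;>
    · intro h'
      exact absurd (h'.1.trans h'.2) h.asymm

theorem cross_neg_simple_iff {n : ℕ} (ε : Fin 2) {k : ℕ} {a b : Root n} (ha : a.neg.IsSimple k)
    (hb : b.IsAlmostPos) (hab : b ≠ a) :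
    Cross (diagonal ε a) (diagonal ε b) ↔ b.Appears k := by
  have h1 := a.1.1.2
  have h2 := a.1.2.2
  have h3 := b.1.1.2
  have h4 := b.1.2.2
  obtain ⟨e1, e2⟩ := ha
  simp only [Root.neg] at e1 e2
  have hne : ¬ (b.1.1.val = k + 1 ∧ b.1.2.val = k) := by
    rintro ⟨f1, f2⟩
    exact hab (Subtype.ext (Prod.ext (Fin.ext (by omega)) (Fin.ext (by omega))))
  rw [Root.isAlmostPos_iff] at hb
  rw [diagonal, diagonal, Root.Appears, e1, e2]
  by_cases h : b.1.1.val = k + 1 ∨ b.1.1.val = k + 2 ∨ b.1.2.val + 2 = k + 1 ∨ b.1.2.val + 2 = k + 2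
  · refine iff_of_false ?_ (by omega)
    rcases h with h | h | h | h <;> rw [h]
    · exact cross_eq_left
    · rw [Sym2.eq_swap]
      exact cross_eq_left
    · rw [Sym2.eq_swap (a := zigzagVertex n ε b.1.1)]
      exact cross_eq_left
    · rw [Sym2.eq_swap, Sym2.eq_swap (a := zigzagVertex n ε b.1.1)]
      exact cross_eq_left
  · rw [cross_zigzag_iff] <;> omega

theorem iterate_rotate_isAlmostPos {n : ℕ} (ε : Fin 2) {a : Root n} (ha : a.IsAlmostPos) (r : ℕ) :
    ((rotate ε)^[r] a).IsAlmostPos := by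
  induction r with
  | zero => exact ha
  | succ r ih => rw [Function.iterate_succ_apply']; exact rotate_isAlmostPos ε ih

theorem diagonal_iterate_rotate {n : ℕ} (ε : Fin 2) {a : Root n} (ha : a.IsAlmostPos) (r : ℕ) :
    diagonal ε ((rotate ε)^[r] a) = (diagonal ε a).map fun v => v + vtx (n + 2) r := by
  induction r with
  | zero =>
    have : vtx (n + 2) (0 : ℤ) = 0 := rfl
    simp [this]
  | succ r ih =>
    rw [Function.iterate_succ_apply', diagonal_rotate ε (iterate_rotate_isAlmostPos ε ha r), ih,
      Sym2.map_map]
    congr 1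
    funext v
    rw [Function.comp_apply, Nat.cast_succ, vtx_add, vtx_one, add_assoc]

theorem cross_iterate_rotate {n : ℕ} (ε : Fin 2) {a b : Root n} (ha : a.IsAlmostPos)
    (hb : b.IsAlmostPos) (r : ℕ) :
    Cross (diagonal ε ((rotate ε)^[r] a)) (diagonal ε ((rotate ε)^[r] b)) ↔
      Cross (diagonal ε a) (diagonal ε b) := by
  induction r with
  | zero => rfl
  | succ r ih =>
    rw [Function.iterate_succ_apply', Function.iterate_succ_apply',
      diagonal_rotate ε (iterate_rotate_isAlmostPos ε ha r),
      diagonal_rotate ε (iterate_rotate_isAlmostPos ε hb r), cross_map_add, ih]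

theorem iterate_rotate_injOn {n : ℕ} (ε : Fin 2) {a b : Root n} (ha : a.IsAlmostPos)
    (hb : b.IsAlmostPos) (r : ℕ) (h : (rotate ε)^[r] a = (rotate ε)^[r] b) : a = b := by
  refine diagonal_injOn ε ha hb ?_
  have h1 := congrArg (diagonal ε) h
  rw [diagonal_iterate_rotate ε ha, diagonal_iterate_rotate ε hb] at h1
  exact Sym2.map.injective (add_left_injective _) h1

/-- The zigzag contains a diagonal of every length: the one of -α_k spans k + 2 sides. A rotation
carries the given diagonal onto the one of equal length. -/
theorem exists_iterate_rotate_neg_simple {n : ℕ} (ε : Fin 2) {a : Root n} (ha : a.IsAlmostPos) :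
    ∃ r k : ℕ, ((rotate ε)^[r] a).neg.IsSimple k := by
  have hε := ε.2
  have key : ∀ p q : Fin (n + 2), p < q → diagonal ε a = s(p, q) →
      ∃ r k : ℕ, ((rotate ε)^[r] a).neg.IsSimple k := by
    intro p q hpq h
    have hp := p.2
    have hq := q.2
    rw [Fin.lt_def] at hpq
    have hd := isDiagonal_diagonal (ε := ε) ha
    rw [h, isDiagonal_mk_iff] at hd
    simp only [ne_eq, Fin.ext_iff, val_add_one] at hd
    have h2 : 2 ≤ q.val - p.val ∧ q.val - p.val ≤ n := by
      split_ifs at hd <;> omega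
    obtain ⟨k, hk⟩ : ∃ k, k + 2 = q.val - p.val := ⟨q.val - p.val - 2, by omega⟩
    let b : Root n := ⟨(⟨k + 1, by omega⟩, ⟨k, by omega⟩), fun he => by
      have := congrArg Fin.val he
      dsimp only at this
      omega⟩
    have hb : b.IsAlmostPos := (Root.isAlmostPos_iff b).mpr (Or.inr rfl)
    -- The ends are ordered so that k + 2 steps forward from s lead to t after passing the label 0;
    -- which end comes first depends on the parity of k.
    obtain ⟨s, t, hst, hlen, hs, hbd⟩ : ∃ s t : ℕ, s ≤ n + 1 ∧ s + (q.val - p.val) = t + (n + 2) ∧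
        t ≤ n + 1 ∧ diagonal ε b = s(vtx (n + 2) s, vtx (n + 2) t) := by
      by_cases hpar : (k + 1) % 2 = ε.val
      · refine ⟨zigzagPos n ε (k + 1), zigzagPos n ε (k + 2), ?_, ?_, ?_, rfl⟩ <;>
          simp only [zigzagPos] <;> split_ifs <;> omega
      · refine ⟨zigzagPos n ε (k + 2), zigzagPos n ε (k + 1), ?_, ?_, ?_, Sym2.eq_swap⟩ <;>
          simp only [zigzagPos] <;> split_ifs <;> omega
    refine ⟨s + (n + 2) - p.val, k, ?_⟩
    have hR : (rotate ε)^[s + (n + 2) - p.val] a = b := by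
      refine diagonal_injOn ε (iterate_rotate_isAlmostPos ε ha _) hb ?_
      rw [diagonal_iterate_rotate ε ha, h, hbd, Sym2.map_mk]
      have e0 : ((s + (n + 2) - p.val : ℕ) : ℤ) = s + (n + 2 : ℕ) - p.val := by
        rw [Nat.cast_sub (by omega)]
        push_cast
        rfl
      have e1 : vtx (n + 2) ((p.val : ℤ) + (s + (n + 2 : ℕ) - p.val)) = vtx (n + 2) s :=
        vtx_eq_iff.mpr ⟨-1, by omega⟩
      have e2 : vtx (n + 2) ((q.val : ℤ) + (s + (n + 2 : ℕ) - p.val)) = vtx (n + 2) t :=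
        vtx_eq_iff.mpr ⟨-2, by omega⟩
      rw [vtx_add, vtx_natCast] at e1 e2
      rw [e0, e1, e2]
    rw [hR]
    exact ⟨rfl, rfl⟩
  obtain ⟨p, q, hpq⟩ : ∃ p q, diagonal ε a = s(p, q) := ⟨_, _, rfl⟩
  rcases lt_trichotomy p q with h | rfl | h
  · exact key p q h hpq
  · have hd := isDiagonal_diagonal (ε := ε) ha
    rw [hpq, isDiagonal_mk_iff] at hd
    exact absurd rfl hd.1
  · exact key q p h (hpq.trans Sym2.eq_swap)

theorem compat_iff {n : ℕ} (ε : Fin 2) {a b : Root n} (ha : a.IsAlmostPos) (hb : b.IsAlmostPos)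
    (hab : a ≠ b) : Compat ε a b ↔ ¬ Cross (diagonal ε a) (diagonal ε b) := by
  have key : ∀ r k : ℕ, ((rotate ε)^[r] a).neg.IsSimple k →
      (Cross (diagonal ε a) (diagonal ε b) ↔ ((rotate ε)^[r] b).Appears k) := by
    intro r k h
    rw [← cross_iterate_rotate ε ha hb r]
    exact cross_neg_simple_iff ε h (iterate_rotate_isAlmostPos ε hb r)
      fun he => hab (iterate_rotate_injOn ε hb ha r he).symm
  constructor
  · rintro ⟨r, k, h1, h2⟩
    rwa [key r k h1]
  · intro h
    obtain ⟨r, k, hrk⟩ := exists_iterate_rotate_neg_simple ε ha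
    exact ⟨r, k, hrk, by rwa [← key r k hrk]⟩

end TypeA

namespace TypeA

/-! ### Cuts and sides of diagonals -/

variable {n : ℕ} {ε : Fin 2}

/-- The diagonal of an almost positive root in terms of the positions of its two indices on the
cycle of the Coxeter element. -/
theorem zigzagPos_of_isAlmostPos {a : Root n} (ha : a.IsAlmostPos) :
    (cycPos n ε a.1.1 < cycPos n ε a.1.2 ∧ zigzagPos n ε a.1.1 = cycPos n ε a.1.1 ∧
      zigzagPos n ε (a.1.2 + 2) = cycPos n ε a.1.2 + 1) ∨
    (cycPos n ε a.1.2 < cycPos n ε a.1.1 ∧ zigzagPos n ε a.1.1 = cycPos n ε a.1.1 + 2 ∧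
      zigzagPos n ε (a.1.2 + 2) = cycPos n ε a.1.2 + 1) := by
  have hε := ε.2
  have h1 := a.1.1.2
  have h2 := a.1.2.2
  rw [Root.isAlmostPos_iff] at ha
  simp only [cycPos, zigzagPos]
  split_ifs <;> omega

theorem zigzagPos_cases {z : ℕ} (hz : z ≤ n + 1) :
    (z % 2 = ε.val ∧ zigzagPos n ε z + z / 2 = n + 1) ∨
      (z % 2 ≠ ε.val ∧ zigzagPos n ε z = z / 2) := by
  rw [zigzagPos]
  split_ifs <;> omega

/-- Diagonals with a common end never cross, so noncrossing gives no order of the other two ends.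
Here a = d + 2 is the common end, and c ≤ d + 1 while b + 2 ≥ d + 3: the other ends lie on opposite
sides of it along the zigzag, which decides their order. -/
theorem zigzagPos_lt_of_eq {a b c d : ℕ} (ha : a < n) (hb : b < n) (hc : c < n) (hd : d < n)
    (hab : a < b ∨ a = b + 1) (hcd : c < d ∨ c = d + 1)
    (h : zigzagPos n ε a = zigzagPos n ε (d + 2))
    (h1 : zigzagPos n ε (b + 2) < zigzagPos n ε a)
    (h2 : zigzagPos n ε c < zigzagPos n ε (d + 2)) :
    zigzagPos n ε c < zigzagPos n ε (b + 2) := by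
  have hε := ε.2
  obtain rfl : a = d + 2 := by
    refine zigzagVertex_inj (n := n) (ε := ε) (by omega) (by omega) (Fin.ext ?_)
    rwa [zigzagVertex_val (by omega), zigzagVertex_val (by omega)]
  have p1 := zigzagPos_cases (n := n) (ε := ε) (z := d + 2) (by omega)
  have p2 := zigzagPos_cases (n := n) (ε := ε) (z := b + 2) (by omega)
  have p3 := zigzagPos_cases (n := n) (ε := ε) (z := c) (by omega)
  rcases p1 with p1 | p1 <;> rcases p2 with p2 | p2 <;> rcases p3 with p3 | p3 <;> omega

theorem zigzagPos_le_of_eq {a b c d : ℕ} (ha : a < n) (hb : b < n) (hc : c < n) (hd : d < n)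
    (hab : a < b ∨ a = b + 1) (hcd : c < d ∨ c = d + 1)
    (h : zigzagPos n ε c = zigzagPos n ε (b + 2))
    (h1 : zigzagPos n ε (b + 2) < zigzagPos n ε a)
    (h2 : zigzagPos n ε c < zigzagPos n ε (d + 2)) :
    zigzagPos n ε (d + 2) ≤ zigzagPos n ε a := by
  have hε := ε.2
  obtain rfl : c = b + 2 := by
    refine zigzagVertex_inj (n := n) (ε := ε) (by omega) (by omega) (Fin.ext ?_)
    rwa [zigzagVertex_val (by omega), zigzagVertex_val (by omega)]
  have p1 := zigzagPos_cases (n := n) (ε := ε) (z := d + 2) (by omega)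
  have p2 := zigzagPos_cases (n := n) (ε := ε) (z := b + 2) (by omega)
  have p3 := zigzagPos_cases (n := n) (ε := ε) (z := a) (by omega)
  rcases p1 with p1 | p1 <;> rcases p2 with p2 | p2 <;> rcases p3 with p3 | p3 <;> omega

/-- A linear order on the almost positive roots in which the cuts of earlier roots do not separate
later compatible ones. -/
def cutRank (n : ℕ) (ε : Fin 2) (a : Root n) : ℤ :=
  cycPos n ε a.1.1 + cycPos n ε a.1.2 - if cycPos n ε a.1.2 < cycPos n ε a.1.1 then n else 0

/-- In cycle positions A, B the diagonal is {A, B + 1} if A < B and {A + 2, B + 1} otherwise.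
Noncrossing forbids a proper overlap of arcs, but a half-open cut may still separate the other pair
when arcs share an end; the rank excludes that case. -/
theorem inCut_iff_of_cutRank_le {a b : Root n} (ha : a.IsAlmostPos) (hb : b.IsAlmostPos)
    (hab : a ≠ b) (hc : ¬ Cross (diagonal ε a) (diagonal ε b))
    (h : cutRank n ε a ≤ cutRank n ε b) :
    InCut (fun x : Fin n => cycPos n ε x.val) b.1 a.1.1 ↔
      InCut (fun x : Fin n => cycPos n ε x.val) b.1 a.1.2 := by
  have hA := zigzagPos_of_isAlmostPos (ε := ε) ha
  have hB := zigzagPos_of_isAlmostPos (ε := ε) hb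
  have h1 := a.1.1.2
  have h2 := a.1.2.2
  have h3 := b.1.1.2
  have h4 := b.1.2.2
  have i1 := cycPos_lt (ε := ε) h1
  have i2 := cycPos_lt (ε := ε) h2
  have i3 := cycPos_lt (ε := ε) h3
  have i4 := cycPos_lt (ε := ε) h4
  have hne : ¬ (cycPos n ε a.1.1 = cycPos n ε b.1.1 ∧ cycPos n ε a.1.2 = cycPos n ε b.1.2) :=
    fun h => hab (Subtype.ext (Prod.ext (cycPos_injective n ε h.1) (cycPos_injective n ε h.2)))
  rw [diagonal, diagonal, cross_mk_iff] at hc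
  simp only [Fin.lt_def, zigzagVertex_val (show a.1.1.val ≤ n + 1 by omega),
    zigzagVertex_val (show a.1.2.val + 2 ≤ n + 1 by omega),
    zigzagVertex_val (show b.1.1.val ≤ n + 1 by omega),
    zigzagVertex_val (show b.1.2.val + 2 ≤ n + 1 by omega), not_or] at hc
  obtain ⟨c1, c2, c3, c4, c5, c6, c7, c8⟩ := hc
  simp only [cutRank] at h
  simp only [InCut]
  have hS := zigzagPos_lt_of_eq (ε := ε) h1 h2 h3 h4 (a.isAlmostPos_iff.mp ha)
    (b.isAlmostPos_iff.mp hb)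
  have hS' := zigzagPos_le_of_eq (ε := ε) h1 h2 h3 h4 (a.isAlmostPos_iff.mp ha)
    (b.isAlmostPos_iff.mp hb)
  generalize zigzagPos n ε a.1.1 = PA at *
  generalize zigzagPos n ε (a.1.2 + 2) = PB at *
  generalize zigzagPos n ε b.1.1 = PC at *
  generalize zigzagPos n ε (b.1.2 + 2) = PD at *
  generalize cycPos n ε a.1.1 = A at *
  generalize cycPos n ε a.1.2 = B at *
  generalize cycPos n ε b.1.1 = C at *
  generalize cycPos n ε b.1.2 = D at *
  rcases hA with ⟨hA, rfl, rfl⟩ | ⟨hA, rfl, rfl⟩ <;> rcases hB with ⟨hB, rfl, rfl⟩ | ⟨hB, rfl, rfl⟩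
  · rw [if_neg (by omega), if_neg (by omega)] at h
    rw [min_eq_left hB.le, max_eq_right hB.le]
    clear c3 c4 c6 c7 c8 c2
    omega
  · rw [if_neg (by omega), if_pos hB] at h
    rw [min_eq_right hB.le, max_eq_left hB.le]
    clear c3 c4 c5 c8 c6 c1
    omega
  · rw [if_pos hA, if_neg (by omega)] at h
    rw [min_eq_left hB.le, max_eq_right hB.le]
    clear c1 c2 c4 c5 c7
    omega
  · rw [if_pos hA, if_pos hB] at h
    rw [min_eq_right hB.le, max_eq_left hB.le]
    clear c1 c2 c3 c5 c6 c7
    omega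

theorem exists_isUnseparated {f : Finset (Root n)} (hf : ∀ a ∈ f, a.IsAlmostPos)
    (hc : ∀ a ∈ f, ∀ b ∈ f, ¬ Cross (diagonal ε a) (diagonal ε b)) :
    ∃ L : List (Root n), L.Nodup ∧ (∀ a, a ∈ L ↔ a ∈ f) ∧
      IsUnseparated (fun x : Fin n => cycPos n ε x.val) (L.map Subtype.val) := by
  have hle : ∀ a b : Root n, decide (cutRank n ε a ≤ cutRank n ε b) = true ↔
      cutRank n ε a ≤ cutRank n ε b := fun a b => decide_eq_true_iff
  let L := f.toList.mergeSort fun a b => decide (cutRank n ε a ≤ cutRank n ε b)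
  have hp : L.Perm f.toList := List.mergeSort_perm _ _
  have hL : ∀ a, a ∈ L ↔ a ∈ f := fun a => hp.mem_iff.trans Finset.mem_toList
  have hnd : L.Nodup := hp.nodup_iff.mpr f.nodup_toList
  have hs : L.Pairwise fun a b => decide (cutRank n ε a ≤ cutRank n ε b) = true :=
    List.pairwise_mergeSort (fun a b c h1 h2 => by rw [hle] at *; exact h1.trans h2)
      (fun a b => by
        rw [Bool.or_eq_true, hle, hle]
        exact le_total _ _) _
  refine ⟨L, hnd, hL, ?_⟩
  rw [IsUnseparated, List.pairwise_map]
  refine (hs.and hnd).imp_of_mem fun {a b} ha hb h => ?_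
  exact inCut_iff_of_cutRank_le (hf a ((hL a).mp ha)) (hf b ((hL b).mp hb)) h.2
    (hc a ((hL a).mp ha) b ((hL b).mp hb)) ((hle a b).mp h.1)

/-- The label attached to the vertex number `x + 1` of the zigzag. -/
theorem cycPos_cMinus (x : Fin n) :
    cycPos n ε (cMinus n ε x).val =
      if (x.val + 1) % 2 = ε.val then zigzagPos n ε (x.val + 1) - 2
      else if zigzagPos n ε (x.val + 1) = 0 then n - 1 else zigzagPos n ε (x.val + 1) - 1 := by
  have hε := ε.2
  have h1 := x.2
  rw [cMinus_val]
  simp only [cycPos, zigzagPos]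
  split_ifs <;> omega

theorem inCut_cMinus_iff_aux {a b j w r : ℕ} (ha : a < n) (hb : b < n) (hab : a < b ∨ a = b + 1)
    (hj : 1 ≤ j) (hj' : j ≤ n) (hw : w ≤ n + 1) (h1 : w ≠ a) (h2 : w ≠ b + 2)
    (h : w = j ∨ (j = a ∧ w < j) ∨ (j = b + 2 ∧ j < w))
    (hr : (j % 2 = ε.val ∧ r + 2 = zigzagPos n ε j) ∨
      (j % 2 ≠ ε.val ∧ (zigzagPos n ε j = 0 ∧ r + 1 = n ∨ r + 1 = zigzagPos n ε j))) :
    (zigzagPos n ε a < zigzagPos n ε (b + 2) →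
      (zigzagPos n ε a ≤ r ∧ r + 1 < zigzagPos n ε (b + 2) ↔
        zigzagPos n ε a < zigzagPos n ε w ∧ zigzagPos n ε w < zigzagPos n ε (b + 2))) ∧
    (zigzagPos n ε (b + 2) < zigzagPos n ε a →
      (zigzagPos n ε (b + 2) ≤ r + 1 ∧ r + 2 < zigzagPos n ε a ↔
        zigzagPos n ε (b + 2) < zigzagPos n ε w ∧ zigzagPos n ε w < zigzagPos n ε a)) := by
  have hε := ε.2
  have pa := zigzagPos_cases (n := n) (ε := ε) (z := a) (by omega)
  have pb := zigzagPos_cases (n := n) (ε := ε) (z := b + 2) (by omega)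
  have pw := zigzagPos_cases (n := n) (ε := ε) (z := w) hw
  rcases h with rfl | ⟨rfl, h⟩ | ⟨rfl, h⟩ <;> rcases pa with pa | pa <;> rcases pb with pb | pb <;>
    rcases pw with pw | pw <;> rcases hr with hr | ⟨hr', hr | hr⟩ <;>
    generalize zigzagPos n ε _ = A at * <;> constructor <;> intro h0 <;> constructor <;>
    intro h3 <;> omega

/-- Cuts are half-open, so a label whose vertex is an end of the diagonal still has a definite side:
that of the earlier zigzag vertices at the first end, that of the later ones at the second. The
vertex `w` is a witness of that side. -/
theorem inCut_cMinus_iff {a : Root n} (ha : a.IsAlmostPos) (x : Fin n) {w : ℕ} (hw : w ≤ n + 1)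
    (h1 : w ≠ a.1.1) (h2 : w ≠ a.1.2 + 2) (h : w = x + 1 ∨ (x.val + 1 = a.1.1 ∧ w < x + 1) ∨
      (x.val + 1 = a.1.2 + 2 ∧ x.val + 1 < w)) :
    InCut (fun x : Fin n => cycPos n ε x.val) a.1 (cMinus n ε x) ↔
      min (zigzagPos n ε a.1.1) (zigzagPos n ε (a.1.2 + 2)) < zigzagPos n ε w ∧
        zigzagPos n ε w < max (zigzagPos n ε a.1.1) (zigzagPos n ε (a.1.2 + 2)) := by
  have hA := zigzagPos_of_isAlmostPos (ε := ε) ha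
  have jx := x.2
  have hr : ((x.val + 1) % 2 = ε.val ∧
        cycPos n ε (cMinus n ε x).val + 2 = zigzagPos n ε (x.val + 1)) ∨
      ((x.val + 1) % 2 ≠ ε.val ∧ (zigzagPos n ε (x.val + 1) = 0 ∧
        cycPos n ε (cMinus n ε x).val + 1 = n ∨
          cycPos n ε (cMinus n ε x).val + 1 = zigzagPos n ε (x.val + 1))) := by
    have px := zigzagPos_cases (n := n) (ε := ε) (z := x + 1) (by omega)
    rw [cycPos_cMinus]
    split_ifs <;> omega
  obtain ⟨k1, k2⟩ := inCut_cMinus_iff_aux a.1.1.2 a.1.2.2 (a.isAlmostPos_iff.mp ha)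
    (show 1 ≤ x.val + 1 by omega) (by omega) hw h1 h2 h hr
  simp only [InCut]
  rcases hA with ⟨hA, e1, e2⟩ | ⟨hA, e1, e2⟩
  · rw [min_eq_left hA.le, max_eq_right hA.le, min_eq_left (by omega), max_eq_right (by omega),
      ← k1 (by omega)]
    omega
  · rw [min_eq_right hA.le, max_eq_left hA.le, min_eq_right (by omega), max_eq_left (by omega),
      ← k2 (by omega)]
    omega

theorem cross_iff_min_max {N : ℕ} {p q x y : Fin N} (hpq : p ≠ q) (h1 : x ≠ p) (h2 : x ≠ q)
    (h3 : y ≠ p) (h4 : y ≠ q) : Cross s(p, q) s(x, y) ↔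
      ¬ ((min p.val q.val < x.val ∧ x.val < max p.val q.val) ↔
        (min p.val q.val < y.val ∧ y.val < max p.val q.val)) := by
  rcases lt_or_gt_of_ne hpq with h | h
  · rw [cross_iff_of_lt h h1 h2 h3 h4, min_eq_left (Fin.le_def.mp h.le),
      max_eq_right (Fin.le_def.mp h.le)]
    rfl
  · rw [Sym2.eq_swap, cross_iff_of_lt h h2 h1 h4 h3, min_eq_right (Fin.le_def.mp h.le),
      max_eq_left (Fin.le_def.mp h.le)]
    rfl

/-- The labels of two vertices are on the same side of the cut of a root if and only if the
vertices, displaced to the left or to the right when they are on the diagonal, are on the same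
side of the diagonal of the root. -/
theorem cross_diagonal_iff {a : Root n} (ha : a.IsAlmostPos) (x y : Fin n) {w z : ℕ}
    (hw : w ≤ n + 1) (hw1 : w ≠ a.1.1) (hw2 : w ≠ a.1.2 + 2)
    (hx : w = x + 1 ∨ (x.val + 1 = a.1.1 ∧ w < x + 1) ∨ (x.val + 1 = a.1.2 + 2 ∧ x.val + 1 < w))
    (hz : z ≤ n + 1) (hz1 : z ≠ a.1.1) (hz2 : z ≠ a.1.2 + 2)
    (hy : z = y + 1 ∨ (y.val + 1 = a.1.1 ∧ z < y + 1) ∨ (y.val + 1 = a.1.2 + 2 ∧ y.val + 1 < z)) :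
    Cross (diagonal ε a) s(zigzagVertex n ε w, zigzagVertex n ε z) ↔
      ¬ (InCut (fun x : Fin n => cycPos n ε x.val) a.1 (cMinus n ε x) ↔
        InCut (fun x : Fin n => cycPos n ε x.val) a.1 (cMinus n ε y)) := by
  rw [inCut_cMinus_iff ha x hw hw1 hw2 hx, inCut_cMinus_iff ha y hz hz1 hz2 hy, diagonal]
  have j1 := a.1.1.2
  have j2 := a.1.2.2
  rw [Root.isAlmostPos_iff] at ha
  have inj : ∀ {z w}, z ≤ n + 1 → w ≤ n + 1 → z ≠ w →
      zigzagVertex n ε z ≠ zigzagVertex n ε w := fun hz hw h he => h (zigzagVertex_inj hz hw he)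
  rw [cross_iff_min_max (inj (by omega) (by omega) (by omega)) (inj hw (by omega) hw1)
    (inj hw (by omega) hw2) (inj hz (by omega) hz1) (inj hz (by omega) hz2),
    zigzagVertex_val hw, zigzagVertex_val hz, zigzagVertex_val (by omega),
    zigzagVertex_val (by omega)]

end TypeA

namespace TypeA

/-! ### Cells and classes of labels -/

variable {n : ℕ} {ε : Fin 2}

theorem ne_of_cross {N : ℕ} {p q x y : Fin N} (h : Cross s(p, q) s(x, y)) :
    p ≠ q ∧ x ≠ p ∧ x ≠ q ∧ y ≠ p ∧ y ≠ q := by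
  refine ⟨?_, ?_, ?_, ?_, ?_⟩ <;> rintro rfl
  · exact not_cross_diag _ _ _ h
  · exact cross_eq_left h
  · rw [Sym2.eq_swap] at h
    exact cross_eq_left h
  · rw [Sym2.eq_swap (a := x)] at h
    exact cross_eq_left h
  · rw [Sym2.eq_swap, Sym2.eq_swap (a := x)] at h
    exact cross_eq_left h

/-- Being on the same side of a chord is transitive among the vertices that are not its ends. -/
theorem cross_congr {N : ℕ} {p q x y z : Fin N} (h : ¬ Cross s(p, q) s(x, y)) (hx1 : x ≠ p)
    (hx2 : x ≠ q) (hy1 : y ≠ p) (hy2 : y ≠ q) (hc : Cross s(p, q) s(x, z)) :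
    Cross s(p, q) s(y, z) := by
  obtain ⟨hpq, -, -, h3, h4⟩ := ne_of_cross hc
  rw [cross_iff_min_max hpq (by assumption) (by assumption) (by assumption) (by assumption)] at *
  tauto

open Classical in
/-- The labels of the vertices of a set that are neither the first nor the last one along the
zigzag. -/
noncomputable def midLabels (ε : Fin 2) (Q : Finset (Fin (n + 2))) : Finset (Fin n) :=
  Finset.univ.filter fun x => zigzagVertex n ε (x + 1) ∈ Q ∧
    (∃ w < x.val + 1, zigzagVertex n ε w ∈ Q) ∧
      ∃ w, x.val + 1 < w ∧ w ≤ n + 1 ∧ zigzagVertex n ε w ∈ Q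

theorem mem_midLabels {Q : Finset (Fin (n + 2))} {x : Fin n} :
    x ∈ midLabels ε Q ↔ zigzagVertex n ε (x + 1) ∈ Q ∧
      (∃ w < x.val + 1, zigzagVertex n ε w ∈ Q) ∧
        ∃ w, x.val + 1 < w ∧ w ≤ n + 1 ∧ zigzagVertex n ε w ∈ Q := by
  simp [midLabels]

theorem card_midLabels {Q : Finset (Fin (n + 2))} (hQ : 2 ≤ Q.card) :
    (midLabels ε Q).card = Q.card - 2 := by
  classical
  let T := (Finset.range (n + 2)).filter fun z => zigzagVertex n ε z ∈ Q
  have memT : ∀ z, z ∈ T ↔ z < n + 2 ∧ zigzagVertex n ε z ∈ Q := fun z => by simp [T]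
  have hT : T.card = Q.card := by
    refine Finset.card_bij (fun z _ => zigzagVertex n ε z) (fun z hz => ((memT z).mp hz).2) ?_ ?_
    · intro z hz w hw h
      rw [memT] at hz hw
      exact zigzagVertex_inj (by omega) (by omega) h
    · intro p hp
      obtain ⟨z, hz, rfl⟩ := exists_zigzagVertex ε p
      exact ⟨z, (memT z).mpr ⟨by omega, hp⟩, rfl⟩
  have hne : T.Nonempty := Finset.card_pos.mp (by omega)
  have hlt : T.min' hne < T.max' hne :=
    Finset.min'_lt_max'_of_card T (by omega)
  rw [← hT]
  have h1 : ((T.erase (T.min' hne)).erase (T.max' hne)).card = T.card - 2 := by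
    rw [Finset.card_erase_of_mem, Finset.card_erase_of_mem (T.min'_mem hne), Nat.sub_sub]
    exact Finset.mem_erase.mpr ⟨hlt.ne', T.max'_mem hne⟩
  rw [← h1]
  refine Finset.card_bij (fun x _ => x.val + 1) ?_ (fun x _ y _ h => Fin.ext (by omega)) ?_
  · intro x hx
    obtain ⟨h2, ⟨w, hw, hwQ⟩, z, hz, hz', hzQ⟩ := mem_midLabels.mp hx
    have hw' := T.min'_le w ((memT w).mpr ⟨by omega, hwQ⟩)
    have hz'' := T.le_max' z ((memT z).mpr ⟨by omega, hzQ⟩)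
    rw [Finset.mem_erase, Finset.mem_erase, memT]
    exact ⟨by omega, by omega, by omega, h2⟩
  · intro z hz
    rw [Finset.mem_erase, Finset.mem_erase] at hz
    obtain ⟨hz1, hz2, hz3⟩ := hz
    have h4 := T.min'_le z hz3
    have h5 := T.le_max' z hz3
    have h6 := (memT _).mp (T.min'_mem hne)
    have h7 := (memT _).mp (T.max'_mem hne)
    obtain ⟨y, rfl⟩ : ∃ y, z = y + 1 := ⟨z - 1, by omega⟩
    refine ⟨⟨y, by omega⟩, mem_midLabels.mpr ⟨((memT _).mp hz3).2, ⟨_, ?_, h6.2⟩, _, ?_, ?_, h7.2⟩,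
      rfl⟩
    · exact lt_of_le_of_ne h4 (Ne.symm hz2)
    · exact lt_of_le_of_ne h5 hz1
    · omega

/-- If the vertex is an end of the diagonal, an earlier or later vertex of Q replaces it; this is
why the extreme vertices of Q are left out of `midLabels`. Since a.1.1 < a.1.2 + 2, the replacement
is not the other end. -/
theorem exists_companion {Q : Finset (Fin (n + 2))} {x : Fin n} (hx : x ∈ midLabels ε Q)
    {a : Root n} (ha : a.IsAlmostPos) :
    ∃ w ≤ n + 1, zigzagVertex n ε w ∈ Q ∧ w ≠ a.1.1 ∧ w ≠ a.1.2 + 2 ∧ (w = x + 1 ∨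
      (x.val + 1 = a.1.1 ∧ w < x + 1) ∨ (x.val + 1 = a.1.2 + 2 ∧ x.val + 1 < w)) := by
  obtain ⟨h2, ⟨w, hw, hwQ⟩, z, hz, hz', hzQ⟩ := mem_midLabels.mp hx
  rw [Root.isAlmostPos_iff] at ha
  have := x.2
  by_cases h3 : x.val + 1 = a.1.1
  · exact ⟨w, by omega, hwQ, by omega, by omega, Or.inr (Or.inl ⟨h3, hw⟩)⟩
  · by_cases h4 : x.val + 1 = a.1.2 + 2
    · exact ⟨z, by omega, hzQ, by omega, by omega, Or.inr (Or.inr ⟨h4, hz⟩)⟩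
    · exact ⟨x + 1, by omega, h2, h3, h4, Or.inl rfl⟩

variable {f : Finset (Root n)}

theorem inCut_iff_of_mem_midLabels [DecidableEq (Sym2 (Fin (n + 2)))]
    (hf : ∀ a ∈ f, a.IsAlmostPos) {Q : Finset (Fin (n + 2))}
    (hQ : IsCell (f.image (diagonal ε)) Q) {x y : Fin n} (hx : x ∈ midLabels ε Q)
    (hy : y ∈ midLabels ε Q) {a : Root n} (ha : a ∈ f) :
    InCut (fun x : Fin n => cycPos n ε x.val) a.1 (cMinus n ε x) ↔
      InCut (fun x : Fin n => cycPos n ε x.val) a.1 (cMinus n ε y) := by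
  obtain ⟨w, hw, hwQ, h1, h2, h3⟩ := exists_companion hx (hf a ha)
  obtain ⟨z, hz, hzQ, h4, h5, h6⟩ := exists_companion hy (hf a ha)
  have h := hQ.visible _ hwQ _ hzQ _ (Finset.mem_image_of_mem _ ha)
  rwa [cross_diagonal_iff (hf a ha) x y hw h1 h2 h3 hz h4 h5 h6, not_not] at h

/-- By maximality, some diagonal separates a vertex of one cell from a vertex of the other. Each
cell lies on one side of it, so the companions, which avoid its ends, are separated too. -/
theorem exists_inCut_of_ne [DecidableEq (Sym2 (Fin (n + 2)))]
    (hf : ∀ a ∈ f, a.IsAlmostPos) {Q Q' : Finset (Fin (n + 2))}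
    (hQ : IsCell (f.image (diagonal ε)) Q) (hQ' : IsCell (f.image (diagonal ε)) Q')
    (hne : Q ≠ Q') {x y : Fin n} (hx : x ∈ midLabels ε Q) (hy : y ∈ midLabels ε Q') :
    ∃ a ∈ f, ¬ (InCut (fun x : Fin n => cycPos n ε x.val) a.1 (cMinus n ε x) ↔
      InCut (fun x : Fin n => cycPos n ε x.val) a.1 (cMinus n ε y)) := by
  obtain ⟨t, ht, q, hq, htq⟩ : ∃ t ∈ Q', ∃ q ∈ Q, ¬ Visible (f.image (diagonal ε)) t q := by
    by_contra hcon
    push Not at hcon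
    exact hne (hQ'.eq_of_subset hQ.visible fun t ht => hQ.maximal t (hcon t ht)).symm
  simp only [Visible, not_forall, not_not] at htq
  obtain ⟨d, hd, hc⟩ := htq
  obtain ⟨a, ha, rfl⟩ := Finset.mem_image.mp hd
  refine ⟨a, ha, ?_⟩
  obtain ⟨w, hw, hwQ, h1, h2, h3⟩ := exists_companion hx (hf a ha)
  obtain ⟨z, hz, hzQ, h4, h5, h6⟩ := exists_companion hy (hf a ha)
  rw [← cross_diagonal_iff (hf a ha) x y hw h1 h2 h3 hz h4 h5 h6]
  have v1 := hQ.visible _ hq _ hwQ _ hd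
  have v2 := hQ'.visible _ ht _ hzQ _ hd
  have b1 := a.1.1.2
  have b2 := a.1.2.2
  have inj : ∀ {z w}, z ≤ n + 1 → w ≤ n + 1 → z ≠ w →
      zigzagVertex n ε z ≠ zigzagVertex n ε w := fun hz hw h he => h (zigzagVertex_inj hz hw he)
  rw [diagonal] at *
  obtain ⟨-, t1, t2, q1, q2⟩ := ne_of_cross hc
  have c1 := cross_congr v2 t1 t2 (inj hz (by omega) h4) (inj hz (by omega) h5) hc
  rw [Sym2.eq_swap (a := zigzagVertex n ε z)] at c1
  exact cross_congr v1 q1 q2 (inj hw (by omega) h1) (inj hw (by omega) h2) c1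

/-- The sets `midLabels` of the cells are disjoint and have total size n by `hsum`, so they exhaust
the labels. Labels of one cell are never separated and labels of different cells always are, so
these sets are the classes. -/
theorem hasParabolicType_iff_cells [DecidableEq (Sym2 (Fin (n + 2)))] (hn : 1 ≤ n)
    (hf : ∀ a ∈ f, a.IsAlmostPos)
    (hc : ∀ a ∈ f, ∀ b ∈ f, ¬ Cross (diagonal ε a) (diagonal ε b))
    (hsum : ∑ Q ∈ cells (f.image (diagonal ε)), (Q.card - 2) = n) (lam : n.Partition) :
    HasParabolicType ε f lam ↔ ∀ k, 1 ≤ k →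
      ((cells (f.image (diagonal ε))).filter fun Q => Q.card = k + 2).card =
        lam.parts.count k := by
  classical
  rw [hasParabolicType_iff (cycPos_injective n ε) hn (isNext_cox n ε) (cPlus_mul_self n ε)
    (cMinus_mul_self n ε) (exists_isUnseparated hf hc)]
  set D := f.image (diagonal ε) with hD
  have hdisj : ∀ Q ∈ cells D, ∀ Q' ∈ cells D, ∀ x, x ∈ midLabels ε Q → x ∈ midLabels ε Q' →
      Q = Q' := by
    intro Q hQ Q' hQ' x hx hx'
    by_contra hne
    obtain ⟨a, -, ha⟩ := exists_inCut_of_ne hf (mem_cells.mp hQ) (mem_cells.mp hQ') hne hx hx'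
    exact ha Iff.rfl
  have hpd : (cells D : Set (Finset (Fin (n + 2)))).PairwiseDisjoint (midLabels ε) := by
    intro Q hQ Q' hQ' hne
    rw [Function.onFun, Finset.disjoint_left]
    exact fun x hx hx' => hne (hdisj Q hQ Q' hQ' x hx hx')
  have hcard : ∀ Q ∈ cells D, (midLabels ε Q).card = Q.card - 2 := fun Q hQ =>
    card_midLabels (by have := (mem_cells.mp hQ).three_le; omega)
  have huniv : (cells D).biUnion (midLabels ε) = Finset.univ := by
    refine Finset.eq_univ_of_card _ ?_
    rw [Finset.card_biUnion hpd, Finset.sum_congr rfl hcard, hsum, Fintype.card_fin]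
  have hclass : ∀ Q ∈ cells D, ∀ x ∈ midLabels ε Q,
      classSize (fun x : Fin n => cycPos n ε x.val) f (cMinus n ε x) = Q.card - 2 := by
    intro Q hQ x hx
    rw [← hcard Q hQ, classSize]
    refine (Finset.card_bij (fun y _ => cMinus n ε y) ?_ ?_ ?_).symm
    · intro y hy
      rw [Finset.mem_filter]
      exact ⟨Finset.mem_univ _, fun a ha =>
        inCut_iff_of_mem_midLabels hf (mem_cells.mp hQ) hx hy ha⟩
    · exact fun y _ z _ h => (cMinus n ε).injective h
    · intro z hz
      rw [Finset.mem_filter] at hz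
      obtain ⟨y, rfl⟩ := (cMinus n ε).surjective z
      refine ⟨y, ?_, rfl⟩
      obtain ⟨Q', hQ', hy⟩ := Finset.mem_biUnion.mp (huniv.symm ▸ Finset.mem_univ y)
      by_contra hne
      obtain ⟨a, ha, h⟩ := exists_inCut_of_ne hf (mem_cells.mp hQ) (mem_cells.mp hQ')
        (fun h => hne (h ▸ hy)) hx hy
      exact h (hz.2 a ha)
  have hcount : ∀ k, (Finset.univ.filter fun x =>
      classSize (fun x : Fin n => cycPos n ε x.val) f x = k).card =
        k * ((cells D).filter fun Q => Q.card = k + 2).card := by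
    intro k
    have h1 : (Finset.univ.filter fun x =>
        classSize (fun x : Fin n => cycPos n ε x.val) f x = k).card =
        (((cells D).filter fun Q => Q.card = k + 2).biUnion (midLabels ε)).card := by
      refine (Finset.card_bij (fun y _ => cMinus n ε y) ?_ ?_ ?_).symm
      · intro y hy
        obtain ⟨Q, hQ, hy⟩ := Finset.mem_biUnion.mp hy
        rw [Finset.mem_filter] at hQ
        rw [Finset.mem_filter, hclass Q hQ.1 y hy]
        exact ⟨Finset.mem_univ _, by omega⟩
      · exact fun y _ z _ h => (cMinus n ε).injective h
      · intro z hz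
        rw [Finset.mem_filter] at hz
        obtain ⟨y, rfl⟩ := (cMinus n ε).surjective z
        obtain ⟨Q, hQ, hy⟩ := Finset.mem_biUnion.mp (huniv.symm ▸ Finset.mem_univ y)
        have h3 := (mem_cells.mp hQ).three_le
        rw [hclass Q hQ y hy] at hz
        exact ⟨y, Finset.mem_biUnion.mpr ⟨Q, Finset.mem_filter.mpr ⟨hQ, by omega⟩, hy⟩, rfl⟩
    rw [h1, Finset.card_biUnion (hpd.subset fun Q hQ => (Finset.mem_filter.mp hQ).1),
      Finset.sum_const_nat (m := k), mul_comm]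
    intro Q hQ
    rw [Finset.mem_filter] at hQ
    rw [hcard Q hQ.1, hQ.2]
    rfl
  refine forall_congr' fun k => ?_
  rw [hcount]
  rcases Nat.eq_zero_or_pos k with rfl | hk
  · simp
  · rw [Nat.mul_right_inj hk.ne']
    exact ⟨fun h _ => h, fun h => h hk⟩

end TypeA

namespace TypeA

/-! ### Dissections and the families of intervals on a line -/

variable {N : ℕ} [NeZero N]

/-- A dissection of the polygon: a set of pairwise noncrossing diagonals. -/
structure IsDissection (D : Finset (Sym2 (Fin N))) : Prop where
  isDiagonal : ∀ d ∈ D, IsDiagonal d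
  not_cross : ∀ d ∈ D, ∀ e ∈ D, ¬ Cross d e

theorem isDiagonal_vtx_iff {u v : ℤ} (huv : u < v) (hv : v < u + N) :
    IsDiagonal s(vtx N u, vtx N v) ↔ u + 2 ≤ v ∧ v + 2 ≤ u + N := by
  rw [isDiagonal_mk_iff, ← vtx_one, ← vtx_add, ← vtx_add]
  constructor
  · rintro ⟨-, h2, h3⟩
    constructor
    · by_contra h
      exact h2 (congrArg _ (by omega))
    · by_contra h
      exact h3 (vtx_eq_iff.mpr ⟨-1, by omega⟩)
  · rintro ⟨h1, h2⟩
    refine ⟨fun h => ?_, fun h => ?_, fun h => ?_⟩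
    · have := vtx_injOn u (by omega) (by omega) (by omega) (by omega) h
      omega
    · have := vtx_injOn u (by omega) (by omega) (by omega) (by omega) h
      omega
    · have := vtx_injOn u (by omega) (by omega) (by omega) (by omega) h
      omega

/-- Every diagonal has a standard form. -/
theorem IsDiagonal.exists_nat {d : Sym2 (Fin N)} (hd : IsDiagonal d) :
    ∃ r ℓ : ℕ, 2 ≤ ℓ ∧ r + ℓ < N ∧ ℓ + 2 ≤ N ∧ d = s(vtx N r, vtx N (r + ℓ : ℤ)) := by
  induction d using Sym2.ind with
  | _ p q =>
  have key : ∀ p q : Fin N, p < q → IsDiagonal s(p, q) →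
      ∃ r ℓ : ℕ, 2 ≤ ℓ ∧ r + ℓ < N ∧ ℓ + 2 ≤ N ∧ s(p, q) = s(vtx N r, vtx N (r + ℓ : ℤ)) := by
    intro p q hpq h
    rw [Fin.lt_def] at hpq
    have hq := q.2
    have e : ((p.val : ℤ) + (q.val - p.val : ℕ)) = q.val := by omega
    rw [← vtx_natCast p, ← vtx_natCast q, isDiagonal_vtx_iff (by omega) (by omega)] at h
    refine ⟨p.val, q.val - p.val, by omega, by omega, by omega, ?_⟩
    rw [e, vtx_natCast, vtx_natCast]
  rcases lt_trichotomy p q with h | rfl | h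
  · exact key p q h hd
  · exact absurd rfl ((isDiagonal_mk_iff p p).mp hd).1
  · rw [Sym2.eq_swap] at hd ⊢
    exact key q p h hd

open Classical in
/-- The diagonals of a dissection and the side between the last and the first vertex as intervals
of `[0, N - 1]`, translated by `x` and by the multiples of `P`. -/
noncomputable def linFamily (D : Finset (Sym2 (Fin N))) (P : ℕ) (x u : ℤ) : Finset ℕ :=
  (Finset.range N).filter fun ℓ => 2 ≤ ℓ ∧ (u - x) % P + ℓ + 1 ≤ N ∧
    (s(vtx N ((u - x) % P), vtx N ((u - x) % P + ℓ)) ∈ D ∨ ℓ + 1 = N)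

variable {D : Finset (Sym2 (Fin N))} {P : ℕ} {x : ℤ}

theorem mem_linFamily {k r : ℤ} (hr : 0 ≤ r) (hr' : r < P) {ℓ : ℕ} :
    ℓ ∈ linFamily D P x (x + k * P + r) ↔ 2 ≤ ℓ ∧ r + ℓ + 1 ≤ N ∧
      (s(vtx N r, vtx N (r + ℓ)) ∈ D ∨ ℓ + 1 = N) := by
  have h : (x + k * P + r - x) % P = r := by
    rw [show x + k * P + r - x = r + k * P by ring, Int.add_mul_emod_self_right,
      Int.emod_eq_of_lt hr hr']
  rw [linFamily, Finset.mem_filter, h, Finset.mem_range]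
  constructor
  · exact fun h => h.2
  · exact fun h => ⟨by omega, h⟩

theorem exists_block (x : ℤ) (hP : 1 ≤ P) (u : ℤ) : ∃ k r : ℤ, u = x + k * P + r ∧ 0 ≤ r ∧ r < P := by
  refine ⟨(u - x) / P, (u - x) % P, ?_, Int.emod_nonneg _ (by omega),
    Int.emod_lt_of_pos _ (by omega)⟩
  have := Int.mul_ediv_add_emod (u - x) P
  rw [mul_comm] at this
  omega

theorem block_eq {k k' : ℤ} (h1 : k * P < k' * P + P) (h2 : k' * P < k * P + P) : k = k' := by
  have h3 : k * (P : ℤ) < (k' + 1) * P := by rw [add_mul]; omega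
  have h4 : k' * (P : ℤ) < (k + 1) * P := by rw [add_mul]; omega
  have h5 := lt_of_mul_lt_mul_right h3 (by omega)
  have h6 := lt_of_mul_lt_mul_right h4 (by omega)
  omega

/-- Since P ≥ N - 1, consecutive copies of [0, N - 1] meet in at most one point, so only intervals
of the same copy need comparison. Period N represents the polygon; period N - 1 is used for the
count. -/
theorem isPeriodicLaminar_linFamily (hD : IsDissection D) (hN : 2 ≤ N) (hP : N ≤ P + 1) (x : ℤ) :
    IsPeriodicLaminar P (linFamily D P x) where
  two_le := by
    intro u ℓ h
    exact (Finset.mem_filter.mp h).2.1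
  nested := by
    intro u ℓ u' ℓ' h h' h1 h2
    obtain ⟨k, r, rfl, hr, hr'⟩ := exists_block (P := P) x (by omega) u
    obtain ⟨k', r', rfl, hs, hs'⟩ := exists_block (P := P) x (by omega) u'
    rw [mem_linFamily hr hr'] at h
    rw [mem_linFamily hs hs'] at h'
    obtain rfl : k = k' := block_eq (P := P) (by omega) (by omega)
    obtain ⟨a1, a2, a3⟩ := h
    obtain ⟨b1, b2, b3⟩ := h'
    rcases a3 with a3 | a3
    · rcases b3 with b3 | b3
      · have hc := hD.not_cross _ a3 _ b3
        rw [cross_vtx_iff (by omega) (by omega) (by omega) (by omega) (by omega) (by omega)] at hc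
        omega
      · omega
    · omega
  periodic := by
    intro u
    have : (u + P - x) % P = (u - x) % P := by
      rw [show u + P - x = u - x + P by ring, Int.add_emod_right]
    simp only [linFamily, this]
  le := by
    intro u ℓ h
    have := Finset.mem_range.mp (Finset.mem_filter.mp h).1
    omega

theorem represents_linFamily (hD : IsDissection D) (hN : 2 ≤ N) :
    Represents (linFamily D N 0) D where
  laminar := isPeriodicLaminar_linFamily hD hN (by omega) 0
  lt := by
    intro u ℓ h
    exact Finset.mem_range.mp (Finset.mem_filter.mp h).1
  mem := by
    intro u ℓ h
    obtain ⟨k, r, rfl, hr, hr'⟩ := exists_block (P := N) 0 (by omega) u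
    rw [mem_linFamily hr hr'] at h
    rw [show (0 : ℤ) + k * N + r = r + k * N by ring,
      show (r + k * N + ℓ : ℤ) = r + ℓ + k * N by ring, vtx_add_mul, vtx_add_mul]
    exact h.2.2
  exists_mem := by
    intro d hd
    obtain ⟨r, ℓ, h1, h2, h3, rfl⟩ := (hD.isDiagonal d hd).exists_nat
    refine ⟨r, ℓ, ?_, rfl⟩
    have := mem_linFamily (D := D) (P := N) (x := 0) (k := 0) (r := r) (by omega) (by omega)
      (ℓ := ℓ)
    rw [zero_mul, zero_add, zero_add] at this
    rw [this]
    exact ⟨h1, by omega, Or.inl hd⟩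

theorem innerPts_linFamily (hN : 2 ≤ N) (hP : N ≤ P + 1) (x : ℤ) {r : ℤ}
    {ℓ : ℕ} (hr : 0 ≤ r) (hr' : r + ℓ + 1 ≤ N) (w : ℤ) :
    x + w ∈ innerPts (linFamily D P x) (x + r) ℓ ↔ (r < w ∧ w < r + ℓ) ∧
      ∀ r' ℓ' : ℕ, 2 ≤ ℓ' → r' + ℓ' + 1 ≤ N → s(vtx N r', vtx N (r' + ℓ')) ∈ D ∨ ℓ' + 1 = N →
        r' < w → w < r' + ℓ' → ℓ ≤ ℓ' := by
  rw [mem_innerPts]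
  rw [show (x + r < x + w ∧ x + w < x + r + ℓ) ↔ (r < w ∧ w < r + ℓ) by omega]
  refine and_congr_right fun hw => ⟨fun h => ?_, fun h => ?_⟩
  · intro r' ℓ' h1 h2 h3 h4 h5
    refine h (x + r') ℓ' ?_ (by omega) (by omega)
    have := mem_linFamily (D := D) (P := P) (x := x) (k := 0) (r := r') (by omega) (by omega)
      (ℓ := ℓ')
    rw [zero_mul, add_zero] at this
    rw [this]
    exact ⟨h1, by omega, h3⟩
  · intro u' ℓ' h' h1 h2
    obtain ⟨k, r', rfl, hs, hs'⟩ := exists_block (P := P) x (by omega) u'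
    rw [mem_linFamily hs hs'] at h'
    obtain rfl : k = 0 := block_eq (P := P) (by rw [zero_mul]; omega) (by rw [zero_mul]; omega)
    obtain ⟨s, rfl⟩ : ∃ s : ℕ, r' = s := ⟨r'.toNat, by omega⟩
    exact h s ℓ' h'.1 (by omega) h'.2.2 (by omega) (by omega)

theorem linFamily_add (hP : N ≤ P + 1) (x : ℤ) {r : ℤ} (hr : 0 ≤ r) (hr' : r + 1 < N) :
    linFamily D P x (x + r) = linFamily D N 0 r := by
  ext ℓ
  have h1 := mem_linFamily (D := D) (P := P) (x := x) (k := 0) hr (by omega) (ℓ := ℓ)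
  have h2 := mem_linFamily (D := D) (P := N) (x := 0) (k := 0) hr (by omega) (ℓ := ℓ)
  rw [zero_mul, add_zero] at h1
  rw [zero_mul, zero_add, zero_add] at h2
  rw [h1, h2]

theorem arityList_linFamily (hN : 2 ≤ N) (hP : N ≤ P + 1) (x : ℤ) {r : ℤ}
    (hr : 0 ≤ r) (hr' : r + 1 < N) :
    arityList (linFamily D P x) (x + r) = arityList (linFamily D N 0) r := by
  rw [arityList, arityList, linFamily_add hP x hr hr']
  refine List.map_congr_left fun ℓ hℓ => ?_
  rw [Finset.mem_sort] at hℓ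
  have h2 := mem_linFamily (D := D) (P := N) (x := 0) (k := 0) hr (by omega) (ℓ := ℓ)
  rw [zero_mul, zero_add, zero_add] at h2
  have h3 := (h2.mp hℓ).2.1
  have key := fun w => (innerPts_linFamily (D := D) hN hP x hr h3 w).trans
    (innerPts_linFamily hN (show N ≤ N + 1 by omega) 0 hr h3 w).symm
  simp only [zero_add] at key
  rw [arity, arity]
  refine (Finset.card_bij (fun w _ => x + w) (fun w hw => (key w).mpr hw)
    (fun w _ z _ h => by omega) fun z hz => ⟨z - x, ?_, by omega⟩).symm
  rw [← key, add_sub_cancel]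
  exact hz

/-- The numbers of vertices, minus two, of the cells of a dissection. -/
noncomputable def cellType (D : Finset (Sym2 (Fin N))) : Multiset ℕ :=
  arityType N (linFamily D N 0)

/-- No interval starts at the last vertex N - 1, so shortening the period from N to N - 1 drops only
an empty list, and the position x does not matter. -/
theorem arityType_linFamily (hD : IsDissection D) (hN : 2 ≤ N) (x : ℤ) :
    arityType (N - 1) (linFamily D (N - 1) x) = cellType D := by
  have hV := isPeriodicLaminar_linFamily hD hN (P := N - 1) (by omega) x
  rw [cellType, arityType, arityType]
  obtain ⟨M, hM⟩ : ∃ M, N = M + 1 := ⟨N - 1, by omega⟩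
  have hlast : arityList (linFamily D N 0) (M : ℤ) = [] := by
    have : linFamily D N 0 (M : ℤ) = ∅ := by
      refine Finset.eq_empty_of_forall_notMem fun ℓ hℓ => ?_
      have h2 := mem_linFamily (D := D) (P := N) (x := 0) (k := 0) (r := M) (by omega) (by omega)
        (ℓ := ℓ)
      rw [zero_mul, zero_add, zero_add] at h2
      have := h2.mp hℓ
      omega
    rw [arityList, this, Finset.sort_empty, List.map_nil]
  have hR : ∑ i ∈ Finset.range N, (arityList (linFamily D N 0) i : Multiset ℕ) =
      ∑ i ∈ Finset.range (N - 1), (arityList (linFamily D N 0) i : Multiset ℕ) := by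
    rw [show Finset.range N = Finset.range (N - 1 + 1) by rw [Nat.sub_add_cancel (by omega)],
      Finset.sum_range_succ, show N - 1 = M by omega, hlast]
    simp
  rw [hR, ← sum_Ico_of_periodic (F := fun u => (arityList (linFamily D (N - 1) x) u : Multiset ℕ))
    (fun u => by rw [hV.arityList_periodic]) x]
  refine (Finset.sum_bij (fun (i : ℕ) _ => x + i) ?_ ?_ ?_ ?_).symm
  · intro i hi
    rw [Finset.mem_range] at hi
    rw [Finset.mem_Ico]
    omega
  · intro i _ j _ h
    omega
  · intro w hw
    rw [Finset.mem_Ico] at hw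
    exact ⟨(w - x).toNat, Finset.mem_range.mpr (by omega), by omega⟩
  · intro i hi
    rw [Finset.mem_range] at hi
    rw [arityList_linFamily hN (by omega) x (by omega) (by omega)]

/-- The side joining the last vertex to the first covers all others, so the outer region degenerates
to a segment and every true cell lies under an interval. -/
theorem card_outerCell_linFamily (hD : IsDissection D) (hN : 3 ≤ N) :
    (outerCell N (linFamily D N 0)).card = 2 := by
  have hR := represents_linFamily hD (by omega)
  have hroot : N - 1 ∈ linFamily D N 0 0 := by
    have h2 := mem_linFamily (D := D) (P := N) (x := 0) (k := 0) (r := 0) (by omega) (by omega)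
      (ℓ := N - 1)
    rw [zero_mul, zero_add, zero_add] at h2
    rw [h2]
    exact ⟨by omega, by omega, Or.inr (by omega)⟩
  have hcov : ∀ w : ℤ, Covered (linFamily D N 0) w → w ≠ 0 ∧ w + 1 ≠ N := by
    rintro w ⟨u, ℓ, h, h1, h2⟩
    obtain ⟨k, r, rfl, hr, hr'⟩ := exists_block (P := N) 0 (by omega) u
    rw [mem_linFamily hr hr'] at h
    constructor
    · rintro rfl
      have h3 : k * (N : ℤ) < 0 * N := by omega
      have h4 : (-1) * (N : ℤ) < k * N := by omega
      have h5 := lt_of_mul_lt_mul_right h3 (by omega)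
      have h6 := lt_of_mul_lt_mul_right h4 (by omega)
      omega
    · intro hw
      have h3 : k * (N : ℤ) < 1 * N := by omega
      have h4 : 0 * (N : ℤ) < k * N := by omega
      have h5 := lt_of_mul_lt_mul_right h3 (by omega)
      have h6 := lt_of_mul_lt_mul_right h4 (by omega)
      omega
  have hset : outerCell N (linFamily D N 0) = {vtx N 0, vtx N ((N - 1 : ℕ) : ℤ)} := by
    ext v
    obtain ⟨w, h1, h2, rfl⟩ := exists_lift 0 v
    rw [hR.mem_outerCell, Finset.mem_insert, Finset.mem_singleton]
    constructor
    · intro h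
      by_contra hcon
      push Not at hcon
      refine h ⟨0, N - 1, hroot, ?_, ?_⟩
      · exact lt_of_le_of_ne h1 fun h => hcon.1 (by rw [h])
      · have : w ≠ (N - 1 : ℕ) := fun h => hcon.2 (by rw [h])
        omega
    · rintro (h | h) hc
      · have := vtx_injOn 0 h1 h2 (by omega) (by omega) h
        exact (hcov w hc).1 this
      · have := vtx_injOn 0 h1 h2 (by omega) (by omega) h
        exact (hcov w hc).2 (by omega)
  rw [hset, Finset.card_pair]
  intro h
  have := vtx_injOn 0 (by omega) (by omega) (by omega) (by omega) h
  omega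

theorem sum_cells_eq (hD : IsDissection D) (hN : 3 ≤ N) (F : ℕ → ℕ) :
    ∑ Q ∈ cells D, F Q.card = ((cellType D).map fun j => F (j + 2)).sum := by
  rw [(represents_linFamily hD (by omega)).sum_cells, card_outerCell_linFamily hD hN,
    if_neg (by omega), add_zero]
  rfl

theorem sum_cellType (hD : IsDissection D) (hN : 3 ≤ N) : (cellType D).sum + 2 = N := by
  have := (represents_linFamily hD (by omega)).card_outerCell_add
  rw [card_outerCell_linFamily hD hN] at this
  rw [cellType]
  omega

theorem pos_of_mem_arityType {V : ℤ → Finset ℕ} (hV : IsLaminar V) {m : ℕ} :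
    ∀ a ∈ arityType m V, 0 < a := by
  intro a ha
  rw [arityType, Multiset.mem_sum] at ha
  obtain ⟨i, -, hi⟩ := ha
  exact hV.pos_of_mem_arityList i a hi

theorem pos_of_mem_cellType (hD : IsDissection D) (hN : 2 ≤ N) : ∀ a ∈ cellType D, 0 < a :=
  pos_of_mem_arityType (represents_linFamily hD hN).laminar.toIsLaminar

theorem card_filter_cells (hD : IsDissection D) (hN : 3 ≤ N) (k : ℕ) :
    ((cells D).filter fun Q => Q.card = k + 2).card = (cellType D).count k := by
  have h := sum_cells_eq hD hN fun c => if c = k + 2 then 1 else 0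
  rw [← Finset.card_filter] at h
  rw [h, Multiset.count, Multiset.countP_eq_card_filter]
  simp only [Nat.add_right_cancel_iff]
  induction cellType D using Multiset.induction_on with
  | empty => rfl
  | cons a s ih =>
    rw [Multiset.map_cons, Multiset.sum_cons, ih]
    by_cases h : a = k
    · rw [if_pos h, Multiset.filter_cons_of_pos _ h.symm, Multiset.card_cons, add_comm]
    · rw [if_neg h, Multiset.filter_cons_of_neg _ (Ne.symm h), zero_add]

end TypeA

namespace TypeA

/-! ### Counting dissections -/

variable {N : ℕ} [NeZero N] {D : Finset (Sym2 (Fin N))}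

theorem mem_linFamily_root_iff {P : ℕ} (hP : N = P + 1) (hN : 3 ≤ N) (x u : ℤ) :
    P ∈ linFamily D P x u ↔ ∃ k : ℤ, u = x + k * P := by
  obtain ⟨k, r, rfl, hr, hr'⟩ := exists_block (P := P) x (by omega) u
  rw [mem_linFamily hr hr']
  constructor
  · intro h
    exact ⟨k, by omega⟩
  · rintro ⟨k', hk⟩
    obtain rfl : k = k' := block_eq (P := P) (by omega) (by omega)
    exact ⟨by omega, by omega, Or.inr hP.symm⟩

theorem mem_linFamily_nat_iff {P : ℕ} (hP : N = P + 1) (x : ℤ) {r ℓ : ℕ}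
    (h1 : 2 ≤ ℓ) (h2 : r + ℓ < N) (h3 : ℓ + 2 ≤ N) :
    ℓ ∈ linFamily D P x (x + r) ↔ s(vtx N r, vtx N (r + ℓ : ℤ)) ∈ D := by
  have h := mem_linFamily (D := D) (P := P) (x := x) (k := 0) (r := r) (by omega) (by omega) (ℓ := ℓ)
  rw [zero_mul, add_zero] at h
  rw [h]
  exact ⟨fun h => h.2.2.resolve_right (by omega), fun h => ⟨h1, by omega, Or.inl h⟩⟩

/-- The intervals of full length P mark the multiples of the period from x, so the starting point
can be read off; the diagonals are then the shorter intervals. -/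
theorem linFamily_injective {P : ℕ} (hP : N = P + 1) (hN : 3 ≤ N) {D' : Finset (Sym2 (Fin N))}
    (hD : IsDissection D) (hD' : IsDissection D') {x x' : ℤ} (hx : 0 ≤ x) (hx2 : x < P)
    (hx' : 0 ≤ x') (hx2' : x' < P) (h : linFamily D P x = linFamily D' P x') : x = x' ∧ D = D' := by
  have h1 : P ∈ linFamily D P x x := (mem_linFamily_root_iff hP hN x x).mpr ⟨0, by simp⟩
  rw [h, mem_linFamily_root_iff hP hN] at h1
  obtain ⟨k, hk⟩ := h1
  obtain rfl : k = 0 := block_eq (P := P) (by rw [zero_mul]; omega) (by rw [zero_mul]; omega)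
  obtain rfl : x = x' := by omega
  have key : ∀ {r ℓ : ℕ}, 2 ≤ ℓ → r + ℓ < N → ℓ + 2 ≤ N →
      (s(vtx N r, vtx N (r + ℓ : ℤ)) ∈ D ↔ s(vtx N r, vtx N (r + ℓ : ℤ)) ∈ D') := by
    intro r ℓ h1 h2 h3
    rw [← mem_linFamily_nat_iff hP x h1 h2 h3, ← mem_linFamily_nat_iff hP x h1 h2 h3, h]
  refine ⟨rfl, Finset.ext fun d => ⟨fun hd => ?_, fun hd => ?_⟩⟩
  · obtain ⟨r, ℓ, h1, h2, h3, rfl⟩ := (hD.isDiagonal d hd).exists_nat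
    exact (key h1 h2 h3).mp hd
  · obtain ⟨r, ℓ, h1, h2, h3, rfl⟩ := (hD'.isDiagonal d hd).exists_nat
    exact (key h1 h2 h3).mpr hd

/-- A family which covers all the interior points of a period contains the whole period. -/
theorem _root_.IsPeriodicLaminar.exists_root {P : ℕ} {V : ℤ → Finset ℕ}
    (hV : IsPeriodicLaminar P V) (hP : 2 ≤ P) (h : (arityType P V).sum + 1 = P) :
    ∃ x : ℤ, 0 ≤ x ∧ x < P ∧ P ∈ V x := by
  classical
  have hc := hV.card_covered
  have h1 : ((Finset.range P).filter fun i : ℕ => ¬ Covered V i).card = 1 := by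
    have := Finset.card_filter_add_card_filter_not (s := Finset.range P) fun i : ℕ => Covered V i
    rw [Finset.card_range] at this
    omega
  obtain ⟨x, hx⟩ := Finset.card_eq_one.mp h1
  have hx1 : x < P ∧ ¬ Covered V x := by
    have : x ∈ (Finset.range P).filter fun i : ℕ => ¬ Covered V i := by
      rw [hx]; exact Finset.mem_singleton_self x
    rwa [Finset.mem_filter, Finset.mem_range] at this
  have hx2 : ∀ i : ℤ, x < i → i < x + P → Covered V i := by
    intro i hi hi'
    by_contra hcon
    have key : ∀ j : ℕ, j < P → ¬ Covered V j → j = x := by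
      intro j hj hj'
      have : j ∈ (Finset.range P).filter fun i : ℕ => ¬ Covered V i :=
        Finset.mem_filter.mpr ⟨Finset.mem_range.mpr hj, hj'⟩
      rwa [hx, Finset.mem_singleton] at this
    rcases lt_or_ge i P with hlt | hge
    · obtain ⟨j, rfl⟩ : ∃ j : ℕ, i = j := ⟨i.toNat, by omega⟩
      have := key j (by omega) hcon
      omega
    · obtain ⟨j, hj⟩ : ∃ j : ℕ, i = j + P := ⟨(i - P).toNat, by omega⟩
      rw [hj, hV.covered_periodic] at hcon
      have := key j (by omega) hcon
      omega
  obtain ⟨u, ℓ, hℓ, h2, h3⟩ := hx2 (x + 1) (by omega) (by omega)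
  obtain rfl : u = x := by
    rcases (show u < x ∨ u = x by omega) with h | h
    · exact absurd ⟨u, ℓ, hℓ, h, by omega⟩ hx1.2
    · exact h
  -- Take the longest interval starting at the unique uncovered point x of the period. If it were
  -- shorter than P, its right end would be covered, and the covering interval would contradict the
  -- choice of x, maximality or laminarity.
  have hne : (V x).Nonempty := ⟨ℓ, hℓ⟩
  have hm := (V x).max'_mem hne
  have hmax : ∀ q ∈ V x, q ≤ (V x).max' hne := fun q hq => (V x).le_max' q hq
  generalize (V x).max' hne = q at hm hmax
  have hq2 := hV.two_le hm
  have hqP := hV.le hm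
  refine ⟨x, by omega, by omega, ?_⟩
  rcases hqP.lt_or_eq with hlt | rfl
  · exfalso
    obtain ⟨u, k, hk, h4, h5⟩ := hx2 (x + q) (by omega) (by omega)
    rcases lt_trichotomy u x with h6 | rfl | h6
    · exact hx1.2 ⟨u, k, hk, h6, by omega⟩
    · have := hmax k hk
      omega
    · have := hV.nested hm hk h6 h4
      omega
  · exact hm

open Classical in
/-- The dissection attached to a family of intervals of `[x, x + N - 1]`. -/
noncomputable def dissectionOf (N : ℕ) (V : ℤ → Finset ℕ) (x : ℤ) : Finset (Sym2 (Fin N)) :=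
  Finset.univ.filter fun d => ∃ (a b : Fin N) (ℓ : ℕ), d = s(a, b) ∧ b.val = a.val + ℓ ∧
    ℓ + 2 ≤ N ∧ ℓ ∈ V (x + a.val)

theorem mem_dissectionOf {N : ℕ} {V : ℤ → Finset ℕ} {x : ℤ} {d : Sym2 (Fin N)} :
    d ∈ dissectionOf N V x ↔ ∃ (a b : Fin N) (ℓ : ℕ), d = s(a, b) ∧ b.val = a.val + ℓ ∧
      ℓ + 2 ≤ N ∧ ℓ ∈ V (x + a.val) := by
  simp only [dissectionOf, Finset.mem_filter, Finset.mem_univ, true_and]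

theorem isDissection_dissectionOf {V : ℤ → Finset ℕ} (hV : IsLaminar V) (x : ℤ) :
    IsDissection (dissectionOf N V x) where
  isDiagonal := by
    intro d hd
    obtain ⟨a, b, ℓ, rfl, hb, h1, h2⟩ := mem_dissectionOf.mp hd
    have := hV.two_le h2
    rw [← vtx_natCast a, ← vtx_natCast b, isDiagonal_vtx_iff (by omega) (by have := b.2; omega)]
    omega
  not_cross := by
    have key : ∀ p q y z : Fin N, p < y → y < q → q < z → s(p, q) ∈ dissectionOf N V x →
        s(y, z) ∈ dissectionOf N V x → False := by
      intro p q y z h1 h2 h3 h4 h5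
      obtain ⟨a, b, ℓ, e, hb, -, hm⟩ := mem_dissectionOf.mp h4
      obtain ⟨a', b', ℓ', e', hb', -, hm'⟩ := mem_dissectionOf.mp h5
      rw [Fin.lt_def] at h1 h2 h3
      have hab : a.val = p.val ∧ b.val = q.val := by
        rcases Sym2.eq_iff.mp e with ⟨rfl, rfl⟩ | ⟨rfl, rfl⟩
        · exact ⟨rfl, rfl⟩
        · omega
      have hab' : a'.val = y.val ∧ b'.val = z.val := by
        rcases Sym2.eq_iff.mp e' with ⟨rfl, rfl⟩ | ⟨rfl, rfl⟩
        · exact ⟨rfl, rfl⟩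
        · omega
      have := hV.nested hm hm' (by omega) (by omega)
      omega
    rintro d hd e he ⟨p, y, q, z, h1, h2, h3, ⟨rfl, rfl⟩ | ⟨rfl, rfl⟩⟩
    · exact key p q y z h1 h2 h3 hd he
    · exact key p q y z h1 h2 h3 he hd

theorem linFamily_dissectionOf {P : ℕ} {V : ℤ → Finset ℕ} (hP : N = P + 1) (hN : 3 ≤ N)
    (hV : IsPeriodicLaminar P V) {x : ℤ} (hx : P ∈ V x) :
    linFamily (dissectionOf N V x) P x = V := by
  funext u
  ext ℓ
  obtain ⟨k, r, rfl, hr, hr'⟩ := exists_block (P := P) x (by omega) u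
  rw [mem_linFamily hr hr', show x + k * P + r = x + r + k * P by ring,
    periodic_mul hV.periodic]
  obtain ⟨s, rfl⟩ : ∃ s : ℕ, r = s := ⟨r.toNat, by omega⟩
  constructor
  · rintro ⟨h1, h2, h3 | h3⟩
    · obtain ⟨a, b, ℓ', e, hb, h4, h5⟩ := mem_dissectionOf.mp h3
      have hbN := b.2
      rw [← vtx_natCast a, ← vtx_natCast b] at e
      rcases Sym2.eq_iff.mp e with ⟨e1, e2⟩ | ⟨e1, e2⟩
      · have e1 := vtx_injOn 0 (by omega) (by omega) (by omega) (by omega) e1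
        have e2 := vtx_injOn 0 (by omega) (by omega) (by omega) (by omega) e2
        obtain rfl : ℓ = ℓ' := by omega
        rwa [e1]
      · have e1 := vtx_injOn 0 (by omega) (by omega) (by omega) (by omega) e1
        have e2 := vtx_injOn 0 (by omega) (by omega) (by omega) (by omega) e2
        omega
    · obtain rfl : ℓ = P := by omega
      obtain rfl : s = 0 := by omega
      simpa using hx
  · intro h
    have h1 := hV.two_le h
    have h2 := hV.le h
    have h3 : s + ℓ ≤ P := by
      rcases Nat.eq_zero_or_pos s with rfl | hs
      · omega
      · have := hV.nested hx h (by omega) (by omega)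
        omega
    refine ⟨h1, by omega, ?_⟩
    by_cases h4 : ℓ + 1 = N
    · exact Or.inr h4
    · left
      refine mem_dissectionOf.mpr ⟨⟨s, by omega⟩, ⟨s + ℓ, by omega⟩, ℓ, ?_, rfl, by omega, h⟩
      rw [← vtx_natCast (N := N) ⟨s, by omega⟩, ← vtx_natCast (N := N) ⟨s + ℓ, by omega⟩]
      push_cast
      rfl

/-- The number of dissections of a polygon whose cells have given sizes. -/
theorem card_dissections_mul (hN : 3 ≤ N) (s : Finset ℕ) (κ : Multiset ℕ) (hs : ∀ a ∈ κ, a ∈ s)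
    (hpos : ∀ a ∈ κ, 0 < a) (hκ : κ.sum + 2 = N) :
    Nat.card {D : Finset (Sym2 (Fin N)) // IsDissection D ∧ cellType D = κ} *
      ((N - 1).factorial * ∏ a ∈ s, (κ.count a).factorial) = (N - 2 + κ.card).factorial := by
  obtain ⟨P, hP⟩ : ∃ P, N = P + 1 := ⟨N - 1, by omega⟩
  have hP' : N - 1 = P := by omega
  -- A cycle lemma argument: each dissection is laid out from P starting points, and the resulting
  -- factor P turns (P - 1)! into the P! of the formula.
  let f : Fin P × {D : Finset (Sym2 (Fin N)) // IsDissection D ∧ cellType D = κ} →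
      {V : ℤ → Finset ℕ // IsPeriodicLaminar P V ∧ arityType P V = κ} := fun y =>
    ⟨linFamily y.2.1 P (y.1.val : ℤ),
      isPeriodicLaminar_linFamily y.2.2.1 (by omega) (by omega) _, by
        have := arityType_linFamily y.2.2.1 (by omega) (y.1.val : ℤ)
        rw [hP'] at this
        rw [this, y.2.2.2]⟩
  have hf : Function.Bijective f := by
    constructor
    · rintro ⟨x, D, hD, hκ⟩ ⟨x', D', hD', hκ'⟩ h
      obtain ⟨h1, h2⟩ := linFamily_injective hP hN hD hD' (by omega) (by have := x.2; omega)
        (by omega) (by have := x'.2; omega) (congrArg Subtype.val h)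
      obtain rfl : x = x' := Fin.ext (by exact_mod_cast h1)
      subst h2
      rfl
    · rintro ⟨V, hV, hVκ⟩
      obtain ⟨x, hx, hx', hPx⟩ := hV.exists_root (by omega) (by rw [hVκ]; omega)
      obtain ⟨y, rfl⟩ : ∃ y : ℕ, x = y := ⟨x.toNat, by omega⟩
      have hlin := linFamily_dissectionOf hP hN hV hPx
      have hdis := isDissection_dissectionOf (N := N) hV.toIsLaminar (y : ℤ)
      refine ⟨⟨⟨y, by omega⟩, dissectionOf N V y, hdis, ?_⟩, Subtype.ext hlin⟩
      have := arityType_linFamily hdis (by omega) (y : ℤ)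
      rw [hP', hlin, hVκ] at this
      exact this.symm
  have hcard := Nat.card_congr (Equiv.ofBijective f hf)
  rw [Nat.card_prod, Nat.card_eq_fintype_card, Fintype.card_fin] at hcard
  have h := (card_periodicLaminar_mul s P κ hs hpos (by omega)).2
  rw [← hcard] at h
  rw [hP', show N - 2 = P - 1 by omega, ← h, ← Nat.mul_factorial_pred (show P ≠ 0 by omega)]
  ring

end TypeA

/-! ### Dissections that are invariant under a rotation -/

theorem IsPeriodicLaminar.mul {m : ℕ} {V : ℤ → Finset ℕ} (hV : IsPeriodicLaminar m V) {d : ℕ}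
    (hd : 1 ≤ d) : IsPeriodicLaminar (d * m) V where
  two_le := hV.two_le
  nested := hV.nested
  periodic := fun u => by
    have := periodic_mul hV.periodic u d
    rwa [← Nat.cast_mul] at this
  le := fun h => (hV.le h).trans (Nat.le_mul_of_pos_left m hd)

theorem IsPeriodicLaminar.arityType_mul {m : ℕ} {V : ℤ → Finset ℕ} (hV : IsPeriodicLaminar m V)
    (d : ℕ) : arityType (d * m) V = d • arityType m V := by
  induction d with
  | zero => simp [arityType]
  | succ d ih =>
    rw [add_mul, one_mul, succ_nsmul, ← ih, arityType, Finset.sum_range_add]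
    refine congrArg₂ _ rfl (Finset.sum_congr rfl fun i _ => ?_)
    have := periodic_mul hV.arityList_periodic i d
    rw [← this]
    push_cast
    rw [add_comm]

namespace TypeA

variable {N : ℕ} [NeZero N] {D : Finset (Sym2 (Fin N))}

open Classical in
/-- The diagonals of a dissection which is invariant under the rotation by `m` as intervals of
length at most `m`. -/
noncomputable def symFamily (D : Finset (Sym2 (Fin N))) (m : ℕ) (u : ℤ) : Finset ℕ :=
  (Finset.range (m + 1)).filter fun ℓ => 2 ≤ ℓ ∧ s(vtx N u, vtx N (u + ℓ)) ∈ D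

theorem mem_symFamily {m : ℕ} {u : ℤ} {ℓ : ℕ} :
    ℓ ∈ symFamily D m u ↔ ℓ ≤ m ∧ 2 ≤ ℓ ∧ s(vtx N u, vtx N (u + ℓ)) ∈ D := by
  simp only [symFamily, Finset.mem_filter, Finset.mem_range, Nat.lt_succ_iff]

/-- Invariance under the rotation by `m`. -/
def IsInvariant (m : ℕ) (D : Finset (Sym2 (Fin N))) : Prop :=
  ∀ d, d.map (fun v => v + vtx N m) ∈ D ↔ d ∈ D

theorem IsInvariant.mem_add {m : ℕ} (h : IsInvariant m D) (u v : ℤ) :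
    s(vtx N (u + m), vtx N (v + m)) ∈ D ↔ s(vtx N u, vtx N v) ∈ D := by
  rw [← h s(vtx N u, vtx N v), Sym2.map_mk, ← vtx_add, ← vtx_add]

theorem isPeriodicLaminar_symFamily {m : ℕ} (hD : IsDissection D) (hi : IsInvariant m D)
    (hm : 2 * m ≤ N) : IsPeriodicLaminar m (symFamily D m) where
  two_le := fun h => (mem_symFamily.mp h).2.1
  nested := by
    intro u ℓ u' ℓ' h h' h1 h2
    rw [mem_symFamily] at h h'
    have hc := hD.not_cross _ h.2.2 _ h'.2.2
    rw [cross_vtx_iff (by omega) (by omega) (by omega) (by omega) (by omega) (by omega)] at hc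
    omega
  periodic := by
    intro u
    ext ℓ
    rw [mem_symFamily, mem_symFamily, show u + m + ℓ = u + ℓ + m by ring, hi.mem_add]
  le := fun h => (mem_symFamily.mp h).1

theorem represents_symFamily {m d : ℕ} (hD : IsDissection D) (hi : IsInvariant m D)
    (hd : 2 ≤ d) (hN : N = d * m) : Represents (symFamily D m) D := by
  have h0 : 0 < N := NeZero.pos N
  have hm : 2 * m ≤ N := hN ▸ Nat.mul_le_mul_right m hd
  have hm0 : 0 < m := by
    rcases Nat.eq_zero_or_pos m with rfl | h
    · omega
    · exact h
  have hV := (isPeriodicLaminar_symFamily hD hi hm).mul (d := d) (by omega)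
  rw [← hN] at hV
  refine ⟨hV, ?_, ?_, ?_⟩
  · intro u ℓ h
    have := (mem_symFamily.mp h).1
    omega
  · intro u ℓ h
    exact Or.inl (mem_symFamily.mp h).2.2
  · intro e he
    obtain ⟨r, ℓ, h1, h2, h3, rfl⟩ := (hD.isDiagonal e he).exists_nat
    by_cases h4 : ℓ ≤ m
    · exact ⟨r, ℓ, mem_symFamily.mpr ⟨h4, h1, he⟩, rfl⟩
    -- If both arcs of the chord were longer than m, it would cross its own rotation by m. So one of
    -- its two arcs has length at most m.
    · have h5 : N ≤ ℓ + m := by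
        by_contra h5
        refine hD.not_cross _ he _ ((hi.mem_add r (r + ℓ)).mpr he) ?_
        rw [cross_vtx_iff (by omega) (by omega) (by omega) (by omega) (by omega) (by omega)]
        omega
      have e1 : vtx N ((r : ℤ) + ℓ + (N - ℓ : ℕ)) = vtx N r := vtx_eq_iff.mpr ⟨-1, by omega⟩
      refine ⟨r + ℓ, N - ℓ, mem_symFamily.mpr ⟨by omega, by omega, ?_⟩, ?_⟩
      · rw [e1, Sym2.eq_swap]
        exact he
      · rw [e1, Sym2.eq_swap]

theorem symFamily_injective {m d : ℕ} {D' : Finset (Sym2 (Fin N))} (hD : IsDissection D)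
    (hi : IsInvariant m D) (hD' : IsDissection D') (hi' : IsInvariant m D') (hd : 2 ≤ d)
    (hN : N = d * m) (h : symFamily D m = symFamily D' m) : D = D' := by
  have hR := represents_symFamily hD hi hd hN
  have hR' := represents_symFamily hD' hi' hd hN
  refine Finset.ext fun e => ⟨fun he => ?_, fun he => ?_⟩
  · obtain ⟨u, ℓ, hℓ, rfl⟩ := hR.exists_mem e he
    rw [h] at hℓ
    exact (mem_symFamily.mp hℓ).2.2
  · obtain ⟨u, ℓ, hℓ, rfl⟩ := hR'.exists_mem e he
    rw [← h] at hℓ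
    exact (mem_symFamily.mp hℓ).2.2

open Classical in
/-- The chords attached to a periodic family of intervals. -/
noncomputable def chordsOf (N : ℕ) [NeZero N] (V : ℤ → Finset ℕ) : Finset (Sym2 (Fin N)) :=
  Finset.univ.filter fun d => ∃ u : ℤ, ∃ ℓ : ℕ, ℓ ∈ V u ∧ d = s(vtx N u, vtx N (u + ℓ))

theorem mem_chordsOf {V : ℤ → Finset ℕ} {d : Sym2 (Fin N)} :
    d ∈ chordsOf N V ↔ ∃ u : ℤ, ∃ ℓ : ℕ, ℓ ∈ V u ∧ d = s(vtx N u, vtx N (u + ℓ)) := by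
  simp only [chordsOf, Finset.mem_filter, Finset.mem_univ, true_and]

/-! ### From periodic families of intervals to invariant dissections. -/

section

variable {m d : ℕ} {V : ℤ → Finset ℕ}

theorem isDissection_chordsOf (hV : IsPeriodicLaminar m V) (hd : 2 ≤ d)
    (hN : N = d * m) (hN3 : 3 ≤ N) : IsDissection (chordsOf N V) where
  isDiagonal := by
    intro e he
    obtain ⟨u, ℓ, h, rfl⟩ := mem_chordsOf.mp he
    have h1 := hV.two_le h
    have h2 := hV.le h
    have hm : 2 * m ≤ N := hN ▸ Nat.mul_le_mul_right m hd
    rw [isDiagonal_vtx_iff (by omega) (by omega)]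
    omega
  not_cross := by
    intro e he e' he' hc
    have hm : 2 * m ≤ N := hN ▸ Nat.mul_le_mul_right m hd
    have hVN := hV.mul (d := d) (by omega)
    rw [← hN] at hVN
    obtain ⟨u, ℓ, h, rfl⟩ := mem_chordsOf.mp he
    obtain ⟨u', ℓ', h', rfl⟩ := mem_chordsOf.mp he'
    obtain ⟨x, hx, hx', hxe⟩ := exists_lift u (vtx N u')
    obtain ⟨k, hk⟩ := vtx_eq_iff.mp hxe
    have h1 := hV.two_le h
    have h2 := hV.le h
    have h3 := hV.two_le h'
    have h4 := hV.le h'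
    have hx'' : ℓ' ∈ V x := by
      rw [hk, periodic_mul hVN.periodic] at h'
      exact h'
    rw [hk, show x + k * N + ℓ' = x + ℓ' + k * N by ring, vtx_add_mul, vtx_add_mul] at hc
    rcases lt_or_ge (x + ℓ') (u + N) with h5 | h5
    · rw [cross_vtx_iff (by omega) (by omega) (by omega) (by omega) (by omega) (by omega)] at hc
      rcases hc with hc | hc
      · have := hV.nested h hx'' hc.1 hc.2.1
        omega
      · omega
    -- The second chord wraps past u + N. Shifted back by N, it starts before u, and laminarity is
    -- applied with the two intervals exchanged.
    · rw [show x + ℓ' = x + ℓ' - N + 1 * N by ring, vtx_add_mul,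
        cross_vtx_iff (by omega) (by omega) (by omega) (by omega) (by omega) (by omega)] at hc
      rcases hc with hc | hc
      · omega
      · have h6 : ℓ' ∈ V (x - N) := by
          rw [← hVN.periodic, sub_add_cancel]
          exact hx''
        have := hV.nested h6 h (by omega) (by omega)
        omega

theorem isInvariant_chordsOf (hV : IsPeriodicLaminar m V) (hd : 2 ≤ d)
    (hN : N = d * m) : IsInvariant m (chordsOf N V) := by
  intro e
  have key : ∀ e : Sym2 (Fin N), e ∈ chordsOf N V → e.map (fun v => v + vtx N m) ∈ chordsOf N V := by
    intro e he
    obtain ⟨u, ℓ, h, rfl⟩ := mem_chordsOf.mp he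
    refine mem_chordsOf.mpr ⟨u + m, ℓ, by rwa [hV.periodic], ?_⟩
    rw [Sym2.map_mk, ← vtx_add, ← vtx_add]
    rw [add_right_comm]
  refine ⟨fun h => ?_, key e⟩
  -- Rotating d - 1 more times completes a full turn, which recovers e itself.
  have hiter : ∀ j : ℕ, e.map (fun v => v + vtx N ((j + 1 : ℕ) * m : ℤ)) ∈ chordsOf N V := by
    intro j
    induction j with
    | zero => simpa using h
    | succ j ih =>
      have := key _ ih
      rw [Sym2.map_map] at this
      convert this using 3 with v
      rw [Function.comp_apply, add_assoc v, ← vtx_add]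
      congr 2
      push_cast
      ring
  have h1 := hiter (d - 1)
  rw [Nat.sub_add_cancel (by omega), ← Nat.cast_mul, ← hN] at h1
  have h0 : vtx N (N : ℤ) = 0 := by
    have := vtx_add_mul (N := N) 0 1
    rw [one_mul, zero_add] at this
    rw [this]
    exact vtx_natCast (N := N) 0
  simpa [h0] using h1

theorem symFamily_chordsOf (hV : IsPeriodicLaminar m V) (hd : 2 ≤ d)
    (hN : N = d * m) : symFamily (chordsOf N V) m = V := by
  have hm : 2 * m ≤ N := hN ▸ Nat.mul_le_mul_right m hd
  have hVN := hV.mul (d := d) (by omega)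
  rw [← hN] at hVN
  funext u
  ext ℓ
  rw [mem_symFamily, mem_chordsOf]
  constructor
  · rintro ⟨h1, h2, p, q, hq, he⟩
    have h3 := hV.two_le hq
    have h4 := hV.le hq
    rcases Sym2.eq_iff.mp he with ⟨e1, e2⟩ | ⟨e1, e2⟩
    · obtain ⟨k, hk⟩ := vtx_eq_iff.mp e1
      obtain ⟨k', hk'⟩ := vtx_eq_iff.mp e2
      obtain rfl : k = k' := TypeA.block_eq (P := N) (by omega) (by omega)
      obtain rfl : ℓ = q := by omega
      rwa [hk, periodic_mul hVN.periodic] at hq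
    · obtain ⟨k, hk⟩ := vtx_eq_iff.mp e1
      obtain ⟨k', hk'⟩ := vtx_eq_iff.mp e2
      obtain ⟨j, rfl⟩ : ∃ j, k = k' + j := ⟨k - k', by ring⟩
      rw [add_mul] at hk
      -- The chord is matched with its ends exchanged, so the two lengths add up to N. Both are at
      -- most m ≤ N/2, hence both equal m: the chord is a diameter, and periodicity identifies its
      -- two lifts.
      have hj : j = 1 := by
        refine block_eq (P := N) ?_ ?_ <;> rw [one_mul] <;> omega
      subst hj
      have h5 : ℓ = q := by omega
      have h6 : q = m := by omega
      have h7 : p = u + m + k' * N := by omega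
      rw [h7, periodic_mul hVN.periodic, hV.periodic] at hq
      rwa [h5]
  · intro h
    exact ⟨hV.le h, hV.two_le h, u, ℓ, h, rfl⟩

end

/-- The number of invariant dissections with a given type of orbits of cells. -/
theorem card_invariant_dissections_mul {m d : ℕ} (hd : 2 ≤ d) (hN : N = d * m) (hN3 : 3 ≤ N)
    (s : Finset ℕ) (κ : Multiset ℕ) (hs : ∀ a ∈ κ, a ∈ s) (hpos : ∀ a ∈ κ, 0 < a)
    (hκ : κ.sum < m) :
    Nat.card {D : Finset (Sym2 (Fin N)) //
        (IsDissection D ∧ IsInvariant m D) ∧ arityType m (symFamily D m) = κ} *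
      ((m - 1).factorial * ∏ a ∈ s, (κ.count a).factorial) = (m - 1 + κ.card).factorial := by
  have hm : 2 * m ≤ N := hN ▸ Nat.mul_le_mul_right m hd
  let f : {D : Finset (Sym2 (Fin N)) //
        (IsDissection D ∧ IsInvariant m D) ∧ arityType m (symFamily D m) = κ} →
      {V : ℤ → Finset ℕ // IsPeriodicLaminar m V ∧ arityType m V = κ} := fun D =>
    ⟨symFamily D.1 m, isPeriodicLaminar_symFamily D.2.1.1 D.2.1.2 hm, D.2.2⟩
  have hf : Function.Bijective f := by
    constructor
    · rintro ⟨D, ⟨hD, hi⟩, h⟩ ⟨D', ⟨hD', hi'⟩, h'⟩ he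
      exact Subtype.ext (symFamily_injective hD hi hD' hi' hd hN (congrArg Subtype.val he))
    · rintro ⟨V, hV, hVκ⟩
      have h := symFamily_chordsOf hV hd hN
      exact ⟨⟨chordsOf N V, ⟨isDissection_chordsOf hV hd hN hN3,
        isInvariant_chordsOf hV hd hN⟩, by rw [h, hVκ]⟩, Subtype.ext h⟩
  rw [Nat.card_congr (Equiv.ofBijective f hf)]
  exact (card_periodicLaminar_mul s m κ hs hpos hκ).2

/-- The type of an invariant dissection: there is one cell at the centre if it has at least
three vertices, and the other cells form free orbits. -/
theorem count_cellType {m d : ℕ} (hD : IsDissection D) (hi : IsInvariant m D)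
    (hd : 2 ≤ d) (hN : N = d * m) (hN3 : 3 ≤ N) {k : ℕ} (hk : 1 ≤ k) :
    (cellType D).count k = d * (arityType m (symFamily D m)).count k +
      if k + 2 = d * (m - (arityType m (symFamily D m)).sum) then 1 else 0 := by
  have hm : 2 * m ≤ N := hN ▸ Nat.mul_le_mul_right m hd
  have hV := isPeriodicLaminar_symFamily hD hi hm
  have hR := represents_symFamily hD hi hd hN
  -- The same cells are counted through two representations: `symFamily`, with its outer cell at the
  -- centre, and `linFamily`, which defines `cellType`.
  have h1 := hR.sum_cells fun c => if c = k + 2 then 1 else 0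
  have h2 := hR.card_outerCell_add
  have h3 := sum_cells_eq hD hN3 fun c => if c = k + 2 then 1 else 0
  have hT : arityType N (symFamily D m) = d • arityType m (symFamily D m) := by
    have := hV.arityType_mul d
    rwa [← hN] at this
  have hcount : ∀ s : Multiset ℕ, (s.map fun j => if j + 2 = k + 2 then 1 else 0).sum =
      s.count k := by
    intro s
    induction s using Multiset.induction_on with
    | empty => rfl
    | cons a s ih =>
      rw [Multiset.map_cons, Multiset.sum_cons, ih, Multiset.count_cons, add_comm]
      simp only [Nat.add_right_cancel_iff, eq_comm]
  have ho : (outerCell N (symFamily D m)).card =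
      d * (m - (arityType m (symFamily D m)).sum) := by
    rw [hT, Multiset.sum_nsmul, smul_eq_mul] at h2
    rw [Nat.mul_sub, ← hN]
    omega
  rw [← hcount (cellType D), ← h3, h1, hcount, hT, Multiset.count_nsmul, ho]
  congr 1
  split_ifs <;> omega

end TypeA

namespace TypeA

/-! ### Rotating dissections -/

variable {N : ℕ} [NeZero N] {D : Finset (Sym2 (Fin N))}

/-- The rotation of a set of chords. -/
def rotateChords (g : Fin N) (D : Finset (Sym2 (Fin N))) : Finset (Sym2 (Fin N)) :=
  D.image fun d => d.map fun v => v + g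

theorem map_add_injective {N : ℕ} [NeZero N] (g : Fin N) :
    Function.Injective fun d : Sym2 (Fin N) => d.map fun v => v + g :=
  Sym2.map.injective (add_left_injective g)

theorem map_add_mem_rotateChords {g : Fin N} {d : Sym2 (Fin N)} :
    (d.map fun v => v + g) ∈ rotateChords g D ↔ d ∈ D := by
  rw [rotateChords, Finset.mem_image]
  constructor
  · rintro ⟨e, he, h⟩
    rwa [← map_add_injective g h]
  · exact fun h => ⟨d, h, rfl⟩

theorem rotateChords_zero (D : Finset (Sym2 (Fin N))) : rotateChords 0 D = D := by
  simp [rotateChords]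

theorem rotateChords_add (g h : Fin N) (D : Finset (Sym2 (Fin N))) :
    rotateChords (g + h) D = rotateChords g (rotateChords h D) := by
  rw [rotateChords, rotateChords, rotateChords, Finset.image_image]
  congr 1
  funext d
  rw [Function.comp_apply, Sym2.map_map]
  congr 1
  funext v
  rw [Function.comp_apply, add_assoc, add_comm g h]

theorem isDiagonal_map_add {d : Sym2 (Fin N)} (hd : IsDiagonal d) (g : Fin N) :
    IsDiagonal (d.map fun v => v + g) := by
  obtain ⟨a, b, rfl, h1, h2, h3⟩ := hd
  refine ⟨a + g, b + g, Sym2.map_mk .., fun h => h1 (add_right_cancel h), fun h => h2 ?_,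
    fun h => h3 ?_⟩
  · rw [add_right_comm] at h
    exact add_right_cancel h
  · rw [add_right_comm] at h
    exact add_right_cancel h

theorem IsDissection.rotateChords (hD : IsDissection D) (g : Fin N) :
    IsDissection (rotateChords g D) where
  isDiagonal := by
    intro d hd
    obtain ⟨e, he, rfl⟩ := Finset.mem_image.mp hd
    exact isDiagonal_map_add (hD.isDiagonal e he) g
  not_cross := by
    intro d hd d' hd'
    obtain ⟨e, he, rfl⟩ := Finset.mem_image.mp hd
    obtain ⟨e', he', rfl⟩ := Finset.mem_image.mp hd'
    rw [cross_map_add]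
    exact hD.not_cross e he e' he'

theorem visible_rotateChords {g x y : Fin N} :
    Visible (rotateChords g D) (x + g) (y + g) ↔ Visible D x y := by
  constructor
  · intro h d hd
    have := h _ (map_add_mem_rotateChords.mpr hd)
    rwa [← Sym2.map_mk (fun v => v + g) x y, cross_map_add] at this
  · intro h d hd
    obtain ⟨e, he, rfl⟩ := Finset.mem_image.mp hd
    rw [← Sym2.map_mk (fun v => v + g) x y, cross_map_add]
    exact h e he

theorem IsCell.image_add {Q : Finset (Fin N)} (hQ : IsCell D Q) (g : Fin N) :
    IsCell (rotateChords g D) (Q.image fun v => v + g) where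
  three_le := by
    rw [Finset.card_image_of_injective _ (add_left_injective g)]
    exact hQ.three_le
  visible := by
    intro x hx y hy
    obtain ⟨x', hx', rfl⟩ := Finset.mem_image.mp hx
    obtain ⟨y', hy', rfl⟩ := Finset.mem_image.mp hy
    exact visible_rotateChords.mpr (hQ.visible x' hx' y' hy')
  maximal := by
    intro t ht
    obtain ⟨s, rfl⟩ : ∃ s, t = s + g := ⟨t - g, (sub_add_cancel t g).symm⟩
    refine Finset.mem_image_of_mem _ (hQ.maximal s fun x hx => ?_)
    exact visible_rotateChords.mp (ht _ (Finset.mem_image_of_mem _ hx))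

theorem card_filter_cells_le (g : Fin N) (D : Finset (Sym2 (Fin N))) (k : ℕ) :
    ((cells D).filter fun Q => Q.card = k).card ≤
      ((cells (rotateChords g D)).filter fun Q => Q.card = k).card := by
  refine Finset.card_le_card_of_injOn (fun Q => Q.image fun v => v + g) ?_
    (Finset.image_injective (add_left_injective g)).injOn
  intro Q hQ
  rw [Finset.mem_coe, Finset.mem_filter, mem_cells] at hQ ⊢
  exact ⟨hQ.1.image_add g, by
    rw [Finset.card_image_of_injective _ (add_left_injective g)]
    exact hQ.2⟩

theorem cellType_rotateChords (hD : IsDissection D) (hN : 3 ≤ N) (g : Fin N) :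
    cellType (rotateChords g D) = cellType D := by
  ext k
  rw [← card_filter_cells hD hN, ← card_filter_cells (hD.rotateChords g) hN]
  refine le_antisymm ?_ (card_filter_cells_le g D _)
  have := card_filter_cells_le (-g) (rotateChords g D) (k + 2)
  rwa [← rotateChords_add, neg_add_cancel, rotateChords_zero] at this

/-- The integers whose rotations fix a set of chords. -/
def rotationStabilizer (D : Finset (Sym2 (Fin N))) : AddSubgroup ℤ where
  carrier := {u | rotateChords (vtx N u) D = D}
  zero_mem' := by
    have h0 : vtx N 0 = 0 := vtx_natCast (N := N) 0
    rw [Set.mem_ofPred_eq, h0, rotateChords_zero]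
  add_mem' := by
    intro u v hu hv
    rw [Set.mem_ofPred_eq] at *
    rw [vtx_add, rotateChords_add, hv, hu]
  neg_mem' := by
    intro u hu
    rw [Set.mem_ofPred_eq] at *
    have h0 : vtx N 0 = 0 := vtx_natCast (N := N) 0
    conv_lhs => rw [← hu]
    rw [← rotateChords_add, ← vtx_add, neg_add_cancel, h0, rotateChords_zero]

theorem mem_rotationStabilizer {u : ℤ} :
    u ∈ rotationStabilizer D ↔ rotateChords (vtx N u) D = D := Iff.rfl

/-- The stabilizer, lifted to ℤ, is a subgroup containing N, so by Bézout it contains g exactly when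
it contains gcd(N, g). -/
theorem rotateChords_eq_iff (g : Fin N) :
    rotateChords g D = D ↔ rotateChords (vtx N (N.gcd g.val : ℕ)) D = D := by
  have hg : rotateChords g D = D ↔ (g.val : ℤ) ∈ rotationStabilizer D := by
    rw [mem_rotationStabilizer, vtx_natCast]
  have hNmem : (N : ℤ) ∈ rotationStabilizer D := by
    have h0 : vtx N 0 = 0 := vtx_natCast (N := N) 0
    have := vtx_add_mul (N := N) 0 1
    rw [one_mul, zero_add] at this
    rw [mem_rotationStabilizer, this, h0, rotateChords_zero]
  rw [hg, ← mem_rotationStabilizer]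
  constructor
  · intro h
    rw [Nat.gcd_eq_gcd_ab, mul_comm, mul_comm (g.val : ℤ), ← smul_eq_mul, ← smul_eq_mul]
    exact add_mem (zsmul_mem hNmem _) (zsmul_mem h _)
  · intro h
    obtain ⟨t, ht⟩ := Nat.gcd_dvd_right N g.val
    have := zsmul_mem h (t : ℤ)
    rwa [smul_eq_mul, ← Nat.cast_mul, mul_comm, ← ht] at this

theorem isInvariant_iff {m : ℕ} : IsInvariant m D ↔ rotateChords (vtx N m) D = D := by
  constructor
  · intro h
    refine Finset.eq_of_subset_of_card_le (fun d hd => ?_) ?_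
    · obtain ⟨e, he, rfl⟩ := Finset.mem_image.mp hd
      exact (h e).mpr he
    · rw [rotateChords, Finset.card_image_of_injective _ (map_add_injective _)]
  · intro h d
    conv_lhs => rw [← h]
    exact map_add_mem_rotateChords

/-! ### The type of an invariant dissection -/

theorem sum_count_eq_card {s : Finset ℕ} {κ : Multiset ℕ} (hs : ∀ a ∈ κ, a ∈ s) :
    ∑ i ∈ s, κ.count i = κ.card :=
  Multiset.sum_count_eq_card hs

theorem sum_mul_count {s : Finset ℕ} {κ : Multiset ℕ} (hs : ∀ a ∈ κ, a ∈ s) :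
    ∑ i ∈ s, i * κ.count i = κ.sum := by
  rw [Finset.sum_multiset_count_of_subset κ s fun a ha => hs a (Multiset.mem_toFinset.mp ha)]
  exact Finset.sum_congr rfl fun i _ => by rw [smul_eq_mul, mul_comm]

variable {m d : ℕ}

/-- Free orbits contribute multiples of d, so only the central cell leaves a residue. -/
theorem sum_count_mod_le (hD : IsDissection D) (hi : IsInvariant m D) (hd : 2 ≤ d)
    (hN : N = d * m) (hN3 : 3 ≤ N) {s : Finset ℕ} (hs : ∀ i ∈ s, 1 ≤ i) :
    ∑ i ∈ s, (cellType D).count i % d ≤ 1 := by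
  classical
  have h1 : ∀ i ∈ s, (cellType D).count i % d =
      if i + 2 = d * (m - (arityType m (symFamily D m)).sum) then 1 else 0 := by
    intro i his
    rw [count_cellType hD hi hd hN hN3 (hs i his), Nat.mul_add_mod]
    split_ifs
    · exact Nat.mod_eq_of_lt hd
    · exact Nat.zero_mod d
  rw [Finset.sum_congr rfl h1, ← Finset.card_filter, Finset.card_le_one]
  intro i hi j hj
  rw [Finset.mem_filter] at hi hj
  omega

/-- The orbit type κ determines the size of the central cell, and the condition on residues says
that λ allows just such a cell, so nothing is lost in passing to quotients by d. -/
theorem cellType_eq_iff (hD : IsDissection D) (hi : IsInvariant m D) (hd : 2 ≤ d)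
    (hN : N = d * m) (hN3 : 3 ≤ N) {s : Finset ℕ} {lam κ : Multiset ℕ} (hs : ∀ i ∈ s, 1 ≤ i)
    (hlam : ∀ a ∈ lam, a ∈ s) (hsum : lam.sum + 2 = N) (hmod : ∑ i ∈ s, lam.count i % d ≤ 1)
    (hκ : ∀ i, κ.count i = lam.count i / d) :
    cellType D = lam ↔ arityType m (symFamily D m) = κ := by
  have hm : 2 * m ≤ N := hN ▸ Nat.mul_le_mul_right m hd
  have hV := isPeriodicLaminar_symFamily hD hi hm
  have hpos := pos_of_mem_arityType hV.toIsLaminar (m := m)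
  have hcount := fun k hk => count_cellType hD hi hd hN hN3 (k := k) hk
  constructor
  · rintro rfl
    ext k
    rw [hκ]
    rcases Nat.eq_zero_or_pos k with rfl | hk
    · rw [Multiset.count_eq_zero_of_notMem fun h => (hpos 0 h).ne rfl,
        Multiset.count_eq_zero_of_notMem fun h =>
          (pos_of_mem_cellType hD (by omega) 0 h).ne rfl, Nat.zero_div]
    · rw [hcount k hk, Nat.mul_add_div (by omega), Nat.div_eq_of_lt, add_zero]
      split_ifs <;> omega
  · intro h
    rw [h] at hcount
    have hκs : ∀ a ∈ κ, a ∈ s := by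
      intro a ha
      refine hlam a (Multiset.count_pos.mp ?_)
      have h1 := Multiset.count_pos.mpr ha
      rw [hκ] at h1
      exact Nat.pos_of_div_pos h1
    -- The total weight n = dm - 2 leaves, after removal of the free orbits, exactly the weight of
    -- the central cell. The value 2 on the right is the degenerate case of a diameter.
    have hC : ∑ i ∈ s, i * (lam.count i % d) + 2 = d * (m - κ.sum) := by
      have h1 : ∑ i ∈ s, i * lam.count i =
          d * ∑ i ∈ s, i * κ.count i + ∑ i ∈ s, i * (lam.count i % d) := by
        rw [Finset.mul_sum, ← Finset.sum_add_distrib]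
        refine Finset.sum_congr rfl fun i _ => ?_
        conv_lhs => rw [← Nat.div_add_mod (lam.count i) d, ← hκ]
        ring
      rw [sum_mul_count hlam, sum_mul_count hκs] at h1
      rw [Nat.mul_sub, ← hN]
      omega
    have hone : ∀ k ∈ s, lam.count k % d ≠ 0 →
        lam.count k % d = 1 ∧ ∑ i ∈ s, i * (lam.count i % d) = k := by
      intro k hk h0
      rw [← Finset.add_sum_erase s _ hk] at hmod
      have h1 : ∑ i ∈ s.erase k, lam.count i % d = 0 := by omega
      rw [Finset.sum_eq_zero_iff] at h1
      have h2 : lam.count k % d = 1 := by omega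
      refine ⟨h2, ?_⟩
      rw [← Finset.add_sum_erase s _ hk, h2, Finset.sum_eq_zero fun i hi => by
        rw [h1 i hi, mul_zero]]
      omega
    ext k
    rcases Nat.eq_zero_or_pos k with rfl | hk
    · rw [Multiset.count_eq_zero_of_notMem fun h => (pos_of_mem_cellType hD (by omega) 0 h).ne rfl,
        Multiset.count_eq_zero_of_notMem fun h => by have := hs 0 (hlam 0 h); omega]
    · rw [hcount k hk, hκ, ← hC]
      conv_rhs => rw [← Nat.div_add_mod (lam.count k) d]
      congr 1
      simp only [Nat.add_right_cancel_iff]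
      split_ifs with h1
      · have h2 : ∑ i ∈ s, i * (lam.count i % d) ≠ 0 := by omega
        obtain ⟨i, hi, h3⟩ := Finset.exists_ne_zero_of_sum_ne_zero h2
        obtain ⟨h4, h5⟩ := hone i hi fun h => h3 (by rw [h, mul_zero])
        rw [h1, h5, h4]
      · by_contra h2
        have hks : k ∈ s := hlam k (Multiset.count_pos.mp (Nat.pos_of_ne_zero fun h => by
          rw [h, Nat.zero_mod] at h2
          exact h2 rfl))
        exact h1 (hone k hks (Ne.symm h2)).2.symm

end TypeA

namespace TypeA

/-! ### Faces and dissections -/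

variable {n : ℕ} {ε : Fin 2}

theorem not_cross_self {N : ℕ} (d : Sym2 (Fin N)) : ¬ Cross d d := by
  induction d using Sym2.ind with
  | _ p q => exact cross_eq_left

theorem isFace_iff {f : Finset (Root n)} :
    IsFace ε f ↔ (∀ a ∈ f, a.IsAlmostPos) ∧ IsDissection (f.image (diagonal ε)) := by
  rw [IsFace]
  refine and_congr_right fun hf => ⟨fun h => ⟨?_, ?_⟩, fun h a ha b hb hab => ?_⟩
  · intro d hd
    obtain ⟨a, ha, rfl⟩ := Finset.mem_image.mp hd
    exact isDiagonal_diagonal (hf a ha)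
  · intro d hd e he
    obtain ⟨a, ha, rfl⟩ := Finset.mem_image.mp hd
    obtain ⟨b, hb, rfl⟩ := Finset.mem_image.mp he
    by_cases hab : a = b
    · subst hab
      exact not_cross_self _
    · exact (compat_iff ε (hf a ha) (hf b hb) hab).mp (h a ha b hb hab)
  · exact (compat_iff ε (hf a ha) (hf b hb) hab).mpr
      (h.not_cross _ (Finset.mem_image_of_mem _ ha) _ (Finset.mem_image_of_mem _ hb))

theorem hasParabolicType_iff_cellType (hn : 1 ≤ n) {f : Finset (Root n)} (hf : IsFace ε f)
    (lam : n.Partition) :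
    HasParabolicType ε f lam ↔ cellType (f.image (diagonal ε)) = lam.parts := by
  obtain ⟨h1, h2⟩ := isFace_iff.mp hf
  have hN : 3 ≤ n + 2 := by omega
  rw [hasParabolicType_iff_cells hn h1 (fun a ha b hb => h2.not_cross _
    (Finset.mem_image_of_mem _ ha) _ (Finset.mem_image_of_mem _ hb))]
  · constructor
    · intro h
      ext k
      rcases Nat.eq_zero_or_pos k with rfl | hk
      · rw [Multiset.count_eq_zero_of_notMem fun h => (pos_of_mem_cellType h2 (by omega) 0 h).ne rfl,
          Multiset.count_eq_zero_of_notMem fun h => (lam.parts_pos h).ne rfl]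
      · rw [← h k hk, card_filter_cells h2 hN]
    · intro h k hk
      rw [card_filter_cells h2 hN, h]
  · have h3 := sum_cells_eq h2 hN fun c => c - 2
    have h4 := sum_cellType h2 hN
    simp only [Nat.add_sub_cancel, Multiset.map_id'] at h3
    omega

/-- The dissections of the polygon whose cells have the sizes given by a partition. -/
abbrev TypedDissection (n : ℕ) (lam : n.Partition) : Type :=
  {D : Finset (Sym2 (Fin (n + 2))) // IsDissection D ∧ cellType D = lam.parts}

theorem image_diagonal_injOn {f f' : Finset (Root n)} (hf : ∀ a ∈ f, a.IsAlmostPos)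
    (hf' : ∀ a ∈ f', a.IsAlmostPos) (h : f.image (diagonal ε) = f'.image (diagonal ε)) :
    f = f' := by
  have key : ∀ {f f' : Finset (Root n)}, (∀ a ∈ f, a.IsAlmostPos) → (∀ a ∈ f', a.IsAlmostPos) →
      f.image (diagonal ε) = f'.image (diagonal ε) → f ⊆ f' := by
    intro f f' hf hf' h a ha
    have h1 := Finset.mem_image_of_mem (diagonal ε) ha
    rw [h] at h1
    obtain ⟨b, hb, hab⟩ := Finset.mem_image.mp h1
    rwa [← diagonal_injOn ε (hf' b hb) (hf a ha) hab]
  exact Finset.Subset.antisymm (key hf hf' h) (key hf' hf h.symm)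

/-- Faces correspond to dissections. -/
noncomputable def faceEquiv (hn : 1 ≤ n) (ε : Fin 2) (lam : n.Partition) :
    TypedFace n ε lam ≃ TypedDissection n lam :=
  Equiv.ofBijective (fun f => ⟨f.1.image (diagonal ε), (isFace_iff.mp f.2.1).2,
    (hasParabolicType_iff_cellType hn f.2.1 lam).mp f.2.2⟩) (by
    classical
    constructor
    · rintro ⟨f, hf, h⟩ ⟨f', hf', h'⟩ he
      exact Subtype.ext (image_diagonal_injOn hf.1 hf'.1 (congrArg Subtype.val he))
    · rintro ⟨D, hD, hlam⟩
      let f : Finset (Root n) := Finset.univ.filter fun a => a.IsAlmostPos ∧ diagonal ε a ∈ D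
      have hf : f.image (diagonal ε) = D := by
        ext d
        rw [Finset.mem_image]
        constructor
        · rintro ⟨a, ha, rfl⟩
          exact (Finset.mem_filter.mp ha).2.2
        · intro hd
          obtain ⟨a, ha, rfl⟩ := (bijOn_diagonal ε).surjOn (hD.isDiagonal d hd)
          exact ⟨a, Finset.mem_filter.mpr ⟨Finset.mem_univ a, ha, hd⟩, rfl⟩
      have hface : IsFace ε f := isFace_iff.mpr
        ⟨fun a ha => (Finset.mem_filter.mp ha).2.1, hf.symm ▸ hD⟩
      exact ⟨⟨f, hface, (hasParabolicType_iff_cellType hn hface lam).mpr (by rw [hf, hlam])⟩,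
        Subtype.ext hf⟩)

/-- The rotations of the polygon act on the dissections. -/
noncomputable abbrev dissectionAction (hn : 1 ≤ n) (lam : n.Partition) :
    MulAction (Multiplicative (ZMod (n + 2))) (TypedDissection n lam) where
  smul g D := ⟨rotateChords (Multiplicative.toAdd g : Fin (n + 2)) D.1, D.2.1.rotateChords _, by
    rw [cellType_rotateChords D.2.1 (by omega), D.2.2]⟩
  one_smul D := Subtype.ext (rotateChords_zero D.1)
  mul_smul g h D := Subtype.ext (rotateChords_add _ _ D.1)

theorem image_diagonal_image_rotate {f : Finset (Root n)} (hf : ∀ a ∈ f, a.IsAlmostPos) :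
    (f.image (rotate ε)).image (diagonal ε) = rotateChords 1 (f.image (diagonal ε)) := by
  rw [rotateChords, Finset.image_image, Finset.image_image]
  exact Finset.image_congr fun a ha => diagonal_rotate ε (hf a ha)

/-- The action of the cyclic group on the faces of a given type. -/
noncomputable abbrev faceAction (hn : 1 ≤ n) (ε : Fin 2) (lam : n.Partition) :
    MulAction (Multiplicative (ZMod (n + 2))) (TypedFace n ε lam) :=
  letI := dissectionAction hn lam
  (faceEquiv hn ε lam).mulAction (Multiplicative (ZMod (n + 2)))

theorem faceAction_smul (hn : 1 ≤ n) (lam : n.Partition) (g : Multiplicative (ZMod (n + 2)))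
    (f : TypedFace n ε lam) :
    faceEquiv hn ε lam ((faceAction hn ε lam).smul g f) =
      (dissectionAction hn lam).smul g (faceEquiv hn ε lam f) :=
  (faceEquiv hn ε lam).apply_symm_apply _

theorem faceAction_smul_one (hn : 1 ≤ n) (lam : n.Partition) (f : TypedFace n ε lam) :
    ((faceAction hn ε lam).smul (Multiplicative.ofAdd 1) f).1 = f.1.image (rotate ε) := by
  refine image_diagonal_injOn (ε := ε)
    ((faceAction hn ε lam).smul (Multiplicative.ofAdd 1) f).2.1.1 ?_ ?_
  · intro a ha
    obtain ⟨b, hb, rfl⟩ := Finset.mem_image.mp ha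
    exact rotate_isAlmostPos ε (f.2.1.1 b hb)
  · rw [image_diagonal_image_rotate f.2.1.1]
    exact congrArg Subtype.val (faceAction_smul hn lam (Multiplicative.ofAdd 1) f)

/-- An element g of ℤ/N has order N / gcd(N, g), so g and the rotation by m = N/d fix the same
dissections. -/
theorem gcd_val_eq {g : Multiplicative (ZMod (n + 2))} {d m : ℕ} (hd : orderOf g = d)
    (hm : n + 2 = d * m) :
    (n + 2).gcd (Fin.val (Multiplicative.toAdd g : Fin (n + 2))) = m := by
  have h1 : addOrderOf (Multiplicative.toAdd g) = d := by
    rw [← hd]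
    exact (orderOf_ofAdd_eq_addOrderOf (Multiplicative.toAdd g)).symm
  have h2 : ((ZMod.val (Multiplicative.toAdd g) : ℕ) : ZMod (n + 2)) = Multiplicative.toAdd g :=
    ZMod.natCast_zmod_val _
  rw [← h2, ZMod.addOrderOf_coe _ (by omega)] at h1
  have h3 := Nat.div_mul_cancel (Nat.gcd_dvd_left (n + 2) (ZMod.val (Multiplicative.toAdd g)))
  rw [h1] at h3
  have h4 : 0 < d := Nat.pos_of_ne_zero fun h => by rw [h] at hm; omega
  exact Nat.eq_of_mul_eq_mul_left h4 (h3.trans hm)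

/-- The faces fixed by a rotation. -/
theorem card_fixedBy (hn : 1 ≤ n) (lam : n.Partition) (g : Multiplicative (ZMod (n + 2)))
    {d m : ℕ} (hd : orderOf g = d) (hm : n + 2 = d * m) :
    Nat.card (@MulAction.fixedBy _ (TypedFace n ε lam) _ (faceAction hn ε lam) g) =
      Nat.card {D : Finset (Sym2 (Fin (n + 2))) //
        (IsDissection D ∧ cellType D = lam.parts) ∧ IsInvariant m D} := by
  let := faceAction hn ε lam
  have hfix : ∀ f : TypedFace n ε lam, f ∈ MulAction.fixedBy (TypedFace n ε lam) g ↔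
      IsInvariant m (faceEquiv hn ε lam f).1 := by
    intro f
    rw [isInvariant_iff, ← gcd_val_eq hd hm, ← rotateChords_eq_iff, MulAction.mem_fixedBy,
      ← (faceEquiv hn ε lam).injective.eq_iff]
    change faceEquiv hn ε lam ((faceAction hn ε lam).smul g f) = _ ↔ _
    rw [faceAction_smul, Subtype.ext_iff]
    rfl
  refine Nat.card_congr (((faceEquiv hn ε lam).subtypeEquiv
    (q := fun D : TypedDissection n lam => IsInvariant m D.1) hfix).trans ?_)
  exact Equiv.subtypeSubtypeEquivSubtypeInter _ _

theorem parts_mem_Icc_and_card_pos (hn : 1 ≤ n) (lam : n.Partition) :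
    (∀ a ∈ lam.parts, a ∈ Finset.Icc 1 n) ∧ 1 ≤ lam.parts.card := by
  refine ⟨fun a ha => Finset.mem_Icc.mpr ⟨lam.parts_pos ha, lam.le_of_mem_parts ha⟩, ?_⟩
  rw [Nat.one_le_iff_ne_zero, Ne, Multiset.card_eq_zero]
  intro h
  have := lam.parts_sum
  rw [h, Multiset.sum_zero] at this
  omega

/-- The cyclic sieving phenomenon for dissections with given sizes of cells. -/
theorem aeval_eq_card_invariant (hn : 1 ≤ n) (lam : n.Partition) {μ : ℤ[X]}
    (hμ : μ * ((∏ i ∈ Finset.Icc 1 n, qFactorial (lam.parts.count i)) * qFactorial (n + 1)) =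
      qFactorial (n + lam.parts.card)) {d m : ℕ} (hm : d * m = n + 2) {z : ℂ}
    (hz : IsPrimitiveRoot z d) :
    aeval z μ = (Nat.card {D : Finset (Sym2 (Fin (n + 2))) //
      (IsDissection D ∧ cellType D = lam.parts) ∧ IsInvariant m D} : ℂ) := by
  obtain ⟨hs, -⟩ := parts_mem_Icc_and_card_pos hn lam
  have hs1 : ∀ i ∈ Finset.Icc 1 n, 1 ≤ i := fun i hi => (Finset.mem_Icc.mp hi).1
  have hl := sum_count_eq_card hs
  have hw := sum_mul_count hs
  rw [lam.parts_sum] at hw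
  have hd0 : d ≠ 0 := fun h => by rw [h] at hm; omega
  rcases (show d = 1 ∨ 2 ≤ d by omega) with rfl | hd
  · rw [IsPrimitiveRoot.one_right_iff] at hz
    subst hz
    rw [one_mul] at hm
    subst hm
    have hinv : ∀ D : Finset (Sym2 (Fin (n + 2))), IsInvariant (n + 2) D := by
      intro D
      have h0 : vtx (n + 2) ((n + 2 : ℕ) : ℤ) = 0 := by
        have := vtx_add_mul (N := n + 2) 0 1
        rw [one_mul, zero_add] at this
        rw [this]
        exact vtx_natCast (N := n + 2) 0
      rw [isInvariant_iff, h0, rotateChords_zero]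
    have h1 := card_dissections_mul (N := n + 2) (by omega) (Finset.Icc 1 n) lam.parts hs
      (fun a ha => lam.parts_pos ha) (by rw [lam.parts_sum])
    have h2 : Nat.card {D : Finset (Sym2 (Fin (n + 2))) //
        (IsDissection D ∧ cellType D = lam.parts) ∧ IsInvariant (n + 2) D} =
        Nat.card {D : Finset (Sym2 (Fin (n + 2))) // IsDissection D ∧ cellType D = lam.parts} :=
      Nat.card_congr (Equiv.subtypeEquivRight fun D => and_iff_left (hinv D))
    have h3 := congrArg (aeval (1 : ℂ)) hμ
    rw [map_mul, map_mul, map_prod, aeval_one_qFactorial, aeval_one_qFactorial] at h3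
    simp only [aeval_one_qFactorial] at h3
    rw [show n + 2 - 1 = n + 1 by omega, Nat.add_sub_cancel] at h1
    rw [h2]
    have h4 := congrArg (Nat.cast (R := ℂ)) h1
    push_cast at h4
    rw [mul_comm ((n + 1).factorial : ℂ), ← h3] at h4
    refine (mul_right_cancel₀ ?_ h4).symm
    refine mul_ne_zero (Finset.prod_ne_zero_iff.mpr fun i _ => ?_) ?_ <;>
      exact_mod_cast Nat.factorial_ne_zero _
  · obtain ⟨k1, k2⟩ := aeval_mu (Finset.Icc 1 n) (fun i => lam.parts.count i) id n _ d m hd hm hl hw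
      hz μ hμ
    have hN3 : 3 ≤ n + 2 := by omega
    rcases (show 2 ≤ ∑ i ∈ Finset.Icc 1 n, lam.parts.count i % d ∨
      ∑ i ∈ Finset.Icc 1 n, lam.parts.count i % d ≤ 1 by omega) with h | h
    · rw [k1 h]
      have : IsEmpty {D : Finset (Sym2 (Fin (n + 2))) //
          (IsDissection D ∧ cellType D = lam.parts) ∧ IsInvariant m D} := by
        refine ⟨fun D => ?_⟩
        have h1 := sum_count_mod_le D.2.1.1 D.2.2 hd hm.symm hN3 hs1
        rw [D.2.1.2] at h1
        omega
      rw [Nat.card_of_isEmpty, Nat.cast_zero]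
    -- The only possible type of the free orbits: each part occurs ⌊count/d⌋ times.
    · let κ : Multiset ℕ := ∑ i ∈ Finset.Icc 1 n, Multiset.replicate (lam.parts.count i / d) i
      have hκ : ∀ j, κ.count j = lam.parts.count j / d := by
        intro j
        rw [Multiset.count_sum']
        simp only [Multiset.count_replicate]
        rw [Finset.sum_ite_eq' (Finset.Icc 1 n) j]
        split_ifs with hj
        · rfl
        · rw [Multiset.count_eq_zero_of_notMem fun h => hj (hs j h), Nat.zero_div]
      have hκs : ∀ a ∈ κ, a ∈ Finset.Icc 1 n := by
        intro a ha
        obtain ⟨i, hi, hai⟩ := Multiset.mem_sum.mp ha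
        rwa [Multiset.eq_of_mem_replicate hai]
      have hκsum : κ.sum < m := by
        have h1 : d * κ.sum ≤ n := by
          rw [← sum_mul_count hκs, Finset.mul_sum]
          refine (Finset.sum_le_sum (g := fun i => i * lam.parts.count i) fun i _ => ?_).trans hw.le
          rw [hκ, mul_left_comm]
          exact Nat.mul_le_mul_left i (Nat.mul_div_le _ d)
        exact lt_of_mul_lt_mul_left (show d * κ.sum < d * m by omega) (Nat.zero_le d)
      have h1 := card_invariant_dissections_mul (N := n + 2) hd hm.symm hN3 (Finset.Icc 1 n) κ hκs
        (fun a ha => hs1 a (hκs a ha)) hκsum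
      have h2 : Nat.card {D : Finset (Sym2 (Fin (n + 2))) //
          (IsDissection D ∧ cellType D = lam.parts) ∧ IsInvariant m D} =
          Nat.card {D : Finset (Sym2 (Fin (n + 2))) //
            (IsDissection D ∧ IsInvariant m D) ∧ arityType m (symFamily D m) = κ} := by
        refine Nat.card_congr (Equiv.subtypeEquivRight fun D => ?_)
        rw [and_right_comm]
        refine and_congr_right fun hD => ?_
        exact cellType_eq_iff hD.1 hD.2 hd hm.symm hN3 hs1 hs (by rw [lam.parts_sum]) h hκ
      have h3 := k2 h
      rw [h2]
      have h4 := congrArg (Nat.cast (R := ℂ)) h1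
      rw [← sum_count_eq_card hκs] at h4
      simp only [hκ] at h4
      push_cast at h4
      rw [← h3] at h4
      refine (mul_right_cancel₀ ?_ h4).symm
      refine mul_ne_zero ?_ (Finset.prod_ne_zero_iff.mpr fun i _ => ?_) <;>
        exact_mod_cast Nat.factorial_ne_zero _

end TypeA

theorem theorem5p2 (n : ℕ) (hn : 1 ≤ n) (ε : Fin 2) :
    -- the rotation of the cluster complex is the rotation of the polygon with n + 2 vertices
    (∃ ψ : TypeA.Root n → Sym2 (Fin (n + 2)),
      Set.BijOn ψ {a | a.IsAlmostPos} {d | TypeA.IsDiagonal d} ∧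
      (∀ a : TypeA.Root n, a.IsAlmostPos →
        (TypeA.rotate ε a).IsAlmostPos ∧ ψ (TypeA.rotate ε a) = (ψ a).map (fun v => v + 1)) ∧
      (∀ a b : TypeA.Root n, a.IsAlmostPos → b.IsAlmostPos → a ≠ b →
        (TypeA.Compat ε a b ↔ ¬ TypeA.Cross (ψ a) (ψ b)))) ∧
    -- cyclic sieving on the faces of each parabolic type
    ∀ lam : n.Partition,
      ∃ act : MulAction (Multiplicative (ZMod (n + 2))) (TypeA.TypedFace n ε lam),
        (∀ f : TypeA.TypedFace n ε lam,
          (act.smul (Multiplicative.ofAdd 1) f).1 = f.1.image (TypeA.rotate ε)) ∧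
        ∃ M μ : ℤ[X],
          M * ((∏ i ∈ Finset.Icc 1 n, qFactorial (lam.parts.count i)) * qFactorial n)
            = qFactorial (n + lam.parts.card) ∧
          qInt (n + 1) * μ = M ∧
          ExhibitsCSP (Multiplicative (ZMod (n + 2))) (TypeA.TypedFace n ε lam) μ := by
  refine ⟨⟨TypeA.diagonal ε, TypeA.bijOn_diagonal ε,
    fun a ha => ⟨TypeA.rotate_isAlmostPos ε ha, TypeA.diagonal_rotate ε ha⟩,
    fun a b ha hb hab => TypeA.compat_iff ε ha hb hab⟩, fun lam => ?_⟩
  obtain ⟨hs, hl⟩ := TypeA.parts_mem_Icc_and_card_pos hn lam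
  have hsum := TypeA.sum_count_eq_card hs
  have hw := TypeA.sum_mul_count hs
  rw [lam.parts_sum] at hw
  -- The denominator used throughout has [n+1]_q! instead of [n]_q!, so μ comes first and the
  -- q-multinomial coefficient is recovered as [n+1]_q μ.
  obtain ⟨μ, hμ⟩ := exists_mul_qFactorial (Finset.Icc 1 n) (fun i => lam.parts.count i) id n _ hl
    hsum hw
  refine ⟨TypeA.faceAction hn ε lam, TypeA.faceAction_smul_one hn lam, qInt (n + 1) * μ, μ, ?_, rfl,
    fun g => ?_⟩
  · rw [← hμ, qFactorial_succ]
    ring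
  · obtain ⟨m, hm⟩ : orderOf g ∣ n + 2 := by
      have := orderOf_dvd_natCard g
      rwa [Nat.card_eq_fintype_card, Fintype.card_multiplicative, ZMod.card] at this
    rw [TypeA.card_fixedBy hn lam g rfl hm]
    exact TypeA.aeval_eq_card_invariant hn lam hμ hm.symm
      (Complex.isPrimitiveRoot_exp _ (orderOf_pos g).ne')
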